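/- Let $V$ be a real vector space of finite dimension $n$ with a volume form $\Omega_V\neq 0$, let $W=V^*$ carry the dual volume form $\Omega_W$, and let $P\subset W$ be a simple convex polytope of dimension $n$ (exactly $n$ facets meet at each vertex), with facets $P_1,\dots,P_m$ and chosen outward normal covectors $\xi_1,\dots,\xi_m\in V$ (so $\xi_i|_P$ attains its maximum exactly on $P_i$). *Timorin's polytope algebra.* Two polytopes are analogous if their facets can be matched so that matched facets have the same outward normal direction and are (recursively) analogous; any two segments on a line are analogous. Let $\mathcal P(P)$ be the vector space of formal differences of polytopes analogous to $P$ (with Minkowski addition and dilation). The support numbers $H_i(Q)=\max_{Q}\xi_i$ form a system of linear coordinates on $\mathcal P(P)$, and the volume $\mathrm{Vol}(Q)=\left|\int_Q\Omega_W\right|$ extends to a homogeneous polynomial $\mathrm{Vol}$ of degree $n$ on $\mathcal P(P)$. Let $\mathrm{Diff}=\mathbb R[\partial_1,\dots,\partial_m]$, $\partial_i=\partial/\partial H_i$, and $A(P)=\mathrm{Diff}/\{d: d\,\mathrm{Vol}=0\}=\bigoplus_k A_k(P)$, graded by the order of operators. Put $L_P=\sum_i H_i(P)\,\partial_i\in A_1(P)$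 and $(a,b)_T=ab\,\mathrm{Vol}\in\mathbb R$ for $a\in A_k(P)$, $b\in A_{n-k}(P)$, extended bilinearly by zero to the other pairs of degrees. *Brion's algebra.* Let $\Phi$ be the outer normal fan of $P$, consisting of the cones $\sigma_F=\{v\in V: \langle f-p,v\rangle\ge 0 \text{ for all } f\in F,\ p\in P\}$ for the nonempty faces $F$ of $P$; it is complete. Let $\mathcal A(\Phi)$ be the algebra of functions on $V$ whose restriction to each cone of $\Phi$ is polynomial, graded so that functions homogeneous of polynomial degree $k$ have degree $2k$; let $A^+$ be the ideal of polynomial functions on $V$ without constant term in the algebra $A=\mathrm{Sym}\,V^*$, and $H(\Phi)=\mathcal A(\Phi)/A^+\mathcal A(\Phi)=\bigoplus_k H^{2k}(\Phi)$. For an $n$-dimensional cone $\sigma\in\Phi$ let $\mathcal F_\sigma$ be the product of linear equations $\ell_1,\dots,\ell_n$ of the facets of $\sigma$, nonnegative on $\sigma$ and normalized by $\ell_1\wedge\dots\wedge\ell_n=\pm\Omega_V$ (if $n=0$, $\mathcal F_\sigma=|\Omega_V|$). For $f\in\mathcal A(\Phi)$ the rational function $\zeta(f)=\sum_{\dim\sigma=n}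 f_\sigma/\mathcal F_\sigma$ is a polynomial, where $f_\sigma\in A$ is the polynomial with $f_\sigma=f$ on $\sigma$; the value $\zeta(f)(0)$ depends only on the class of $f$ in $H(\Phi)$ and defines $\bar\zeta:H(\Phi)\to A/A^+=\mathbb R$. Put $(x,y)_B=\bar\zeta(xy)$. Let $H_P(v)=\max_{y\in P}\langle y,v\rangle$ be the support function of $P$, an element of $\mathcal A(\Phi)$. **Theorem 4.16.** With this notation (including the assertions above that the $H_i$ are linear coordinates on $\mathcal P(P)$, that the volume extends to a homogeneous polynomial of degree $n$, and that $\zeta$ and $\bar\zeta$ are well defined), there is an isomorphism of $\mathbb R$-algebras $\beta:A(P)\to H(\Phi)$ such that 1. (naturality) for each $i$, $\beta(\partial_i)$ is the class of a piecewise linear function $\chi_i\in\mathcal A(\Phi)$ with $\chi_i(\xi_i)=1$ and $\chi_i(\xi_j)=0$ for $j\ne i$; 2. $\beta(A_k(P))=H^{2k}(\Phi)$ for every $k\ge 0$; 3. $\beta(L_P)$ is the class of $H_P$; 4. $(a,b)_T=(\beta(a),\beta(b))_B$ for all $a,b\in A(P)$. -/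

import Mathlib

open Module

namespace PolytopeAlgebra

noncomputable section

/-! ## Convex polytopes in `W = V*` -/

section Polytopes

variable {V : Type*} [AddCommGroup V] [Module ℝ V]

/-- A convex polytope in `W = V*`: the convex hull of a finite nonempty set. -/
def IsPolytope (P : Set (Dual ℝ V)) : Prop :=
  ∃ S : Set (Dual ℝ V), S.Finite ∧ S.Nonempty ∧ convexHull ℝ S = P

/-- The dimension of (the affine hull of) a nonempty subset of `W`. -/
def dimP (P : Set (Dual ℝ V)) : ℕ := finrank ℝ (vectorSpan ℝ P)

/-- The points of `P` at which the linear function `v` on `W` attains its maximum over `P`. -/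
def faceAt (P : Set (Dual ℝ V)) (v : V) : Set (Dual ℝ V) :=
  {y | y ∈ P ∧ ∀ z ∈ P, z v ≤ y v}

/-- Nonempty faces of `P` (including `P` itself, which is `faceAt P 0`). -/
def IsFace (P F : Set (Dual ℝ V)) : Prop := F.Nonempty ∧ ∃ v : V, F = faceAt P v

/-- Hyperplane faces: faces of codimension one in `P`. -/
def IsFacet (P F : Set (Dual ℝ V)) : Prop := IsFace P F ∧ dimP F + 1 = dimP P

/-- A simple convex polytope of full dimension `n = dim V` in `W`: at each vertex there meet
exactly `n` faces of dimension `n - 1`. -/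
structure IsSimplePolytope (P : Set (Dual ℝ V)) : Prop where
  isPolytope : IsPolytope P
  full_dim : dimP P = finrank ℝ V
  simple : ∀ p, IsFace P {p} → {F | IsFacet P F ∧ p ∈ F}.encard = finrank ℝ V

/-- Analogous polytopes of dimension `k`, by recursion on `k`. Two points are analogous. Two
polytopes of dimension `k + 1`, lying in parallel affine subspaces, are analogous if their
hyperplane faces can be matched bijectively so that matched faces have a common outward normal
`v` and are analogous. (For `k = 1`: any two segments on parallel lines are analogous.) -/
def Analogous : ℕ → Set (Dual ℝ V) → Set (Dual ℝ V) → Prop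
  | 0, P, Q => (∃ p, P = {p}) ∧ (∃ q, Q = {q})
  | k + 1, P, Q =>
      dimP P = k + 1 ∧ vectorSpan ℝ P = vectorSpan ℝ Q ∧
      ∃ e : {F // IsFacet P F} ≃ {G // IsFacet Q G}, ∀ F : {F // IsFacet P F},
        (∃ v : V, F.1 = faceAt P v ∧ (e F).1 = faceAt Q v) ∧ Analogous k F.1 (e F).1

/-- `𝒫⁺(P)`: the polytopes analogous to the full dimensional polytope `P`. -/
def analogousPolytopes (P : Set (Dual ℝ V)) : Set (Set (Dual ℝ V)) :=
  {Q | IsPolytope Q ∧ Analogous (finrank ℝ V) P Q}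

/-- The support function `H_P(v) = max_{y ∈ P} ⟨y, v⟩`. -/
def supportFn (P : Set (Dual ℝ V)) (v : V) : ℝ := sSup ((fun y : Dual ℝ V => y v) '' P)

/-- `𝒫(P)`: the vector space of formal differences of polytopes in `𝒫⁺(P)`. A polytope is
recorded by its support function, which turns Minkowski sums and dilations into sums and positive
multiples of functions. -/
def virtualPolytopes (P : Set (Dual ℝ V)) : Submodule ℝ (V → ℝ) :=
  Submodule.span ℝ (supportFn '' analogousPolytopes P)

/-- `ξ` is a choice of outward normal covectors of the hyperplane faces of `P`, each hyperplane
face being listed exactly once. -/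
def IsFacetNormals {ι : Type*} (P : Set (Dual ℝ V)) (ξ : ι → V) : Prop :=
  Set.BijOn (fun i => faceAt P (ξ i)) Set.univ {F | IsFacet P F}

/-- The volume of a subset of `W` for the volume form on `W` which is dual to the volume form `Ω`
on `V`: in the coordinates `w ↦ (w (b i))` given by a basis `b` of `V`, it is Lebesgue measure
divided by `|Ω b|` (this does not depend on `b`). -/
def vol [FiniteDimensional ℝ V] (Ω : V [⋀^Fin (finrank ℝ V)]→ₗ[ℝ] ℝ) (Q : Set (Dual ℝ V)) : ℝ :=
  (MeasureTheory.volume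
    ((fun (w : Dual ℝ V) (i : Fin (finrank ℝ V)) => w (finBasis ℝ V i)) '' Q)).toReal
      / |Ω (finBasis ℝ V)|

end Polytopes

/-! ## The polytope algebra -/

section Diff

variable {ι : Type*}

/-- Partial derivatives, as commuting linear operators on polynomials. -/
def partialOp (i : ι) : End ℝ (MvPolynomial ι ℝ) := (MvPolynomial.pderiv i).toLinearMap

theorem partialOp_comm (i j : ι) : partialOp i * partialOp j = partialOp j * partialOp i := by
  have h : ⁅(MvPolynomial.pderiv i : Derivation ℝ (MvPolynomial ι ℝ) (MvPolynomial ι ℝ)),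
      (MvPolynomial.pderiv j : Derivation ℝ (MvPolynomial ι ℝ) (MvPolynomial ι ℝ))⁆ = 0 := by
    classical
    apply MvPolynomial.derivation_ext
    intro k
    simp only [Derivation.commutator_apply, MvPolynomial.pderiv_X, Derivation.coe_zero,
      Pi.zero_apply, Pi.single_apply]
    split_ifs <;> simp
  refine LinearMap.ext fun q => ?_
  have := congrArg (fun D => D q) h
  simp only [Derivation.commutator_apply, Derivation.coe_zero, Pi.zero_apply, sub_eq_zero] at this
  exact this

/-- The algebra of constant coefficient differential operators, written as the polynomial ring
with generators `∂_i = X i`, acting on polynomials in the coordinates `H_i`: `X i` acts as the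
partial derivative `∂/∂H_i`. -/
def diffHom : MvPolynomial ι ℝ →ₐ[ℝ] End ℝ (MvPolynomial ι ℝ) :=
  have : IsMulCommutative (Algebra.adjoin ℝ (Set.range (partialOp (ι := ι)))) :=
    Algebra.isMulCommutative_adjoin ℝ (by
      rintro _ ⟨i, rfl⟩ _ ⟨j, rfl⟩
      exact partialOp_comm i j)
  open scoped IsMulCommutative in
  (Algebra.adjoin ℝ (Set.range (partialOp (ι := ι)))).val.comp
    (MvPolynomial.aeval fun i => ⟨partialOp i, Algebra.subset_adjoin ⟨i, rfl⟩⟩)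

theorem diffHom_X (i : ι) (q : MvPolynomial ι ℝ) :
    diffHom (MvPolynomial.X i) q = MvPolynomial.pderiv i q := by
  simp [diffHom, partialOp]

/-- The ideal of the operators which annihilate a polynomial `q`. -/
def annIdeal (q : MvPolynomial ι ℝ) : Ideal (MvPolynomial ι ℝ) where
  carrier := {d | diffHom d q = 0}
  zero_mem' := by simp
  add_mem' := by
    intro a b ha hb
    change diffHom (a + b) q = 0
    rw [map_add, LinearMap.add_apply, show diffHom a q = 0 from ha, show diffHom b q = 0 from hb,
      add_zero]
  smul_mem' := by
    intro c d hd
    change diffHom (c * d) q = 0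
    rw [map_mul, Module.End.mul_apply, show diffHom d q = 0 from hd, map_zero]

end Diff

section Algebra

variable {V : Type*} [AddCommGroup V] [Module ℝ V] [FiniteDimensional ℝ V] {ι : Type*}

/-- `q`, as a polynomial in the coordinates `H_i = ξ_i` on `𝒫(P)`, is homogeneous of degree
`n = dim V` and extends the volume function on `𝒫⁺(P)`. -/
def IsVolumePolynomial (Ω : V [⋀^Fin (finrank ℝ V)]→ₗ[ℝ] ℝ) (P : Set (Dual ℝ V)) (ξ : ι → V)
    (q : MvPolynomial ι ℝ) : Prop :=
  q.IsHomogeneous (finrank ℝ V) ∧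
    ∀ Q ∈ analogousPolytopes P, MvPolynomial.eval (fun i => supportFn Q (ξ i)) q = vol Ω Q

/-- The volume polynomial of `P`. -/
def volPoly (Ω : V [⋀^Fin (finrank ℝ V)]→ₗ[ℝ] ℝ) (P : Set (Dual ℝ V)) (ξ : ι → V) :
    MvPolynomial ι ℝ :=
  Classical.epsilon (IsVolumePolynomial Ω P ξ)

/-- The polytope algebra `A(P) = Diff / {d | d Vol = 0}`. -/
abbrev PolyAlg (Ω : V [⋀^Fin (finrank ℝ V)]→ₗ[ℝ] ℝ) (P : Set (Dual ℝ V)) (ξ : ι → V) : Type _ :=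
  MvPolynomial ι ℝ ⧸ annIdeal (volPoly Ω P ξ)

variable (Ω : V [⋀^Fin (finrank ℝ V)]→ₗ[ℝ] ℝ) (P : Set (Dual ℝ V)) (ξ : ι → V)

/-- The class of `∂_i` in `A(P)`. -/
def del (i : ι) : PolyAlg Ω P ξ := Ideal.Quotient.mk _ (MvPolynomial.X i)

/-- The graded piece `A_k(P)`: the classes of the operators which are homogeneous of order `k`. -/
def gradedA (k : ℕ) : Submodule ℝ (PolyAlg Ω P ξ) :=
  (MvPolynomial.homogeneousSubmodule ι ℝ k).map
    (Ideal.Quotient.mkₐ ℝ (annIdeal (volPoly Ω P ξ))).toLinearMap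

/-- `L_P = ∑ H_i(P) ∂_i`. -/
def lefschetz [Fintype ι] : PolyAlg Ω P ξ := ∑ i, supportFn P (ξ i) • del Ω P ξ i

/-- The linear function `[d] ↦ (d Vol)(0)` on `A(P)`. On `A_n(P)` it is `d ↦ d Vol`, a constant;
on `A_k(P)` with `k ≠ n` it vanishes. -/
def evalVol : PolyAlg Ω P ξ →ₗ[ℝ] ℝ :=
  ((annIdeal (volPoly Ω P ξ)).restrictScalars ℝ).liftQ
    { toFun := fun d => MvPolynomial.constantCoeff (diffHom d (volPoly Ω P ξ))
      map_add' := by intro a b; simp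
      map_smul' := by intro c a; simp }
    (by
      intro d hd
      have hd' : diffHom d (volPoly Ω P ξ) = 0 := hd
      simp [hd'])

/-- Timorin's pairing `(a, b)_T = a b Vol`, extended by zero from `A_k(P) × A_{n-k}(P)`. -/
def pairingT (a b : PolyAlg Ω P ξ) : ℝ := evalVol Ω P ξ (a * b)

end Algebra

/-! ## Fans and piecewise polynomial functions -/

section Fans

variable {V : Type*} [AddCommGroup V] [Module ℝ V]

/-- The cone `σ_F ⊆ V` dual to the cone in `W` generated by the vectors `f - p`, `f ∈ F`,
`p ∈ P`. -/
def normalCone (P F : Set (Dual ℝ V)) : Set V := {v | ∀ f ∈ F, ∀ p ∈ P, 0 ≤ (f - p) v}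

/-- The outer normal fan of `P`, as the set of its cones. -/
def normalFan (P : Set (Dual ℝ V)) : Set (Set V) := {σ | ∃ F, IsFace P F ∧ σ = normalCone P F}

/-- The cones of the normal fan of a polytope cover `V`. -/
theorem normalFan_complete {P : Set (Dual ℝ V)} (hP : IsPolytope P) (v : V) :
    ∃ σ ∈ normalFan P, v ∈ σ := by
  obtain ⟨S, hfin, hne, rfl⟩ := hP
  obtain ⟨y, hyS, hy⟩ := hfin.exists_maximalFor (fun y : Dual ℝ V => y v) S hne
  have hmax : ∀ z ∈ convexHull ℝ S, z v ≤ y v := by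
    intro z hz
    have hconv : ConvexOn ℝ Set.univ (fun y : Dual ℝ V => y v) :=
      (Dual.eval ℝ V v).convexOn convex_univ
    obtain ⟨x, hx, hzx⟩ := hconv.exists_ge_of_mem_convexHull (Set.subset_univ S) hz
    exact hzx.trans ((le_total (x v) (y v)).elim id fun h => hy hx h)
  refine ⟨_, ⟨faceAt _ v, ⟨⟨y, subset_convexHull ℝ S hyS, hmax⟩, v, rfl⟩, rfl⟩, ?_⟩
  intro f hf p hp
  simpa using hf.2 p hp

/-- The normal fan of a polytope is finite. -/
theorem normalFan_finite {P : Set (Dual ℝ V)} (hP : IsPolytope P) : (normalFan P).Finite := by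
  classical
  obtain ⟨S, hfin, -, rfl⟩ := hP
  have key : ∀ F, IsFace (convexHull ℝ S) F → F ⊆ convexHull ℝ (S ∩ F) := by
    rintro F ⟨-, v, rfl⟩ y ⟨hyP, hy⟩
    rw [hfin.convexHull_eq] at hyP
    obtain ⟨w, hw0, hw1, rfl⟩ := hyP
    set y := hfin.toFinset.centerMass w id with hydef
    have hyv : y v = ∑ x ∈ hfin.toFinset, w x * x v := by
      rw [hydef, Finset.centerMass_eq_of_sum_1 _ _ hw1]
      simp [LinearMap.sum_apply]
    have hsum : ∑ x ∈ hfin.toFinset, w x * (y v - x v) = 0 := by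
      simp only [mul_sub, Finset.sum_sub_distrib, ← Finset.sum_mul, hw1, ← hyv]
      ring
    have hle : ∀ x ∈ S, x v ≤ y v := fun x hx => hy x (subset_convexHull ℝ S hx)
    have hz := (Finset.sum_eq_zero_iff_of_nonneg (fun x hx => mul_nonneg
      (hw0 x (by simpa using hx)) (sub_nonneg.2 (hle x (by simpa using hx))))).1 hsum
    rw [hydef, ← Finset.centerMass_filter_ne_zero]
    refine Finset.centerMass_mem_convexHull _ ?_ ?_ ?_
    · intro x hx
      exact hw0 x (by simpa using (Finset.mem_filter.1 hx).1)
    · rw [Finset.sum_filter_ne_zero, hw1]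
      exact one_pos
    · intro x hx
      obtain ⟨hxS, hwx⟩ := Finset.mem_filter.1 hx
      have hxS' : x ∈ S := by simpa using hxS
      have hxv : y v - x v = 0 := (mul_eq_zero.1 (hz x hxS)).resolve_left hwx
      refine ⟨hxS', subset_convexHull ℝ S hxS', fun z hz' => ?_⟩
      rw [id, ← sub_eq_zero.1 hxv]
      exact hy z hz'
  have key' : ∀ F, IsFace (convexHull ℝ S) F → F = convexHull ℝ (S ∩ F) := by
    intro F hF
    refine (key F hF).antisymm (convexHull_min Set.inter_subset_right ?_)
    obtain ⟨-, v, rfl⟩ := hF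
    intro x hx y hy a b ha hb hab
    refine ⟨convex_convexHull ℝ S hx.1 hy.1 ha hb hab, fun z hz => ?_⟩
    have h1 := mul_le_mul_of_nonneg_left (hx.2 z hz) ha
    have h2 := mul_le_mul_of_nonneg_left (hy.2 z hz) hb
    have h3 : a * z v + b * z v = z v := by rw [← add_mul, hab, one_mul]
    simp only [LinearMap.add_apply, LinearMap.smul_apply, smul_eq_mul]
    linarith
  refine ((hfin.finite_subsets).image
    fun T => normalCone (convexHull ℝ S) (convexHull ℝ T)).subset ?_
  rintro σ ⟨F, hF, rfl⟩
  exact ⟨S ∩ F, Set.inter_subset_left, by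
    change normalCone _ (convexHull ℝ (S ∩ F)) = _
    rw [← key' F hF]⟩

/-- The linear functions on `V`. -/
def linForms (V : Type*) [AddCommGroup V] [Module ℝ V] : Submodule ℝ (V → ℝ) where
  carrier := {f | ∃ w : Dual ℝ V, f = fun v => w v}
  zero_mem' := ⟨0, rfl⟩
  add_mem' := by
    rintro _ _ ⟨a, rfl⟩ ⟨b, rfl⟩
    exact ⟨a + b, rfl⟩
  smul_mem' := by
    rintro c _ ⟨a, rfl⟩
    exact ⟨c • a, rfl⟩

/-- `A = Sym V*`, as the algebra of polynomial functions on `V`. Its part spanned by the products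
of `k` linear functions is `linForms V ^ k`. -/
def polyFns (V : Type*) [AddCommGroup V] [Module ℝ V] : Subalgebra ℝ (V → ℝ) :=
  Algebra.adjoin ℝ (linForms V : Set (V → ℝ))

/-- `𝒜(Φ)`: the functions on `V` that restrict to a polynomial on each cone of the (complete)
fan `Φ`. -/
def pwPoly (Φ : Set (Set V)) : Subalgebra ℝ (V → ℝ) where
  carrier := {f | ∀ σ ∈ Φ, ∃ q ∈ polyFns V, Set.EqOn f q σ}
  mul_mem' := by
    intro f g hf hg σ hσ
    obtain ⟨p, hp, hfp⟩ := hf σ hσ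
    obtain ⟨q, hq, hgq⟩ := hg σ hσ
    exact ⟨p * q, mul_mem hp hq, fun v hv => by simp [hfp hv, hgq hv]⟩
  add_mem' := by
    intro f g hf hg σ hσ
    obtain ⟨p, hp, hfp⟩ := hf σ hσ
    obtain ⟨q, hq, hgq⟩ := hg σ hσ
    exact ⟨p + q, add_mem hp hq, fun v hv => by simp [hfp hv, hgq hv]⟩
  algebraMap_mem' := by
    intro r σ _
    exact ⟨algebraMap ℝ (V → ℝ) r, Subalgebra.algebraMap_mem _ r, fun _ _ => rfl⟩

/-- The piecewise polynomial functions which are homogeneous of polynomial degree `k`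
(that is, of degree `2 * k` in the even grading). -/
def pwHomog (Φ : Set (Set V)) (k : ℕ) : Submodule ℝ (pwPoly Φ) where
  carrier := {f | ∀ σ ∈ Φ, ∃ q ∈ linForms V ^ k, Set.EqOn (f : V → ℝ) q σ}
  zero_mem' := fun _ _ => ⟨0, zero_mem _, fun _ _ => rfl⟩
  add_mem' := by
    intro f g hf hg σ hσ
    obtain ⟨p, hp, hfp⟩ := hf σ hσ
    obtain ⟨q, hq, hgq⟩ := hg σ hσ
    exact ⟨p + q, add_mem hp hq, fun v hv => by simp [hfp hv, hgq hv]⟩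
  smul_mem' := by
    intro c f hf σ hσ
    obtain ⟨p, hp, hfp⟩ := hf σ hσ
    exact ⟨c • p, Submodule.smul_mem _ c hp, fun v hv => by simp [hfp hv]⟩

/-- The ideal `A⁺ 𝒜(Φ)`, generated by the polynomial functions on `V` of positive degree. -/
def augIdeal (Φ : Set (Set V)) : Ideal (pwPoly Φ) :=
  Ideal.span {f | ∃ k, 0 < k ∧ (f : V → ℝ) ∈ linForms V ^ k}

/-- `H(Φ) = 𝒜(Φ) / A⁺ 𝒜(Φ)`. -/
abbrev Coh (Φ : Set (Set V)) : Type _ := pwPoly Φ ⧸ augIdeal Φ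

/-- The graded piece `H^{2k}(Φ)`. -/
def gradedH (Φ : Set (Set V)) (k : ℕ) : Submodule ℝ (Coh Φ) :=
  (pwHomog Φ k).map (Ideal.Quotient.mkₐ ℝ (augIdeal Φ)).toLinearMap

theorem supportFn_mem (P : Set (Dual ℝ V)) : supportFn P ∈ pwPoly (normalFan P) := by
  rintro σ ⟨F, ⟨⟨f, hf⟩, w, rfl⟩, rfl⟩
  refine ⟨fun v => f v, Algebra.subset_adjoin ⟨f, rfl⟩, fun v hv => ?_⟩
  refine IsGreatest.csSup_eq ⟨⟨f, hf.1, rfl⟩, ?_⟩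
  rintro _ ⟨p, hp, rfl⟩
  have := hv f hf p hp
  simpa using this

/-- The support function of `P` as a piecewise polynomial function on the normal fan. -/
def supportPw (P : Set (Dual ℝ V)) : pwPoly (normalFan P) := ⟨supportFn P, supportFn_mem P⟩

/-! ## Brion's functional and pairing -/

/-- The dimension of a cone. -/
def dimC (σ : Set V) : ℕ := finrank ℝ (Submodule.span ℝ σ)

/-- The facets of a cone. -/
def IsConeFacet (σ τ : Set V) : Prop :=
  (∃ L : Dual ℝ V, (∀ v ∈ σ, 0 ≤ L v) ∧ τ = {v | v ∈ σ ∧ L v = 0}) ∧ dimC τ + 1 = dimC σ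

/-- The cones of maximal dimension `n = dim V`. -/
def maxCones (Φ : Set (Set V)) : Set (Set V) := {σ | σ ∈ Φ ∧ dimC σ = finrank ℝ V}

/-- `F` is the normalized product of the equations of the facets of the `n`-dimensional simplicial
cone `σ`: `F = c ℓ_1 ⋯ ℓ_n`, where `ℓ_i ≥ 0` on `σ`, the sets `σ ∩ {ℓ_i = 0}` are the facets
of `σ`, each listed once, and `c ℓ_1 ∧ ⋯ ∧ ℓ_n = ± Ω` with `c > 0`. (If `n ≥ 1`, the factor `c`
can be absorbed into `ℓ_1`.) -/
def IsFacetProduct (Ω : V [⋀^Fin (finrank ℝ V)]→ₗ[ℝ] ℝ) (σ : Set V) (F : V → ℝ) : Prop :=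
  ∃ (c : ℝ) (l : Fin (finrank ℝ V) → Dual ℝ V),
    0 < c ∧ (∀ i, ∀ v ∈ σ, 0 ≤ l i v) ∧
    Set.BijOn (fun i => {v | v ∈ σ ∧ l i v = 0}) Set.univ {τ | IsConeFacet σ τ} ∧
    (∀ u : Fin (finrank ℝ V) → V,
      |c * (Matrix.of fun i j => l i (u j)).det| = |Ω u|) ∧
    F = fun v => c * ∏ i, l i v

/-- The normalized product `F_σ` of the equations of the facets of `σ`. -/
def facetProduct (Ω : V [⋀^Fin (finrank ℝ V)]→ₗ[ℝ] ℝ) (σ : Set V) : V → ℝ :=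
  Classical.epsilon (IsFacetProduct Ω σ)

/-- The polynomial `f_σ` on `V` which agrees with the piecewise polynomial function `f` on the
`n`-dimensional cone `σ`. -/
def polyOn (σ : Set V) (f : V → ℝ) : V → ℝ :=
  Classical.epsilon fun q => q ∈ polyFns V ∧ Set.EqOn f q σ

/-- `g` is the polynomial `ζ(f) = ∑_{dim σ = n} f_σ / F_σ`: the equality holds wherever the
denominators do not vanish. -/
def IsZeta (Ω : V [⋀^Fin (finrank ℝ V)]→ₗ[ℝ] ℝ) (Φ : Set (Set V)) (f g : V → ℝ) : Prop :=
  g ∈ polyFns V ∧ ∀ v : V, (∀ σ ∈ maxCones Φ, facetProduct Ω σ v ≠ 0) →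
    g v = ∑ᶠ σ ∈ maxCones Φ, polyOn σ f v / facetProduct Ω σ v

/-- Brion's functional `ζ : 𝒜(Φ) → A`. -/
def zeta (Ω : V [⋀^Fin (finrank ℝ V)]→ₗ[ℝ] ℝ) (Φ : Set (Set V)) (f : V → ℝ) : V → ℝ :=
  Classical.epsilon (IsZeta Ω Φ f)

/-- The linear function `H(Φ) → A / A⁺ = ℝ` induced by `ζ`: the value at `0` of `ζ(f)`, for a
representative `f` of the class `x`. -/
def zetaBar (Ω : V [⋀^Fin (finrank ℝ V)]→ₗ[ℝ] ℝ) (Φ : Set (Set V)) (x : Coh Φ) : ℝ :=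
  zeta Ω Φ (Classical.choose (Ideal.Quotient.mk_surjective x) : pwPoly Φ) 0

/-- Brion's pairing `(x, y)_B` on `H(Φ)`. -/
def pairingB (Ω : V [⋀^Fin (finrank ℝ V)]→ₗ[ℝ] ℝ) (Φ : Set (Set V)) (x y : Coh Φ) : ℝ :=
  zetaBar Ω Φ (x * y)

end Fans

end

end PolytopeAlgebra

/-!
Both algebras are quotients of the polynomial ring `ℝ[∂_1, …, ∂_m]`, and they coincide because both
are the quotient by the kernel of one and the same symmetric bilinear form.

*The fan.* A simple polytope `P` is replaced by the combinatorial data of its normal fan, a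
`SimpleFan`: for each vertex `p` the basis `ξ i`, `i ∈ idx p`, of normals of the facets through `p`,
and its coordinate functions `x p i`. The strictly convex function with values `k i` at `ξ i` has the
linear pieces `pt k p = ∑ i, k i • x p i`, the vertices of a polytope `face k ∅` with support
numbers `k`. All these polytopes are analogous to `P` (`analogous_face`), and conversely a polytope
analogous to `P` has its vertices at the points `pt k p` (`exists_common_point`). As admissible `k`
form an open set, the support numbers are linear coordinates (`bijective_supportNumbers`).

*The volume.* After the edges at each vertex have been reversed so as to point downwards for a
generic vector `v`, the indicator function of a polytope is an alternating sum of the indicator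
functions of the cones at its vertices (`sum_sgn_eq_indicator`). Truncating by a half space and
adding up volumes of simplices gives `∑ p, (pt k p v + t) ^ n / den p v = n! Vol`, a polynomial
identity in `t`. Hence `n! Vol(k) = ∑ p, (pt k p v) ^ n / den p v`, whereas the sums with exponent
below `n` vanish (`sum_pow_div_den`). The denominators are the normalized products of the facet
equations, so an operator `d` which is homogeneous of order `m ≤ n` satisfies
`(d Vol)(0) = ∑ p, d(x p) / den p = ζ(d(χ))`, where `d(χ)` is obtained by substituting for `∂_i` the
piecewise linear function `χ i` with `χ i (ξ j) = δ_ij` (`sum_eval_div_den`, `isZeta_aeval_chi`).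
For `m > n` the two functionals `d ↦ (d Vol)(0)` and `d ↦ ζ(d(χ))(0)` vanish, the second one by
homogeneity (`zetaZero_eq_zero_of_mem_pwHomog`).

*Duality.* For generic `v` let `up v p` be the set of facets at `p` which correspond to the edges
along which `v` increases. By induction on the height `pt h p v`, the products `∏ i ∈ up v p, χ i`
span the piecewise polynomial functions over the polynomial functions
(`exists_eq_sum_mul_prodChi`). They have degree at most `n`, whence `ζ` takes polynomial values on
all piecewise polynomial functions (`isZeta_zeta`), and `d ↦ d(χ)` is surjective onto `H(Φ)`.
The products for `v` and for `-v` are dual to each other up to a triangular matrix, which makes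
Brion's pairing nondegenerate on `H(Φ)` (`mem_augIdeal_of_zetaZero`). Thus `d(χ)` vanishes in `H(Φ)`
if and only if `(e d Vol)(0) = ζ(e(χ) d(χ))(0)` is zero for all `e`, that is, if and only if
`d Vol = 0`. The map `d ↦ d(χ)` therefore induces the isomorphism (`exists_algEquiv`).
-/

namespace PolytopeAlgebra

/-! ### Faces of polytopes -/

section Convex

open Filter Topology

variable {V : Type*} [AddCommGroup V] [Module ℝ V]

theorem le_of_mem_convexHull {S : Set (Dual ℝ V)} {v : V} {c : ℝ} (h : ∀ s ∈ S, s v ≤ c)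
    {y : Dual ℝ V} (hy : y ∈ convexHull ℝ S) : y v ≤ c := by
  have hconv : Convex ℝ {y : Dual ℝ V | y v ≤ c} :=
    convex_halfSpace_le (Dual.eval ℝ V v).isLinear c
  exact convexHull_min (s := S) (t := {y : Dual ℝ V | y v ≤ c}) h hconv hy

theorem IsPolytope.exists_separating [FiniteDimensional ℝ V] {Q : Set (Dual ℝ V)}
    (hQ : IsPolytope Q) {y : Dual ℝ V} (hy : y ∉ Q) : ∃ v : V, ∀ z ∈ Q, z v < y v := by
  obtain ⟨S, hfin, -, rfl⟩ := hQ
  let b := finBasis ℝ V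
  let T : Dual ℝ V ≃ₗ[ℝ] (Fin (finrank ℝ V) → ℝ) := b.dualBasis.equivFun
  have himg : T '' convexHull ℝ S = convexHull ℝ (T '' S) :=
    LinearMap.image_convexHull T.toLinearMap S
  have hcl : IsClosed (T '' convexHull ℝ S) := by
    rw [himg]; exact (hfin.image T).isClosed_convexHull ℝ
  have hcv : Convex ℝ (T '' convexHull ℝ S) := by rw [himg]; exact convex_convexHull ℝ _
  have hTy : T y ∉ T '' convexHull ℝ S := by
    rintro ⟨z, hz, hzy⟩
    exact hy (T.injective hzy ▸ hz)
  obtain ⟨f, u, h1, h2⟩ := geometric_hahn_banach_closed_point hcv hcl hTy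
  obtain ⟨v, hv⟩ := (evalEquiv ℝ V).surjective (f.toLinearMap ∘ₗ T.toLinearMap)
  have hv' : ∀ z : Dual ℝ V, z v = f (T z) := fun z => by
    have := congrArg (fun g => g z) hv
    simpa using this
  refine ⟨v, fun z hz => ?_⟩
  rw [hv', hv']
  exact (h1 _ ⟨z, hz, rfl⟩).trans h2

theorem exists_mem_faceAt_of_finite {S : Set (Dual ℝ V)} (hfin : S.Finite) (hne : S.Nonempty)
    (v : V) : ∃ y ∈ S, y ∈ faceAt (convexHull ℝ S) v := by
  obtain ⟨y, hyS, hy⟩ := Set.exists_max_image S (fun y => y v) hfin hne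
  exact ⟨y, hyS, subset_convexHull ℝ S hyS, fun z hz => le_of_mem_convexHull hy hz⟩

theorem IsPolytope.faceAt_nonempty {P : Set (Dual ℝ V)} (hP : IsPolytope P) (v : V) :
    (faceAt P v).Nonempty := by
  obtain ⟨S, hfin, hne, rfl⟩ := hP
  obtain ⟨y, -, hy⟩ := exists_mem_faceAt_of_finite hfin hne v
  exact ⟨y, hy⟩

theorem supportFn_eq {P : Set (Dual ℝ V)} {v : V} {y : Dual ℝ V} (hy : y ∈ faceAt P v) :
    supportFn P v = y v := by
  refine IsGreatest.csSup_eq ⟨⟨y, hy.1, rfl⟩, ?_⟩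
  rintro _ ⟨p, hp, rfl⟩
  exact hy.2 p hp

theorem IsPolytope.le_supportFn {P : Set (Dual ℝ V)} (hP : IsPolytope P) {y : Dual ℝ V}
    (hy : y ∈ P) (v : V) : y v ≤ supportFn P v := by
  obtain ⟨z, hz⟩ := hP.faceAt_nonempty v
  rw [supportFn_eq hz]
  exact hz.2 y hy

theorem IsPolytope.mem_faceAt_iff {P : Set (Dual ℝ V)} (hP : IsPolytope P) {y : Dual ℝ V} {v : V} :
    y ∈ faceAt P v ↔ y ∈ P ∧ y v = supportFn P v := by
  refine ⟨fun h => ⟨h.1, (supportFn_eq h).symm⟩, fun h => ⟨h.1, fun z hz => ?_⟩⟩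
  rw [h.2]
  exact hP.le_supportFn hz v

/-- Finitely many nonzero linear functions are simultaneously nonzero at some vector. -/
theorem exists_generic {α : Type*} [Finite α] (f : α → Dual ℝ V) (hf : ∀ a, f a ≠ 0) :
    ∃ u : V, ∀ a, f a u ≠ 0 := by
  obtain ⟨u, -, hu⟩ := Dual.exists_forall_mem_ne_zero_of_forall_exists (⊤ : Submodule ℝ V) f
    (fun a => by
      by_contra! h
      exact hf a (LinearMap.ext fun x => h x trivial))
  exact ⟨u, hu⟩

theorem eventually_add_mul_pos {a : ℝ} (ha : 0 < a) (b : ℝ) :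
    ∀ᶠ ε in 𝓝[>] (0 : ℝ), 0 < a + ε * b := by
  have : Tendsto (fun ε : ℝ => a + ε * b) (𝓝[>] 0) (𝓝 (a + 0 * b)) :=
    ((continuous_const.add (continuous_id.mul continuous_const)).tendsto 0).mono_left
      nhdsWithin_le_nhds
  rw [zero_mul, add_zero] at this
  exact this.eventually (lt_mem_nhds ha)

theorem eventually_add_mul_ne_zero (a : ℝ) {b : ℝ} (hb : b ≠ 0) :
    ∀ᶠ ε in 𝓝[>] (0 : ℝ), a + ε * b ≠ 0 := by
  rcases lt_trichotomy a 0 with ha | rfl | ha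
  · filter_upwards [eventually_add_mul_pos (neg_pos.2 ha) (-b)] with ε h
    intro h0
    linarith
  · filter_upwards [self_mem_nhdsWithin] with ε h
    have : (0 : ℝ) < ε := h
    simp [hb, this.ne']
  · filter_upwards [eventually_add_mul_pos ha b] with ε h
    exact h.ne'

/-- A generic direction `u` moves any vector `v` off finitely many hyperplanes. -/
theorem eventually_generic {α : Type*} [Finite α] (f : α → Dual ℝ V) {u : V}
    (hu : ∀ a, f a u ≠ 0) (v : V) : ∀ᶠ ε in 𝓝[>] (0 : ℝ), ∀ a, f a (v + ε • u) ≠ 0 := by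
  rw [eventually_all]
  intro a
  filter_upwards [eventually_add_mul_ne_zero (f a v) (hu a)] with ε h
  simpa using h

theorem vectorSpan_le_iff {X : Set (Dual ℝ V)} {K : Submodule ℝ (Dual ℝ V)} :
    vectorSpan ℝ X ≤ K ↔ ∀ x ∈ X, ∀ y ∈ X, x - y ∈ K := by
  rw [vectorSpan_def, Submodule.span_le]
  constructor
  · intro h x hx y hy
    exact h (Set.vsub_mem_vsub hx hy)
  · rintro h _ ⟨x, hx, y, hy, rfl⟩
    exact h x hx y hy

theorem sub_mem_vectorSpan {X : Set (Dual ℝ V)} {x y : Dual ℝ V} (hx : x ∈ X) (hy : y ∈ X) :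
    x - y ∈ vectorSpan ℝ X := vsub_mem_vectorSpan ℝ hx hy

theorem faceAt_subset (X : Set (Dual ℝ V)) (v : V) : faceAt X v ⊆ X := fun _ h => h.1

theorem faceAt_eq_of_mem {X : Set (Dual ℝ V)} {v : V} {x y : Dual ℝ V} (hx : x ∈ faceAt X v)
    (hy : y ∈ faceAt X v) : x v = y v := le_antisymm (hy.2 x hx.1) (hx.2 y hy.1)

theorem vectorSpan_faceAt_le_ker (X : Set (Dual ℝ V)) (v : V) :
    vectorSpan ℝ (faceAt X v) ≤ LinearMap.ker (Dual.eval ℝ V v) := by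
  rw [vectorSpan_le_iff]
  intro x hx y hy
  simp [faceAt_eq_of_mem hx hy]

theorem faceAt_eq_self {X : Set (Dual ℝ V)} {v : V}
    (h : ∀ d ∈ vectorSpan ℝ X, d v = 0) : faceAt X v = X := by
  refine (faceAt_subset X v).antisymm fun x hx => ⟨hx, fun z hz => ?_⟩
  have := h _ (sub_mem_vectorSpan hx hz)
  simp at this
  linarith

/-- If `w` vanishes on the direction of the face of `X` at `u`, which has codimension one, then `w`
is a multiple of `u` on the direction of `X`. -/
theorem exists_eq_mul_on_vectorSpan [FiniteDimensional ℝ V] {X : Set (Dual ℝ V)} {u w : V}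
    (hdim : dimP (faceAt X u) + 1 = dimP X)
    (hw : ∀ d ∈ vectorSpan ℝ (faceAt X u), d w = 0) :
    ∃ c : ℝ, ∀ d ∈ vectorSpan ℝ X, d w = c * d u := by
  set U := vectorSpan ℝ X
  set D := vectorSpan ℝ (faceAt X u)
  have hDU : D ≤ U := vectorSpan_mono ℝ (faceAt_subset X u)
  have hdim' : finrank ℝ D + 1 = finrank ℝ U := hdim
  obtain ⟨d, hdU, hdu⟩ : ∃ d ∈ U, d u ≠ 0 := by
    by_contra! h
    have : faceAt X u = X := faceAt_eq_self h
    rw [this] at hdim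
    omega
  have hD : D = U ⊓ LinearMap.ker (Dual.eval ℝ V u) := by
    refine Submodule.eq_of_le_of_finrank_le (le_inf hDU (vectorSpan_faceAt_le_ker X u)) ?_
    have hlt : U ⊓ LinearMap.ker (Dual.eval ℝ V u) < U := by
      refine lt_of_le_of_ne inf_le_left fun h => hdu ?_
      simpa using inf_eq_left.1 h hdU
    have := Submodule.finrank_lt_finrank_of_lt hlt
    omega
  refine ⟨d w / d u, fun x hx => ?_⟩
  have hmem : x - (x u / d u) • d ∈ D := by
    rw [hD]
    refine ⟨U.sub_mem hx (U.smul_mem _ hdU), ?_⟩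
    simp [div_mul_cancel₀ _ hdu]
  have := hw _ hmem
  simp only [LinearMap.sub_apply, LinearMap.smul_apply, smul_eq_mul] at this
  field_simp
  field_simp at this
  linarith

/-- Two outward normals of the same facet of `X` are positively proportional on the direction
of `X`. -/
theorem exists_pos_mul_of_faceAt_eq [FiniteDimensional ℝ V] {X : Set (Dual ℝ V)} {u w : V}
    (hne : (faceAt X u).Nonempty) (hdim : dimP (faceAt X u) + 1 = dimP X)
    (huw : faceAt X u = faceAt X w) :
    ∃ c : ℝ, 0 < c ∧ ∀ d ∈ vectorSpan ℝ X, d w = c * d u := by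
  obtain ⟨c, hc⟩ := exists_eq_mul_on_vectorSpan hdim (w := w) (fun d hd => by
    rw [huw] at hd
    simpa using vectorSpan_faceAt_le_ker X w hd)
  refine ⟨c, ?_, hc⟩
  by_contra! hc0
  obtain ⟨x, hx⟩ := hne
  have hall : faceAt X u = X := by
    refine (faceAt_subset X u).antisymm fun z hz => ?_
    rw [huw]
    refine ⟨hz, fun y hy => ?_⟩
    have hxw : x ∈ faceAt X w := huw ▸ hx
    have h1 := hc _ (sub_mem_vectorSpan hx.1 hz)
    have h2 : 0 ≤ (x - z) u := by simpa using hx.2 z hz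
    have h3 : 0 ≤ (x - z) w := by simpa using hxw.2 z hz
    have h4 : (x - z) w ≤ 0 := h1 ▸ mul_nonpos_of_nonpos_of_nonneg hc0 h2
    have h5 := hxw.2 y hy
    simp only [LinearMap.sub_apply] at h4
    linarith
  rw [hall] at hdim
  omega

theorem faceAt_eq_of_pos_mul {Y : Set (Dual ℝ V)} {u w : V} {c : ℝ} (hc : 0 < c)
    (h : ∀ d ∈ vectorSpan ℝ Y, d w = c * d u) : faceAt Y u = faceAt Y w := by
  ext y
  refine and_congr_right fun hy => forall₂_congr fun z hz => ?_
  have := h _ (sub_mem_vectorSpan hy hz)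
  simp only [LinearMap.sub_apply] at this
  rw [← sub_nonneg, ← sub_nonneg (b := z w), this, mul_nonneg_iff_of_pos_left hc]

/-- If `X` and `Y` are parallel, two outward normals of one facet of `X` cut out the same
face of `Y`. -/
theorem faceAt_eq_of_parallel [FiniteDimensional ℝ V] {X Y : Set (Dual ℝ V)} {u w : V}
    (hXY : vectorSpan ℝ X = vectorSpan ℝ Y) (hne : (faceAt X u).Nonempty)
    (hdim : dimP (faceAt X u) + 1 = dimP X) (huw : faceAt X u = faceAt X w) :
    faceAt Y u = faceAt Y w := by
  obtain ⟨c, hc, h⟩ := exists_pos_mul_of_faceAt_eq hne hdim huw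
  exact faceAt_eq_of_pos_mul hc (hXY ▸ h)

/-- The common zeros of those functions in `A` that vanish at `v`. -/
def activeKer (A : Finset (Dual ℝ V)) (v : V) : Submodule ℝ V :=
  ⨅ a : {a : Dual ℝ V // a ∈ A ∧ a v = 0}, LinearMap.ker a.1

theorem mem_activeKer {A : Finset (Dual ℝ V)} {v w : V} :
    w ∈ activeKer A v ↔ ∀ a ∈ A, a v = 0 → a w = 0 := by
  simp [activeKer]

/-- Walking from a point `v` of a pointed polyhedral cone in a direction `w` which preserves the
active constraints and leaves the cone, one ends at a point with more active constraints. -/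
theorem exists_exit [FiniteDimensional ℝ V] (A : Finset (Dual ℝ V)) {v w : V}
    (hv : ∀ a ∈ A, 0 ≤ a v) (hw : w ∈ activeKer A v) (hexit : ∃ a ∈ A, a w < 0) :
    ∃ t : ℝ, 0 < t ∧ (∀ a ∈ A, 0 ≤ a (v + t • w)) ∧
      finrank ℝ (activeKer A (v + t • w)) < finrank ℝ (activeKer A v) := by
  classical
  rw [mem_activeKer] at hw
  obtain ⟨a₀, ha₀, hmin⟩ := (A.filter fun a => a w < 0).exists_min_image
    (fun a => a v / (-a w)) (by
      obtain ⟨a, ha, h⟩ := hexit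
      exact ⟨a, by simp [ha, h]⟩)
  simp only [Finset.mem_filter] at ha₀ hmin
  have hpos : 0 < a₀ v := by
    refine lt_of_le_of_ne (hv _ ha₀.1) fun h => ?_
    have := hw _ ha₀.1 h.symm
    linarith [ha₀.2]
  refine ⟨a₀ v / (-a₀ w), div_pos hpos (by linarith [ha₀.2]), fun a ha => ?_, ?_⟩
  · rw [map_add, map_smul, smul_eq_mul]
    have ht : 0 < a₀ v / (-a₀ w) := div_pos hpos (by linarith [ha₀.2])
    rcases lt_or_ge (a w) 0 with h | h
    · have := hmin a ⟨ha, h⟩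
      rw [le_div_iff₀ (by linarith)] at this
      linarith
    · have := mul_nonneg ht.le h
      linarith [hv a ha]
  · refine Submodule.finrank_lt_finrank_of_lt (lt_of_le_of_ne ?_ ?_)
    · intro z hz
      rw [mem_activeKer] at hz ⊢
      intro a ha hav
      exact hz a ha (by simp [hav, hw a ha hav])
    · intro h
      have hvm : v ∈ activeKer A v := mem_activeKer.2 fun a _ h => h
      rw [← h, mem_activeKer] at hvm
      refine hpos.ne' (hvm a₀ ha₀.1 ?_)
      rw [map_add, map_smul, smul_eq_mul]
      have := ha₀.2.ne
      field_simp
      ring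

/-- A pointed polyhedral cone is generated by its extreme rays, the points at which the active
constraints cut out a line. -/
theorem mem_of_extreme_rays [FiniteDimensional ℝ V] (A : Finset (Dual ℝ V))
    (hA : ∀ v, (∀ a ∈ A, a v = 0) → v = 0) {C : Set V} (h0 : (0 : V) ∈ C)
    (hadd : ∀ v ∈ C, ∀ w ∈ C, v + w ∈ C) (hsmul : ∀ c : ℝ, 0 < c → ∀ v ∈ C, c • v ∈ C)
    (hray : ∀ v, (∀ a ∈ A, 0 ≤ a v) → finrank ℝ (activeKer A v) = 1 → v ∈ C)
    (v : V) (hv : ∀ a ∈ A, 0 ≤ a v) : v ∈ C := by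
  induction hd : finrank ℝ (activeKer A v) using Nat.strong_induction_on generalizing v with
  | _ d ih =>
  have hvm : v ∈ activeKer A v := mem_activeKer.2 fun a _ h => h
  rcases lt_trichotomy d 1 with h | h | h
  · have : activeKer A v = ⊥ := Submodule.finrank_eq_zero.1 (by omega)
    rw [this, Submodule.mem_bot] at hvm
    exact hvm ▸ h0
  · exact hray v hv (hd.trans h)
  · set φ : Dual ℝ V := ∑ a ∈ A, a
    obtain ⟨w, hwK, hwφ, hw0⟩ : ∃ w ∈ activeKer A v, φ w = 0 ∧ w ≠ 0 := by
      have : 0 < finrank ℝ (LinearMap.ker (φ.domRestrict (activeKer A v))) := by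
        have h1 := LinearMap.finrank_range_add_finrank_ker (φ.domRestrict (activeKer A v))
        have h2 := Submodule.finrank_le (LinearMap.range (φ.domRestrict (activeKer A v)))
        rw [finrank_self] at h2
        omega
      obtain ⟨⟨w, hw⟩, hw0⟩ := Module.finrank_pos_iff_exists_ne_zero.1 this
      refine ⟨w, w.2, by simpa using hw, fun h => hw0 ?_⟩
      ext
      simpa using h
    -- `φ` is positive on the cone away from `0`, so the line through `v` in direction `w` leaves
    -- the cone at both ends
    have hexit : ∀ w : V, φ w = 0 → w ≠ 0 → ∃ a ∈ A, a w < 0 := by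
      intro w hwφ hw0
      by_contra! hge
      refine hw0 (hA w ?_)
      have : ∑ a ∈ A, a w = 0 := by simpa [φ] using hwφ
      exact (Finset.sum_eq_zero_iff_of_nonneg hge).1 this
    obtain ⟨t, ht, h1, h2⟩ := exists_exit A hv hwK (hexit w hwφ hw0)
    obtain ⟨s, hs, h3, h4⟩ := exists_exit A hv (Submodule.neg_mem _ hwK)
      (hexit (-w) (by simp [hwφ]) (by simpa using hw0))
    have e1 := ih _ (hd ▸ h2) _ h1 rfl
    have e2 := ih _ (hd ▸ h4) _ h3 rfl
    have : v = (s / (s + t)) • (v + t • w) + (t / (s + t)) • (v + s • -w) := by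
      have hst : s + t ≠ 0 := by positivity
      rw [smul_add, smul_add, smul_neg, smul_neg, smul_smul, smul_smul,
        show t / (s + t) * s = s / (s + t) * t by ring]
      rw [add_add_add_comm, ← add_smul, add_neg_cancel, add_zero, ← add_div, div_self hst,
        one_smul]
    rw [this]
    exact hadd _ (hsmul _ (by positivity) _ e1) _ (hsmul _ (by positivity) _ e2)

end Convex

end PolytopeAlgebra

namespace PolytopeAlgebra

/-! ### Complete simplicial fans with a strictly convex support function -/

section SimpleFan

open Filter Topology

variable {V : Type*} [AddCommGroup V] [Module ℝ V] {ι : Type*} [Fintype ι] [DecidableEq ι]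

/-- A complete simplicial fan with rays spanned by the `ξ i`, together with a strictly convex
piecewise linear function. The maximal cones are indexed by `κ` (the vertices of a simple
polytope): the cone of `p` is generated by the basis `ξ i`, `i ∈ idx p`, whose coordinate functions
are the `x p i`; for `i ∉ idx p` the function `x p i` is zero. The piecewise linear function is
given by its values `h i` at `ξ i`, and it agrees with `∑ i, h i • x p i` on the cone of `p`. -/
structure SimpleFan (ξ : ι → V) (κ : Type*) where
  idx : κ → Finset ι
  idx_injective : Function.Injective idx
  card_idx : ∀ p, (idx p).card = finrank ℝ V
  x : κ → ι → Dual ℝ V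
  x_of_notMem : ∀ {p i}, i ∉ idx p → x p i = 0
  x_apply : ∀ {p i j}, i ∈ idx p → j ∈ idx p → x p i (ξ j) = if i = j then 1 else 0
  sum_x : ∀ p v, ∑ i, x p i v • ξ i = v
  complete : ∀ v, ∃ p, ∀ i, 0 ≤ x p i v
  exists_mem_idx : ∀ i, ∃ p, i ∈ idx p
  h : ι → ℝ
  h_lt : ∀ {p i}, i ∉ idx p → (∑ j, h j • x p j) (ξ i) < h i

namespace SimpleFan

variable {ξ : ι → V} {κ : Type*} (S : SimpleFan ξ κ)

/-- The linear function with values `k i` at the generators `ξ i` of the cone of `p`. -/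
def pt (k : ι → ℝ) (p : κ) : Dual ℝ V := ∑ j, k j • S.x p j

/-- The values `k i` define a strictly convex piecewise linear function on the fan. -/
def Adm (k : ι → ℝ) : Prop := ∀ p i, i ∉ S.idx p → S.pt k p (ξ i) < k i

theorem adm_h : S.Adm S.h := fun _ _ hi => S.h_lt hi

/-- The maximal cone indexed by `p`. -/
def cone (p : κ) : Set V := {v | ∀ i, 0 ≤ S.x p i v}

theorem apply_eq (p : κ) (y : Dual ℝ V) (v : V) : y v = ∑ i, S.x p i v * y (ξ i) := by
  conv_lhs => rw [← S.sum_x p v]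
  simp

theorem pt_apply (k : ι → ℝ) (p : κ) (v : V) : S.pt k p v = ∑ i, S.x p i v * k i := by
  simp [pt, LinearMap.sum_apply, mul_comm]

theorem x_sum {p : κ} {J : Finset ι} (hJ : J ⊆ S.idx p) (c : ι → ℝ) (i : ι) :
    S.x p i (∑ j ∈ J, c j • ξ j) = if i ∈ J then c i else 0 := by
  by_cases hi : i ∈ S.idx p
  · rw [map_sum, Finset.sum_congr rfl (g := fun j => if i = j then c j else 0)]
    · simp
    · intro j hj
      simp [S.x_apply hi (hJ hj)]
  · rw [S.x_of_notMem hi, if_neg fun h => hi (hJ h)]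
    simp

theorem x_xi {p : κ} {i : ι} (hi : i ∈ S.idx p) (j : ι) :
    S.x p j (ξ i) = if j = i then 1 else 0 := by
  have := S.x_sum (J := {i}) (by simpa using hi) (fun _ => 1) j
  simpa using this

theorem pt_xi (k : ι → ℝ) {p : κ} {i : ι} (hi : i ∈ S.idx p) : S.pt k p (ξ i) = k i := by
  simp [pt_apply, S.x_xi hi]

theorem pt_xi_le {k : ι → ℝ} (hk : S.Adm k) (p : κ) (i : ι) : S.pt k p (ξ i) ≤ k i := by
  by_cases hi : i ∈ S.idx p
  · exact (S.pt_xi k hi).le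
  · exact (hk p i hi).le

theorem pt_sub_apply (k : ι → ℝ) (p : κ) (y : Dual ℝ V) (v : V) :
    S.pt k p v - y v = ∑ i, S.x p i v * (k i - y (ξ i)) := by
  rw [pt_apply, S.apply_eq p y v, ← Finset.sum_sub_distrib]
  simp [mul_sub]

/-- The linear functions `pt k p` are the linear pieces of a convex function. -/
theorem le_pt {p : κ} {v : V} (hv : v ∈ S.cone p) {k : ι → ℝ} {y : Dual ℝ V}
    (hy : ∀ i, y (ξ i) ≤ k i) : y v ≤ S.pt k p v := by
  rw [← sub_nonneg, pt_sub_apply]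
  exact Finset.sum_nonneg fun i _ => mul_nonneg (hv i) (sub_nonneg.2 (hy i))

theorem pt_eq_iff {k : ι → ℝ} (hk : S.Adm k) {p q : κ} {v : V} (hv : v ∈ S.cone p) :
    S.pt k q v = S.pt k p v ↔ ∀ i, S.x p i v ≠ 0 → i ∈ S.idx q := by
  rw [eq_comm, ← sub_eq_zero, pt_sub_apply, Finset.sum_eq_zero_iff_of_nonneg
    fun i _ => mul_nonneg (hv i) (sub_nonneg.2 (S.pt_xi_le hk q i))]
  refine ⟨fun h i hi => ?_, fun h i _ => ?_⟩
  · by_contra hq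
    have := (mul_eq_zero.1 (h i (Finset.mem_univ i))).resolve_left hi
    linarith [hk q i hq]
  · by_cases hi : S.x p i v = 0
    · simp [hi]
    · simp [S.pt_xi k (h i hi)]

theorem x_eq_of_support {p q : κ} {v : V} (h : ∀ i, S.x p i v ≠ 0 → i ∈ S.idx q) (i : ι) :
    S.x q i v = S.x p i v := by
  have hv : v = ∑ j ∈ S.idx q, S.x p j v • ξ j := by
    conv_lhs => rw [← S.sum_x p v]
    rw [← Finset.sum_subset (Finset.subset_univ (S.idx q))]
    intro j _ hj
    have : S.x p j v = 0 := by
      by_contra h0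
      exact hj (h j h0)
    simp [this]
  conv_lhs => rw [hv, S.x_sum subset_rfl]
  split_ifs with hi
  · rfl
  · by_contra h0
    exact hi (h i (Ne.symm h0))

theorem mem_cone_iff {p q : κ} {v : V} (hv : v ∈ S.cone p) :
    v ∈ S.cone q ↔ ∀ i, S.x p i v ≠ 0 → i ∈ S.idx q := by
  refine ⟨fun h => ?_, fun h i => ?_⟩
  · rw [← S.pt_eq_iff S.adm_h hv]
    exact le_antisymm (S.le_pt hv (S.pt_xi_le S.adm_h q)) (S.le_pt h (S.pt_xi_le S.adm_h p))
  · rw [S.x_eq_of_support h]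
    exact hv i

theorem x_eq_of_mem_cone {p q : κ} {v : V} (hp : v ∈ S.cone p) (hq : v ∈ S.cone q) (i : ι) :
    S.x q i v = S.x p i v := S.x_eq_of_support ((S.mem_cone_iff hp).1 hq) i

theorem idx_eq_of_subset {p q : κ} (h : S.idx p ⊆ S.idx q) : p = q :=
  S.idx_injective (Finset.eq_of_subset_of_card_le h (by rw [S.card_idx, S.card_idx]))

/-- The sum of the generators indexed by `J`, a point in the relative interior of the cone they
generate. -/
def vec (_ : SimpleFan ξ κ) (J : Finset ι) : V := ∑ j ∈ J, ξ j

theorem x_vec {p : κ} {J : Finset ι} (hJ : J ⊆ S.idx p) (i : ι) :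
    S.x p i (S.vec J) = if i ∈ J then 1 else 0 := by
  simpa [vec] using S.x_sum hJ (fun _ => 1) i

theorem vec_mem_cone_iff {p : κ} {J : Finset ι} (hJ : J ⊆ S.idx p) {q : κ} :
    S.vec J ∈ S.cone q ↔ J ⊆ S.idx q := by
  have : S.vec J ∈ S.cone p := fun i => by
    rw [S.x_vec hJ]
    split_ifs <;> simp
  rw [S.mem_cone_iff this]
  simp [S.x_vec hJ, Finset.subset_iff]

/-- The maximal cones at a point close to `v` contain `v`. -/
theorem eventually_mem_cone [Finite κ] (v u : V) :
    ∀ᶠ ε in 𝓝[>] (0 : ℝ), ∀ q, v + ε • u ∈ S.cone q → v ∈ S.cone q := by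
  rw [eventually_all]
  intro q
  by_cases hq : v ∈ S.cone q
  · simp [hq]
  · obtain ⟨i, hi⟩ : ∃ i, S.x q i v < 0 := by simpa [cone] using hq
    filter_upwards [eventually_add_mul_pos (neg_pos.2 hi) (-S.x q i u)] with ε hε h
    have := h i
    rw [map_add, map_smul, smul_eq_mul] at this
    linarith

/-- Across each wall of a maximal cone there lies another maximal cone. -/
theorem exists_neighbour [Finite κ] {p : κ} {i : ι} (hi : i ∈ S.idx p) :
    ∃ q, (S.idx p).erase i ⊆ S.idx q ∧ i ∉ S.idx q := by
  have hJ : (S.idx p).erase i ⊆ S.idx p := Finset.erase_subset _ _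
  obtain ⟨ε, h, hε⟩ := ((S.eventually_mem_cone (S.vec ((S.idx p).erase i)) (-ξ i)).and
    self_mem_nhdsWithin).exists
  obtain ⟨q, hq⟩ := S.complete (S.vec ((S.idx p).erase i) + ε • -ξ i)
  have hsub := (S.vec_mem_cone_iff hJ).1 (h q hq)
  refine ⟨q, hsub, fun hiq => ?_⟩
  have : p = q := S.idx_eq_of_subset fun j hj => by
    by_cases hji : j = i
    · exact hji ▸ hiq
    · exact hsub (by simp [hj, hji])
  subst this
  have h2 := hq i
  rw [map_add, map_smul, map_neg, S.x_vec hJ, S.x_xi hi] at h2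
  have hε' : (0 : ℝ) < ε := hε
  simp at h2
  linarith

/-- A vector is generic if it lies on none of the hyperplanes spanned by the walls of the fan. -/
def Generic (v : V) : Prop := ∀ p, ∀ i ∈ S.idx p, S.x p i v ≠ 0

theorem x_ne_zero {p : κ} {i : ι} (hi : i ∈ S.idx p) : S.x p i ≠ 0 := fun h => by
  have := S.x_xi hi i
  simp [h] at this

theorem exists_generic [Finite κ] : ∃ v, S.Generic v := by
  obtain ⟨u, hu⟩ := PolytopeAlgebra.exists_generic
    (fun a : (Σ p : κ, {i // i ∈ S.idx p}) => S.x a.1 a.2.1) (fun a => S.x_ne_zero a.2.2)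
  exact ⟨u, fun p i hi => hu ⟨p, i, hi⟩⟩

theorem eventually_generic [Finite κ] (v : V) {u : V} (hu : S.Generic u) :
    ∀ᶠ ε in 𝓝[>] (0 : ℝ), S.Generic (v + ε • u) := by
  filter_upwards [PolytopeAlgebra.eventually_generic
    (fun a : (Σ p : κ, {i // i ∈ S.idx p}) => S.x a.1 a.2.1) (u := u)
    (fun a => hu a.1 a.2.1 a.2.2) v] with ε h p i hi
  exact h ⟨p, i, hi⟩

/-- The star of the cone generated by `ξ j`, `j ∈ J`, is complete modulo the span of that cone. -/
theorem existsUnique_star [Finite κ] {J : Finset ι} (hJ : ∃ p, J ⊆ S.idx p) {v : V}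
    (hv : S.Generic v) : ∃! q, J ⊆ S.idx q ∧ ∀ i ∈ S.idx q \ J, 0 < S.x q i v := by
  obtain ⟨p, hp⟩ := hJ
  have hpos : ∀ q, J ⊆ S.idx q → (∀ i ∈ S.idx q \ J, 0 < S.x q i v) →
      ∀ᶠ ε in 𝓝[>] (0 : ℝ), ∀ i ∈ S.idx q, 0 < S.x q i (S.vec J + ε • v) := by
    intro q hJq hq
    rw [Filter.eventually_all_finset]
    intro i hi
    simp only [map_add, map_smul, smul_eq_mul, S.x_vec hJq]
    by_cases hiJ : i ∈ J
    · simpa [hiJ] using eventually_add_mul_pos one_pos (S.x q i v)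
    · filter_upwards [self_mem_nhdsWithin] with ε hε
      have hε' : (0 : ℝ) < ε := hε
      simpa [hiJ] using mul_pos hε' (hq i (by simp [hi, hiJ]))
  refine existsUnique_of_exists_of_unique ?_ ?_
  · obtain ⟨ε, h, hε⟩ := ((S.eventually_mem_cone (S.vec J) v).and self_mem_nhdsWithin).exists
    have hε' : (0 : ℝ) < ε := hε
    obtain ⟨q, hq⟩ := S.complete (S.vec J + ε • v)
    have hJq := (S.vec_mem_cone_iff hp).1 (h q hq)
    refine ⟨q, hJq, fun i hi => ?_⟩
    rw [Finset.mem_sdiff] at hi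
    have h2 := hq i
    rw [map_add, map_smul, S.x_vec hJq, if_neg hi.2, zero_add, smul_eq_mul,
      mul_nonneg_iff_of_pos_left hε'] at h2
    exact lt_of_le_of_ne h2 (hv q i hi.1).symm
  · rintro q q' ⟨h1, h2⟩ ⟨h3, h4⟩
    obtain ⟨ε, h, h'⟩ := ((hpos q h1 h2).and (hpos q' h3 h4)).exists
    have hcone : ∀ r, (∀ i ∈ S.idx r, 0 < S.x r i (S.vec J + ε • v)) →
        S.vec J + ε • v ∈ S.cone r := fun r hr i => by
      by_cases hi : i ∈ S.idx r
      · exact (hr i hi).le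
      · simp [S.x_of_notMem hi]
    exact S.idx_eq_of_subset fun i hi =>
      (S.mem_cone_iff (hcone q h)).1 (hcone q' h') i (h i hi).ne'

/-- The signed count of the cones that contain a generic vector `v` after the generators indexed
by `B` have been reversed. This degree of a piecewise linear map does not depend on `v`. -/
theorem sum_prod_sub [Fintype κ] (B : Finset ι) {v : V} (hv : S.Generic v) :
    ∑ p, ∏ i ∈ S.idx p,
        ((if 0 < S.x p i v then (1 : ℝ) else 0) - (if i ∈ B then 1 else 0)) =
      ∑ J ∈ B.powerset, (-1) ^ J.card * (open Classical in if ∃ p, J ⊆ S.idx p then 1 else 0) := by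
  classical
  have step : ∀ p, ∏ i ∈ S.idx p,
      ((if 0 < S.x p i v then (1 : ℝ) else 0) - (if i ∈ B then 1 else 0)) =
      ∑ J ∈ B.powerset, (-1) ^ J.card *
        (if J ⊆ S.idx p ∧ ∀ i ∈ S.idx p \ J, 0 < S.x p i v then 1 else 0) := by
    intro p
    have h1 : ∀ J ∈ (S.idx p).powerset,
        (∏ i ∈ J, (-(if i ∈ B then (1 : ℝ) else 0))) *
          ∏ i ∈ S.idx p \ J, (if 0 < S.x p i v then (1 : ℝ) else 0) =
        if J ⊆ B then (-1) ^ J.card *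
          (if J ⊆ S.idx p ∧ ∀ i ∈ S.idx p \ J, 0 < S.x p i v then 1 else 0) else 0 := by
      intro J hJ
      rw [Finset.mem_powerset] at hJ
      rw [Finset.prod_neg, Finset.prod_ite_zero, Finset.prod_ite_zero]
      simp only [Finset.prod_const_one, hJ, true_and, ← Finset.subset_iff]
      by_cases hB : J ⊆ B <;> simp [hB]
    simp_rw [sub_eq_neg_add]
    rw [Finset.prod_add, Finset.sum_congr rfl h1, ← Finset.sum_filter]
    refine Finset.sum_subset ?_ ?_
    · intro J hJ
      simp only [Finset.mem_filter, Finset.mem_powerset] at hJ ⊢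
      exact hJ.2
    · intro J hJ hJ'
      simp only [Finset.mem_filter, Finset.mem_powerset, not_and] at hJ hJ'
      have : ¬ J ⊆ S.idx p := fun h => hJ' h hJ
      simp [this]
  rw [Finset.sum_congr rfl fun p _ => step p, Finset.sum_comm]
  refine Finset.sum_congr rfl fun J _ => ?_
  rw [← Finset.mul_sum]
  congr 1
  by_cases hJ : ∃ p, J ⊆ S.idx p
  · rw [if_pos hJ]
    obtain ⟨q, hq, huniq⟩ := S.existsUnique_star hJ hv
    rw [Finset.sum_eq_single q, if_pos hq]
    · intro b _ hb
      rw [if_neg fun h => hb (huniq b h)]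
    · simp
  · rw [if_neg hJ]
    refine Finset.sum_eq_zero fun p _ => if_neg fun h => hJ ⟨p, h.1⟩

end SimpleFan

end SimpleFan

end PolytopeAlgebra

namespace PolytopeAlgebra

/-! ### Faces of the polytopes with a given simplicial normal fan -/

section Faces

open Filter Topology

variable {V : Type*} [AddCommGroup V] [Module ℝ V]

theorem mem_convexHull_of_eq {X : Set (Dual ℝ V)} {v : V} {c : ℝ} (hX : ∀ s ∈ X, s v ≤ c)
    {y : Dual ℝ V} (hy : y ∈ convexHull ℝ X) (hyc : y v = c) :
    y ∈ convexHull ℝ {s | s ∈ X ∧ s v = c} := by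
  set X' := {s | s ∈ X ∧ s v = c}
  have hX' : ∀ y ∈ convexHull ℝ X', y v ≤ c := fun y hy =>
    le_of_mem_convexHull (fun s hs => hs.2.le) hy
  have hconv : Convex ℝ {y : Dual ℝ V | y v < c ∨ y ∈ convexHull ℝ X'} := by
    intro a ha b hb s t hs ht hst
    have hle : ∀ y : Dual ℝ V, (y v < c ∨ y ∈ convexHull ℝ X') → y v ≤ c := fun y h =>
      h.elim le_of_lt (hX' y)
    rcases hs.eq_or_lt with rfl | hs
    · simpa [show t = 1 by linarith] using hb
    rcases ht.eq_or_lt with rfl | ht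
    · simpa [show s = 1 by linarith] using ha
    have hval : (s • a + t • b) v = s * a v + t * b v := by simp
    have hc : c = s * c + t * c := by rw [← add_mul, hst, one_mul]
    rcases ha with ha | ha'
    · left
      have := mul_lt_mul_of_pos_left ha hs
      have := mul_le_mul_of_nonneg_left (hle b hb) ht.le
      change (s • a + t • b) v < c
      linarith
    · rcases hb with hb | hb
      · left
        have := mul_lt_mul_of_pos_left hb ht
        have := mul_le_mul_of_nonneg_left (hX' a ha') hs.le
        change (s • a + t • b) v < c
        linarith
      · exact Or.inr (convex_convexHull ℝ X' ha' hb hs.le ht.le hst)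
  have hsub : X ⊆ {y : Dual ℝ V | y v < c ∨ y ∈ convexHull ℝ X'} := fun s hs =>
    (hX s hs).lt_or_eq.imp id fun h => subset_convexHull ℝ X' ⟨hs, h⟩
  rcases convexHull_min hsub hconv hy with h | h
  · exact absurd hyc h.ne
  · exact h

theorem faceAt_convexHull {X : Set (Dual ℝ V)} {v : V} {c : ℝ} (hX : ∀ s ∈ X, s v ≤ c)
    (hc : ∃ s ∈ X, s v = c) :
    faceAt (convexHull ℝ X) v = convexHull ℝ {s | s ∈ X ∧ s v = c} := by
  obtain ⟨s, hs, hsc⟩ := hc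
  have hle : ∀ z ∈ convexHull ℝ X, z v ≤ c := fun z hz => le_of_mem_convexHull hX hz
  refine Set.Subset.antisymm (fun y hy => ?_) fun y hy => ?_
  · exact mem_convexHull_of_eq hX hy.1
      (le_antisymm (hle y hy.1) (hsc ▸ hy.2 s (subset_convexHull ℝ X hs)))
  · have hy' := convexHull_mono (fun s hs => hs.1 : {s | s ∈ X ∧ s v = c} ⊆ X) hy
    have hge : -(y v) ≤ -c := by
      have := le_of_mem_convexHull (v := -v) (c := -c)
        (fun s (hs : s ∈ {s | s ∈ X ∧ s v = c}) => by simp [hs.2]) hy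
      simpa using this
    exact ⟨hy', fun z hz => by linarith [hle z hz]⟩

namespace SimpleFan

variable {ι : Type*} [Fintype ι] [DecidableEq ι] {ξ : ι → V} {κ : Type*} (S : SimpleFan ξ κ)

/-- The convex hull of the points `pt k p` over the maximal cones that contain the `ξ j`, `j ∈ J`;
for admissible `k` it is the face with normals `ξ j`, `j ∈ J`, of the polytope with support numbers
`k`. -/
def face (k : ι → ℝ) (J : Finset ι) : Set (Dual ℝ V) :=
  convexHull ℝ (S.pt k '' {p | J ⊆ S.idx p})

/-- The `ξ j`, `j ∈ J`, generate a cone of the fan. -/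
def IsCone (J : Finset ι) : Prop := ∃ p, J ⊆ S.idx p

theorem pt_mem_face (k : ι → ℝ) {J : Finset ι} {p : κ} (hp : J ⊆ S.idx p) :
    S.pt k p ∈ S.face k J := subset_convexHull ℝ _ ⟨p, hp, rfl⟩

theorem face_nonempty (k : ι → ℝ) {J : Finset ι} (hJ : S.IsCone J) : (S.face k J).Nonempty := by
  obtain ⟨p, hp⟩ := hJ
  exact ⟨_, S.pt_mem_face k hp⟩

theorem isPolytope_face [Finite κ] (k : ι → ℝ) {J : Finset ι} (hJ : S.IsCone J) :
    IsPolytope (S.face k J) := by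
  obtain ⟨p, hp⟩ := hJ
  exact ⟨_, (Set.toFinite _).image _, ⟨_, p, hp, rfl⟩, rfl⟩

theorem xi_of_mem_face (k : ι → ℝ) {J : Finset ι} {y : Dual ℝ V} (hy : y ∈ S.face k J) {j : ι}
    (hj : j ∈ J) : y (ξ j) = k j := by
  refine le_antisymm (le_of_mem_convexHull ?_ hy) ?_
  · rintro _ ⟨p, hp, rfl⟩
    exact (S.pt_xi k (hp hj)).le
  · have := le_of_mem_convexHull (v := -ξ j) (c := -k j) ?_ hy
    · simpa using this
    · rintro _ ⟨p, hp, rfl⟩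
      simp [S.pt_xi k (hp hj)]

theorem xi_le_of_mem_face {k : ι → ℝ} (hk : S.Adm k) {J : Finset ι} {y : Dual ℝ V}
    (hy : y ∈ S.face k J) (i : ι) : y (ξ i) ≤ k i := by
  refine le_of_mem_convexHull ?_ hy
  rintro _ ⟨p, -, rfl⟩
  exact S.pt_xi_le hk p i

theorem faceAt_face_eq {k : ι → ℝ} {J J' : Finset ι} (hJJ : J ⊆ J') (hJ' : S.IsCone J') {u : V}
    {c : ℝ} (hle : ∀ q, J ⊆ S.idx q → S.pt k q u ≤ c)
    (heq : ∀ q, J ⊆ S.idx q → (S.pt k q u = c ↔ J' ⊆ S.idx q)) :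
    faceAt (S.face k J) u = S.face k J' := by
  obtain ⟨p, hp⟩ := hJ'
  rw [face, faceAt_convexHull (c := c)]
  · rw [face]
    congr 1
    ext y
    constructor
    · rintro ⟨⟨q, hq, rfl⟩, h⟩
      exact ⟨q, (heq q hq).1 h, rfl⟩
    · rintro ⟨q, hq, rfl⟩
      exact ⟨⟨q, hJJ.trans hq, rfl⟩, (heq q (hJJ.trans hq)).2 hq⟩
  · rintro _ ⟨q, hq, rfl⟩
    exact hle q hq
  · exact ⟨_, ⟨p, hJJ.trans hp, rfl⟩, (heq p (hJJ.trans hp)).2 hp⟩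

/-- Positive combinations of normals `ξ t`, `t ∈ T`, cut out the expected faces. -/
theorem faceAt_face_sum {k : ι → ℝ} (hk : S.Adm k) {J T : Finset ι} (hJT : S.IsCone (J ∪ T))
    {c : ι → ℝ} (hc : ∀ t ∈ T, 0 < c t) :
    faceAt (S.face k J) (∑ t ∈ T, c t • ξ t) = S.face k (J ∪ T) := by
  refine S.faceAt_face_eq Finset.subset_union_left hJT (c := ∑ t ∈ T, c t * k t)
    (fun q _ => ?_) fun q hq => ?_
  · rw [map_sum]
    refine Finset.sum_le_sum fun t ht => ?_
    rw [map_smul, smul_eq_mul]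
    exact mul_le_mul_of_nonneg_left (S.pt_xi_le hk q t) (hc t ht).le
  · rw [map_sum, Finset.sum_eq_sum_iff_of_le fun t ht => by
      rw [map_smul, smul_eq_mul]
      exact mul_le_mul_of_nonneg_left (S.pt_xi_le hk q t) (hc t ht).le]
    constructor
    · refine fun h => Finset.union_subset hq fun t ht => ?_
      by_contra hn
      have := h t ht
      rw [map_smul, smul_eq_mul] at this
      exact (hk q t hn).ne (mul_left_cancel₀ (hc t ht).ne' this)
    · intro h t ht
      rw [map_smul, smul_eq_mul, S.pt_xi k (h (Finset.mem_union_right J ht))]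

/-- Every face of a face is of the form `face k J'`, where `J'` does not depend on `k`. -/
theorem exists_faceAt_face [Finite κ] {J : Finset ι} (hJ : S.IsCone J) (u : V) :
    ∃ J', J ⊆ J' ∧ S.IsCone J' ∧ ∀ k, S.Adm k → faceAt (S.face k J) u = S.face k J' := by
  obtain ⟨p, hp⟩ := hJ
  have h1 : ∀ᶠ ε in 𝓝[>] (0 : ℝ), ∀ (q : κ) (i : ι), 0 < 1 + ε * S.x q i u := by
    simp only [eventually_all]
    exact fun q i => eventually_add_mul_pos one_pos _
  obtain ⟨ε, ⟨hε1, hε2⟩, hε⟩ := ((h1.and (S.eventually_mem_cone (S.vec J) u)).and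
    self_mem_nhdsWithin).exists
  have hε' : (0 : ℝ) < ε := hε
  set v := S.vec J + ε • u with hv
  obtain ⟨q₀, hq₀⟩ := S.complete v
  have hJq₀ := (S.vec_mem_cone_iff hp).1 (hε2 q₀ hq₀)
  set J' := Finset.univ.filter fun i => S.x q₀ i v ≠ 0 with hJ'
  have hJ'q : ∀ q, J' ⊆ S.idx q ↔ ∀ i, S.x q₀ i v ≠ 0 → i ∈ S.idx q := fun q => by
    simp [hJ', Finset.subset_iff]
  have hJJ' : J ⊆ J' := by
    intro i hi
    have : S.x q₀ i v = 1 + ε * S.x q₀ i u := by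
      rw [hv, map_add, map_smul, S.x_vec hJq₀, if_pos hi, smul_eq_mul]
    simp only [hJ', Finset.mem_filter, Finset.mem_univ, true_and, this]
    exact (hε1 q₀ i).ne'
  have hJ'q₀ : J' ⊆ S.idx q₀ := (hJ'q q₀).2 ((S.mem_cone_iff hq₀).1 hq₀)
  refine ⟨J', hJJ', ⟨q₀, hJ'q₀⟩, fun k hk => ?_⟩
  have hvec : ∀ q, J ⊆ S.idx q → S.pt k q v = ∑ j ∈ J, k j + ε * S.pt k q u := by
    intro q hq
    rw [hv, map_add, map_smul, smul_eq_mul, vec, map_sum]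
    congr 1
    exact Finset.sum_congr rfl fun j hj => S.pt_xi k (hq hj)
  refine S.faceAt_face_eq hJJ' ⟨q₀, hJ'q₀⟩ (c := S.pt k q₀ u) (fun q hq => ?_) fun q hq => ?_
  · have := S.le_pt hq₀ (S.pt_xi_le hk q)
    rw [hvec q hq, hvec q₀ hJq₀] at this
    exact le_of_mul_le_mul_left (by linarith) hε'
  · rw [hJ'q, ← S.pt_eq_iff hk hq₀, hvec q hq, hvec q₀ hJq₀, add_right_inj,
      mul_right_inj' hε'.ne']

/-- The annihilator of the `ξ j`, `j ∈ J`. -/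
def dir (_ : SimpleFan ξ κ) (J : Finset ι) : Submodule ℝ (Dual ℝ V) :=
  ⨅ j : J, LinearMap.ker (Dual.eval ℝ V (ξ j))

theorem mem_dir {J : Finset ι} {y : Dual ℝ V} : y ∈ S.dir J ↔ ∀ j ∈ J, y (ξ j) = 0 := by
  simp [dir]

theorem eq_sum_x (p : κ) (y : Dual ℝ V) : y = ∑ i ∈ S.idx p, y (ξ i) • S.x p i := by
  ext v
  rw [S.apply_eq p, LinearMap.sum_apply, ← Finset.sum_subset (Finset.subset_univ (S.idx p))]
  · simp [mul_comm]
  · intro i _ hi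
    simp [S.x_of_notMem hi]

theorem dir_eq_span {J : Finset ι} {p : κ} (hp : J ⊆ S.idx p) :
    S.dir J = Submodule.span ℝ (S.x p '' (S.idx p \ J : Finset ι)) := by
  refine le_antisymm (fun y hy => ?_) (Submodule.span_le.2 ?_)
  · rw [S.eq_sum_x p y]
    refine Submodule.sum_mem _ fun i hi => ?_
    by_cases hiJ : i ∈ J
    · rw [S.mem_dir.1 hy i hiJ, zero_smul]
      exact Submodule.zero_mem _
    · exact Submodule.smul_mem _ _ (Submodule.subset_span ⟨i, by simp [hi, hiJ], rfl⟩)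
  · rintro _ ⟨i, hi, rfl⟩
    rw [Finset.mem_coe, Finset.mem_sdiff] at hi
    refine S.mem_dir.2 fun j hj => ?_
    rw [S.x_xi (hp hj), if_neg]
    rintro rfl
    exact hi.2 hj

theorem linearIndepOn_x (p : κ) : LinearIndepOn ℝ (S.x p) (S.idx p : Set ι) := by
  rw [linearIndepOn_finset_iff]
  intro c hc i hi
  have := congrArg (fun f => f (ξ i)) hc
  simpa [LinearMap.sum_apply, S.x_xi hi, hi] using this

theorem finrank_dir {J : Finset ι} (hJ : S.IsCone J) :
    finrank ℝ (S.dir J) + J.card = finrank ℝ V := by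
  obtain ⟨p, hp⟩ := hJ
  have h := (S.linearIndepOn_x p).mono (t := (S.idx p \ J : Finset ι)) (by simp)
  have h2 := finrank_span_eq_card h
  rw [S.dir_eq_span hp, Set.image_eq_range, h2, ← S.card_idx p]
  simp only [Finset.coe_sort_coe, Fintype.card_coe]
  exact Finset.card_sdiff_add_card_eq_card hp

theorem vectorSpan_face [Finite κ] {k : ι → ℝ} (hk : S.Adm k) {J : Finset ι} (hJ : S.IsCone J) :
    vectorSpan ℝ (S.face k J) = S.dir J := by
  refine le_antisymm ?_ ?_
  · rw [vectorSpan_le_iff]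
    intro x hx y hy
    refine S.mem_dir.2 fun j hj => ?_
    simp [S.xi_of_mem_face k hx hj, S.xi_of_mem_face k hy hj]
  · obtain ⟨p, hp⟩ := hJ
    rw [S.dir_eq_span hp, Submodule.span_le]
    rintro _ ⟨i, hi, rfl⟩
    rw [Finset.mem_coe, Finset.mem_sdiff] at hi
    obtain ⟨q, hq, hiq⟩ := S.exists_neighbour hi.1
    have hJq : J ⊆ S.idx q := fun j hj => hq (by
      rw [Finset.mem_erase]
      exact ⟨fun h => hi.2 (h ▸ hj), hp hj⟩)
    have hmem := sub_mem_vectorSpan (S.pt_mem_face k hJq) (S.pt_mem_face k hp)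
    have heq : S.pt k q - S.pt k p = (S.pt k q (ξ i) - k i) • S.x p i := by
      rw [S.eq_sum_x p (S.pt k q - S.pt k p), Finset.sum_eq_single i]
      · simp [S.pt_xi k hi.1]
      · intro j hj hji
        simp [S.pt_xi k hj, S.pt_xi k (hq (Finset.mem_erase.2 ⟨hji, hj⟩))]
      · exact fun h => absurd hi.1 h
    have hne : S.pt k q (ξ i) - k i ≠ 0 := by linarith [hk q i hiq]
    rw [heq] at hmem
    simpa [smul_smul, hne] using Submodule.smul_mem _ (S.pt k q (ξ i) - k i)⁻¹ hmem

theorem dimP_face [Finite κ] {k : ι → ℝ} (hk : S.Adm k) {J : Finset ι} (hJ : S.IsCone J) :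
    dimP (S.face k J) + J.card = finrank ℝ V := by
  rw [dimP, S.vectorSpan_face hk hJ, S.finrank_dir hJ]

theorem subset_of_face_subset [Finite κ] {k : ι → ℝ} (hk : S.Adm k) {J J' : Finset ι}
    (hJ : S.IsCone J) (h : S.face k J ⊆ S.face k J') : J' ⊆ J := by
  intro i hi
  by_contra hiJ
  obtain ⟨p, hp⟩ := hJ
  obtain ⟨q, hq, hiq⟩ : ∃ q, J ⊆ S.idx q ∧ i ∉ S.idx q := by
    by_cases hip : i ∈ S.idx p
    · obtain ⟨q, hq, hiq⟩ := S.exists_neighbour hip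
      exact ⟨q, fun j hj => hq (Finset.mem_erase.2 ⟨fun h => hiJ (h ▸ hj), hp hj⟩), hiq⟩
    · exact ⟨p, hp, hip⟩
  have := S.xi_of_mem_face k (h (S.pt_mem_face k hq)) hi
  exact (hk q i hiq).ne this

theorem face_injective [Finite κ] {k : ι → ℝ} (hk : S.Adm k) {J J' : Finset ι}
    (hJ : S.IsCone J) (hJ' : S.IsCone J') (h : S.face k J = S.face k J') : J = J' :=
  (S.subset_of_face_subset hk hJ' h.ge).antisymm (S.subset_of_face_subset hk hJ h.le)

/-- The index sets of the facets of the face `face k J`: the cones one dimension larger. -/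
def link (J : Finset ι) : Type _ :=
  {J' : Finset ι // J ⊆ J' ∧ J'.card = J.card + 1 ∧ S.IsCone J'}

theorem face_eq_faceAt {k : ι → ℝ} (hk : S.Adm k) {J J' : Finset ι} (h : J ⊆ J')
    (hJ' : S.IsCone J') : S.face k J' = faceAt (S.face k J) (S.vec J') := by
  have := S.faceAt_face_sum hk (J := J) (T := J') (by rwa [Finset.union_eq_right.2 h])
    (c := fun _ => 1) (by simp)
  rw [Finset.union_eq_right.2 h] at this
  simpa [vec] using this.symm

theorem isFacet_face [Finite κ] {k : ι → ℝ} (hk : S.Adm k) {J : Finset ι} (J' : S.link J) :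
    IsFacet (S.face k J) (S.face k J'.1) := by
  obtain ⟨J', h1, h2, h3⟩ := J'
  have hJ : S.IsCone J := h3.imp fun p hp => h1.trans hp
  refine ⟨⟨S.face_nonempty k h3, _, S.face_eq_faceAt hk h1 h3⟩, ?_⟩
  have := S.dimP_face hk h3
  have := S.dimP_face hk hJ
  dsimp only
  omega

theorem exists_of_isFacet [Finite κ] {k : ι → ℝ} (hk : S.Adm k) {J : Finset ι} (hJ : S.IsCone J)
    {F : Set (Dual ℝ V)} (hF : IsFacet (S.face k J) F) :
    ∃ J' : S.link J, S.face k J'.1 = F := by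
  obtain ⟨⟨-, u, rfl⟩, hdim⟩ := hF
  obtain ⟨J', h1, h2, h3⟩ := S.exists_faceAt_face hJ u
  rw [h3 k hk] at hdim ⊢
  have := S.dimP_face hk h2
  have := S.dimP_face hk hJ
  exact ⟨⟨J', h1, by omega, h2⟩, rfl⟩

theorem facet_bijective [Finite κ] {k : ι → ℝ} (hk : S.Adm k) {J : Finset ι} (hJ : S.IsCone J) :
    Function.Bijective (fun J' : S.link J =>
      (⟨S.face k J'.1, S.isFacet_face hk J'⟩ : {F // IsFacet (S.face k J) F})) := by
  refine ⟨fun J' J'' h => Subtype.ext ?_, fun ⟨F, hF⟩ => ?_⟩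
  · exact S.face_injective hk J'.2.2.2 J''.2.2.2 (congrArg Subtype.val h)
  · obtain ⟨J', h⟩ := S.exists_of_isFacet hk hJ hF
    exact ⟨J', Subtype.ext h⟩

/-- Polytopes with the same simplicial normal fan are analogous. -/
theorem analogous_face [Finite κ] {k k' : ι → ℝ} (hk : S.Adm k) (hk' : S.Adm k') (m : ℕ) :
    ∀ J, S.IsCone J → J.card + m = finrank ℝ V → Analogous m (S.face k J) (S.face k' J) := by
  induction m with
  | zero =>
    intro J hJ hcard
    obtain ⟨p, hp⟩ := hJ
    obtain rfl : J = S.idx p := Finset.eq_of_subset_of_card_le hp (by rw [S.card_idx]; omega)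
    have : {q | S.idx p ⊆ S.idx q} = {p} := by
      ext q
      exact ⟨fun h => (S.idx_eq_of_subset h).symm, fun h => h ▸ Finset.Subset.refl _⟩
    simp [Analogous, face, this]
  | succ m ih =>
    intro J hJ hcard
    refine ⟨?_, ?_, (Equiv.ofBijective _ (S.facet_bijective hk hJ)).symm.trans
      (Equiv.ofBijective _ (S.facet_bijective hk' hJ)), ?_⟩
    · have := S.dimP_face hk hJ
      omega
    · rw [S.vectorSpan_face hk hJ, S.vectorSpan_face hk' hJ]
    · intro F
      obtain ⟨J', rfl⟩ := (Equiv.ofBijective _ (S.facet_bijective hk hJ)).surjective F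
      simp only [Equiv.trans_apply, Equiv.symm_apply_apply]
      refine ⟨⟨S.vec J'.1, S.face_eq_faceAt hk J'.2.1 J'.2.2.2,
        S.face_eq_faceAt hk' J'.2.1 J'.2.2.2⟩, ih _ J'.2.2.2 ?_⟩
      have := J'.2.2.1
      omega

end SimpleFan

end Faces

end PolytopeAlgebra

namespace PolytopeAlgebra

/-! ### Analogous polytopes have the same normal fan -/

section Analogous

variable {V : Type*} [AddCommGroup V] [Module ℝ V]

theorem isPolytope_faceAt {P : Set (Dual ℝ V)} (hP : IsPolytope P) (v : V) :
    IsPolytope (faceAt P v) := by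
  obtain ⟨X, hfin, hne, rfl⟩ := hP
  obtain ⟨y, hyX, hy⟩ := exists_mem_faceAt_of_finite hfin hne v
  have hle : ∀ s ∈ X, s v ≤ y v := fun s hs => hy.2 s (subset_convexHull ℝ X hs)
  exact ⟨{s | s ∈ X ∧ s v = y v}, hfin.subset fun s hs => hs.1, ⟨y, hyX, rfl⟩,
    (faceAt_convexHull hle ⟨y, hyX, rfl⟩).symm⟩

namespace SimpleFan

variable {ι : Type*} [Fintype ι] [DecidableEq ι] {ξ : ι → V} {κ : Type*}
  (S : SimpleFan ξ κ) {k : ι → ℝ} {m : ℕ} {J : Finset ι} {G : Set (Dual ℝ V)}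

theorem face_insert (hk : S.Adm k) {i : ι} (hi : S.IsCone (insert i J)) :
    faceAt (S.face k J) (ξ i) = S.face k (insert i J) := by
  have := S.faceAt_face_sum hk (J := J) (T := {i}) (c := fun _ => 1) (by
    rwa [Finset.union_comm, ← Finset.insert_eq]) (by simp)
  rw [Finset.union_comm, ← Finset.insert_eq] at this
  simpa using this

theorem dimP_faceAt_face [Finite κ] (hk : S.Adm k) {i : ι} (hiJ : i ∉ J)
    (hi : S.IsCone (insert i J)) :
    dimP (faceAt (S.face k J) (ξ i)) + 1 = dimP (S.face k J) := by
  rw [S.face_insert hk hi]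
  have h1 := S.dimP_face hk hi
  have h2 := S.dimP_face hk (hi.imp fun p hp => (Finset.subset_insert i J).trans hp :
    S.IsCone J)
  rw [Finset.card_insert_of_notMem hiJ] at h1
  omega

theorem facet_of_analogous [FiniteDimensional ℝ V] [Finite κ] (hk : S.Adm k)
    (hA : Analogous (m + 1) (S.face k J) G) {i : ι} (hiJ : i ∉ J)
    (hi : S.IsCone (insert i J)) : IsFacet G (faceAt G (ξ i)) ∧
      Analogous m (S.face k (insert i J)) (faceAt G (ξ i)) := by
  obtain ⟨-, hvs, e, he⟩ := hA
  let J' : S.link J := ⟨insert i J, Finset.subset_insert i J, Finset.card_insert_of_notMem hiJ, hi⟩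
  obtain ⟨⟨v, h1, h2⟩, h3⟩ := he ⟨_, S.isFacet_face hk J'⟩
  have hF : faceAt (S.face k J) (ξ i) = faceAt (S.face k J) v := (S.face_insert hk hi).trans h1
  have hG : faceAt G (ξ i) = faceAt G v := faceAt_eq_of_parallel hvs
    (by rw [S.face_insert hk hi]; exact S.face_nonempty k hi) (S.dimP_faceAt_face hk hiJ hi) hF
  rw [hG, ← h2]
  exact ⟨(e _).2, h3⟩

theorem exists_of_isFacet_of_analogous [FiniteDimensional ℝ V] [Finite κ] (hk : S.Adm k)
    (hJ : S.IsCone J) (hA : Analogous (m + 1) (S.face k J) G) {G' : Set (Dual ℝ V)}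
    (hG' : IsFacet G G') :
    ∃ i ∉ J, S.IsCone (insert i J) ∧ G' = faceAt G (ξ i) := by
  obtain ⟨-, hvs, e, he⟩ := hA
  obtain ⟨F, hF⟩ := e.surjective ⟨G', hG'⟩
  obtain ⟨J', hJ'⟩ := S.exists_of_isFacet hk hJ F.2
  obtain ⟨J', h1, h2, h3⟩ := J'
  obtain ⟨i, hiJ, rfl⟩ : ∃ i ∉ J, insert i J = J' :=
    (Finset.covBy_iff_exists_insert.1 (Finset.covBy_iff_card_sdiff_eq_one.2
      ⟨h1, by rw [Finset.card_sdiff_of_subset h1]; omega⟩))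
  obtain ⟨⟨v, h4, h5⟩, -⟩ := he F
  refine ⟨i, hiJ, h3, ?_⟩
  rw [hF] at h5
  dsimp only at h5 hJ'
  rw [h5]
  refine (faceAt_eq_of_parallel hvs (by rw [S.face_insert hk h3]; exact S.face_nonempty k h3)
    (S.dimP_faceAt_face hk hiJ h3) ?_).symm
  rw [S.face_insert hk h3, hJ', h4]

/-- A polytope `G` analogous to a face has, for every vertex `p` of the face, a point which lies on
all the faces of `G` with the normals at `p`. The crucial step is that two facets of `G`
meet if the corresponding facets at `p` do: otherwise, rotating the first normal towards the
second one, one would find a facet of `G` with a normal strictly between them. -/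
theorem exists_common_point [FiniteDimensional ℝ V] [Finite κ] (hk : S.Adm k) (m : ℕ) :
    ∀ (J : Finset ι) (G : Set (Dual ℝ V)), IsPolytope G → J.card + m = finrank ℝ V →
    Analogous m (S.face k J) G → ∀ p, J ⊆ S.idx p →
    ∃ q, ∀ i ∈ S.idx p, q ∈ faceAt G (ξ i) := by
  induction m with
  | zero =>
    rintro J G hG - ⟨-, q, rfl⟩ p -
    exact ⟨q, fun i _ => ⟨rfl, fun z hz => by rw [Set.mem_singleton_iff.1 hz]⟩⟩
  | succ m ih =>
    intro J G hG hcard hA p hp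
    have hJ : S.IsCone J := ⟨p, hp⟩
    have hvs : vectorSpan ℝ (S.face k J) = vectorSpan ℝ G := hA.2.1
    obtain ⟨i₀, hi₀⟩ : (S.idx p \ J).Nonempty := by
      rw [← Finset.card_pos, Finset.card_sdiff_of_subset hp, S.card_idx]
      omega
    rw [Finset.mem_sdiff] at hi₀
    have hcone : ∀ {i}, i ∈ S.idx p → S.IsCone (insert i J) := fun hi =>
      ⟨p, Finset.insert_subset hi hp⟩
    obtain ⟨hfac, hA'⟩ := S.facet_of_analogous hk hA hi₀.2 (hcone hi₀.1)
    obtain ⟨q, hq⟩ := ih (insert i₀ J) _ (isPolytope_faceAt hG _)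
      (by rw [Finset.card_insert_of_notMem hi₀.2]; omega) hA' p (Finset.insert_subset hi₀.1 hp)
    have hqG : q ∈ faceAt G (ξ i₀) := (hq i₀ hi₀.1).1
    refine ⟨q, fun j hj => ?_⟩
    by_cases hjJ : j ∈ J
    · rw [faceAt_eq_self]
      · exact hqG.1
      · rw [← hvs, S.vectorSpan_face hk hJ]
        exact fun d hd => S.mem_dir.1 hd j hjJ
    by_cases hji : j = i₀
    · exact hji ▸ hqG
    -- `t` is the first parameter at which the face with normal `ξ i₀ + t • ξ j` contains a point
    -- beyond `q` in the direction `ξ j`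
    obtain ⟨X, hfin, hne, rfl⟩ := hG
    refine ⟨hqG.1, fun z hz => le_of_mem_convexHull ?_ hz⟩
    by_contra! hcon
    have hpos : ∀ s ∈ X, q (ξ j) < s (ξ j) → 0 < q (ξ i₀) - s (ξ i₀) := by
      intro s hs hlt
      have hsX := subset_convexHull ℝ X hs
      rcases (hqG.2 s hsX).lt_or_eq with h | h
      · linarith
      · have := (hq j hj).2 s ⟨hsX, fun z hz => h ▸ hqG.2 z hz⟩
        linarith
    obtain ⟨s₀, hs₀, hmin⟩ := Set.exists_min_image {s | s ∈ X ∧ q (ξ j) < s (ξ j)}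
      (fun s => (q (ξ i₀) - s (ξ i₀)) / (s (ξ j) - q (ξ j))) (hfin.subset fun s hs => hs.1) hcon
    set t := (q (ξ i₀) - s₀ (ξ i₀)) / (s₀ (ξ j) - q (ξ j)) with ht
    have ht0 : 0 < t := div_pos (hpos s₀ hs₀.1 hs₀.2) (by linarith [hs₀.2])
    set w := ξ i₀ + t • ξ j with hw
    have hwle : ∀ s ∈ X, s w ≤ q w := by
      intro s hs
      simp only [hw, map_add, map_smul, smul_eq_mul]
      have h1 := hqG.2 s (subset_convexHull ℝ X hs)
      rcases le_or_gt (s (ξ j)) (q (ξ j)) with h | h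
      · have := mul_le_mul_of_nonneg_left h ht0.le
        linarith
      · have := hmin s ⟨hs, h⟩
        rw [le_div_iff₀ (by linarith)] at this
        linarith
    have hs₀w : s₀ w = q w := by
      have : s₀ (ξ j) - q (ξ j) ≠ 0 := by linarith [hs₀.2]
      simp only [hw, map_add, map_smul, smul_eq_mul, ht]
      field_simp
      ring
    have hwle' : ∀ z ∈ convexHull ℝ X, z w ≤ q w := fun z hz => le_of_mem_convexHull hwle hz
    have hw_mem : ∀ z ∈ convexHull ℝ X, z w = q w → z ∈ faceAt (convexHull ℝ X) w :=
      fun z hz h => ⟨hz, fun y hy => h ▸ hwle' y hy⟩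
    -- the face with normal `w` strictly contains the ridge `G_{i₀} ∩ G_j`, so it is a facet
    obtain ⟨m, rfl⟩ : ∃ m', m = m' + 1 := by
      refine Nat.exists_eq_succ_of_ne_zero fun h => ?_
      have := Finset.card_le_card (Finset.insert_subset hj (Finset.insert_subset hi₀.1 hp))
      rw [S.card_idx, Finset.card_insert_of_notMem (by simp [hji, hjJ]),
        Finset.card_insert_of_notMem hi₀.2] at this
      omega
    obtain ⟨hridge, -⟩ := S.facet_of_analogous hk hA' (i := j) (by simp [hji, hjJ])
      ⟨p, Finset.insert_subset hj (Finset.insert_subset hi₀.1 hp)⟩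
    have hdim1 : dimP (faceAt (faceAt (convexHull ℝ X) (ξ i₀)) (ξ j)) <
        dimP (faceAt (convexHull ℝ X) w) := by
      refine Submodule.finrank_lt_finrank_of_lt (lt_of_le_of_ne (vectorSpan_mono ℝ ?_) ?_)
      · intro r hr
        refine hw_mem r hr.1.1 ?_
        simp only [hw, map_add, faceAt_eq_of_mem hr.1 hqG, map_smul,
          faceAt_eq_of_mem hr (hq j hj)]
      · intro h
        have hmem := sub_mem_vectorSpan (hw_mem q hqG.1 rfl)
          (hw_mem s₀ (subset_convexHull ℝ X hs₀.1) hs₀w)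
        rw [← h] at hmem
        have := vectorSpan_faceAt_le_ker _ _ (vectorSpan_mono ℝ (faceAt_subset _ _) hmem)
        have h2 := hpos s₀ hs₀.1 hs₀.2
        simp at this
        linarith
    have hdim2 : dimP (faceAt (convexHull ℝ X) w) < dimP (convexHull ℝ X) := by
      refine Submodule.finrank_lt_finrank_of_lt
        (lt_of_le_of_ne (vectorSpan_mono ℝ (faceAt_subset _ _)) fun h => ?_)
      have hmem : S.x p j ∈ vectorSpan ℝ (convexHull ℝ X) := by
        rw [← hvs, S.vectorSpan_face hk hJ, S.mem_dir]
        intro l hl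
        rw [S.x_xi (hp hl), if_neg]
        rintro rfl
        exact hjJ hl
      rw [← h] at hmem
      have := vectorSpan_faceAt_le_ker _ _ hmem
      have h0 : S.x p j (ξ i₀) + t * S.x p j (ξ j) = 0 := by simpa [hw] using this
      rw [S.x_xi hi₀.1, S.x_xi hj, if_neg hji, if_pos rfl] at h0
      linarith
    have hdim : dimP (faceAt (convexHull ℝ X) w) + 1 = dimP (convexHull ℝ X) := by
      have := hridge.2
      have := hfac.2
      omega
    have hqw := hw_mem q hqG.1 rfl
    obtain ⟨l, hlJ, hl, hleq⟩ := S.exists_of_isFacet_of_analogous hk hJ hA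
      (G' := faceAt (convexHull ℝ X) w) ⟨⟨⟨q, hqw⟩, w, rfl⟩, hdim⟩
    have h1 := faceAt_eq_of_parallel hvs.symm ⟨q, hqw⟩ hdim hleq
    have h2 : faceAt (S.face k J) w = S.face k (J ∪ {i₀, j}) := by
      have hsub : J ∪ {i₀, j} ⊆ S.idx p := Finset.union_subset hp (by
        simp [Finset.insert_subset_iff, hi₀.1, hj])
      have := S.faceAt_face_sum hk (J := J) (T := {i₀, j}) ⟨p, hsub⟩
        (c := fun i => if i = j then t else 1) (by
          intro i _
          split_ifs <;> simp [ht0])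
      rw [Finset.sum_pair (Ne.symm hji)] at this
      simpa [Ne.symm hji, hw] using this
    rw [h2, S.face_insert hk hl] at h1
    have h3 := S.face_injective hk ⟨p, Finset.union_subset hp (by
        simp [Finset.insert_subset_iff, hi₀.1, hj])⟩ hl h1
    have h4 := congrArg Finset.card h3
    rw [Finset.card_insert_of_notMem hlJ, Finset.card_union_of_disjoint
      (by simp [hi₀.2, hjJ]), Finset.card_pair (Ne.symm hji)] at h4
    omega

end SimpleFan

end Analogous

end PolytopeAlgebra

namespace PolytopeAlgebra

/-! ### The normal fan of a simple polytope -/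

section NormalFan

open Filter Topology

variable {V : Type*} [AddCommGroup V] [Module ℝ V]

theorem mem_faceAt_convexHull_iff {X : Set (Dual ℝ V)} {p : Dual ℝ V} (hp : p ∈ convexHull ℝ X)
    {v : V} : p ∈ faceAt (convexHull ℝ X) v ↔ ∀ s ∈ X, s v ≤ p v :=
  ⟨fun h s hs => h.2 s (subset_convexHull ℝ X hs),
    fun h => ⟨hp, fun _ hz => le_of_mem_convexHull h hz⟩⟩

theorem mem_of_isFace_singleton {X : Set (Dual ℝ V)} (hfin : X.Finite) (hne : X.Nonempty)
    {p : Dual ℝ V} (hp : IsFace (convexHull ℝ X) {p}) : p ∈ X := by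
  obtain ⟨-, v, hv⟩ := hp
  obtain ⟨y, hyX, hy⟩ := exists_mem_faceAt_of_finite hfin hne v
  rw [← hv, Set.mem_singleton_iff] at hy
  exact hy ▸ hyX

theorem IsPolytope.finite_vertices {P : Set (Dual ℝ V)} (hP : IsPolytope P) :
    Finite {p // IsFace P {p}} := by
  obtain ⟨X, hfin, hne, rfl⟩ := hP
  exact (hfin.subset fun p hp => mem_of_isFace_singleton hfin hne hp).to_subtype

/-- A strict lexicographic maximum of `(v, u)` is a strict maximum of `v + ε • u` for
small `ε`. -/
theorem eventually_lt_of_lex {X : Set (Dual ℝ V)} (hfin : X.Finite) {p : Dual ℝ V} {v u : V}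
    (hp : ∀ s ∈ X, s ≠ p → s v < p v ∨ s v = p v ∧ s u < p u) :
    ∀ᶠ ε in 𝓝[>] (0 : ℝ), ∀ s ∈ X, s ≠ p → s (v + ε • u) < p (v + ε • u) := by
  rw [Filter.eventually_all_finite hfin]
  intro s hs
  by_cases hsp : s = p
  · simp [hsp]
  rcases hp s hs hsp with h | ⟨h1, h2⟩
  · filter_upwards [eventually_add_mul_pos (sub_pos.2 h) (p u - s u)] with ε hε _
    simp only [map_add, map_smul, smul_eq_mul]
    linarith
  · filter_upwards [self_mem_nhdsWithin] with ε hε _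
    have hε' : (0 : ℝ) < ε := hε
    simp only [map_add, map_smul, smul_eq_mul, h1]
    linarith [mul_lt_mul_of_pos_left h2 hε']

/-- Every face contains a vertex: perturb the normal vector generically. -/
theorem IsPolytope.exists_vertex_mem_faceAt {P : Set (Dual ℝ V)} (hP : IsPolytope P) (v : V) :
    ∃ p ∈ faceAt P v, IsFace P {p} := by
  obtain ⟨X, hfin, hne, rfl⟩ := hP
  have : Finite {a : Dual ℝ V //
      a ∈ (fun z : Dual ℝ V × Dual ℝ V => z.1 - z.2) '' (X ×ˢ X) ∧ a ≠ 0} :=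
    (((hfin.prod hfin).image _).subset fun a ha => ha.1).to_subtype
  obtain ⟨u, hu⟩ := PolytopeAlgebra.exists_generic
    (fun a : {a : Dual ℝ V //
      a ∈ (fun z : Dual ℝ V × Dual ℝ V => z.1 - z.2) '' (X ×ˢ X) ∧ a ≠ 0} => a.1) fun a => a.2.2
  have hinj : ∀ s ∈ X, ∀ t ∈ X, s ≠ t → s u ≠ t u := by
    intro s hs t ht hst h
    exact hu ⟨s - t, ⟨(s, t), ⟨hs, ht⟩, rfl⟩, sub_ne_zero.2 hst⟩ (by simp [h])
  obtain ⟨y, hyX, hy⟩ := exists_mem_faceAt_of_finite hfin hne v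
  obtain ⟨p, ⟨hpX, hp⟩, hmax⟩ := Set.exists_max_image (X ∩ faceAt (convexHull ℝ X) v)
    (fun s => s u) (hfin.inter_of_left _) ⟨y, hyX, hy⟩
  have hpP := subset_convexHull ℝ X hpX
  obtain ⟨ε, hε⟩ := (eventually_lt_of_lex (v := v) (u := u) (p := p) hfin (by
    intro s hs hsp
    have hsP := subset_convexHull ℝ X hs
    refine (hp.2 s hsP).lt_or_eq.imp id fun h => ⟨h, lt_of_le_of_ne
      (hmax s ⟨hs, hsP, fun z hz => ?_⟩) (hinj s hs p hpX hsp)⟩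
    exact h ▸ hp.2 z hz)).exists
  refine ⟨p, hp, ⟨p, rfl⟩, v + ε • u, ?_⟩
  have hle : ∀ s ∈ X, s (v + ε • u) ≤ p (v + ε • u) := fun s hs => by
    by_cases hsp : s = p
    · rw [hsp]
    · exact (hε s hs hsp).le
  rw [faceAt_convexHull hle ⟨p, hpX, rfl⟩, eq_comm]
  have : {s | s ∈ X ∧ s (v + ε • u) = p (v + ε • u)} = {p} := by
    ext s
    simp only [Set.mem_ofPred_eq, Set.mem_singleton_iff]
    refine ⟨fun ⟨hs, h⟩ => ?_, fun h => by rw [h]; exact ⟨hpX, rfl⟩⟩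
    by_contra hsp
    exact (hε s hs hsp).ne h
  rw [this, convexHull_singleton]

theorem IsPolytope.eq_convexHull_vertices [FiniteDimensional ℝ V] {P : Set (Dual ℝ V)}
    (hP : IsPolytope P) : convexHull ℝ {p | IsFace P {p}} = P := by
  have hmem : ∀ p, IsFace P {p} → p ∈ P := fun p hp => by
    obtain ⟨-, v, hv⟩ := hp
    exact (hv ▸ Set.mem_singleton p : p ∈ PolytopeAlgebra.faceAt P v).1
  have hfin : {p | IsFace P {p}}.Finite := Set.finite_coe_iff.1 hP.finite_vertices
  have hne : {p | IsFace P {p}}.Nonempty :=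
    let ⟨p, _, hp⟩ := hP.exists_vertex_mem_faceAt 0
    ⟨p, hp⟩
  refine Set.Subset.antisymm ?_ fun y hy => ?_
  · obtain ⟨X, -, -, rfl⟩ := hP
    exact convexHull_min hmem (convex_convexHull ℝ X)
  · by_contra hn
    obtain ⟨v, hv⟩ := IsPolytope.exists_separating ⟨_, hfin, hne, rfl⟩ hn
    obtain ⟨p, hp, hpv⟩ := hP.exists_vertex_mem_faceAt v
    exact absurd (hp.2 y hy) (not_le.2 (hv p (subset_convexHull ℝ _ hpv)))

variable {ι : Type*}

/-- The normal cone at a point of a full dimensional polytope is generated by the normals of the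
facets through this point. -/
theorem exists_nonneg_combination [FiniteDimensional ℝ V] [Fintype ι] {P : Set (Dual ℝ V)}
    (hP : IsPolytope P) (hdim : dimP P = finrank ℝ V) {ξ : ι → V} (hξ : IsFacetNormals P ξ)
    {p : Dual ℝ V} {v : V} (hp : p ∈ faceAt P v) :
    ∃ c : ι → ℝ, (∀ i, 0 ≤ c i) ∧ (∀ i, p ∉ faceAt P (ξ i) → c i = 0) ∧ ∑ i, c i • ξ i = v := by
  classical
  have htop : vectorSpan ℝ P = ⊤ := Submodule.eq_top_of_finrank_eq (by
    rw [Subspace.dual_finrank_eq]; exact hdim)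
  obtain ⟨X, hfin, hne, rfl⟩ := hP
  have hpP : p ∈ convexHull ℝ X := hp.1
  set A : Finset (Dual ℝ V) := hfin.toFinset.image fun s => p - s with hA
  have hAmem : ∀ v, (∀ a ∈ A, 0 ≤ a v) ↔ p ∈ faceAt (convexHull ℝ X) v := fun v => by
    rw [mem_faceAt_convexHull_iff hpP]
    simp [hA]
  have hpointed : ∀ v, (∀ a ∈ A, a v = 0) → v = 0 := by
    intro v hv
    have hconst : ∀ s ∈ X, s v = p v := fun s hs => by
      have := hv (p - s) (by simp only [hA, Finset.mem_image]; exact ⟨s, by simpa using hs, rfl⟩)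
      simp at this
      linarith
    have hker : vectorSpan ℝ (convexHull ℝ X) ≤ LinearMap.ker (Dual.eval ℝ V v) := by
      rw [← direction_affineSpan, affineSpan_convexHull, direction_affineSpan, vectorSpan_le_iff]
      intro x hx y hy
      simp [hconst x hx, hconst y hy]
    rw [htop] at hker
    exact (Module.forall_dual_apply_eq_zero_iff ℝ v).1 fun f => by
      simpa using hker (Submodule.mem_top (x := f))
  refine mem_of_extreme_rays A hpointed (C := {v | ∃ c : ι → ℝ, (∀ i, 0 ≤ c i) ∧
    (∀ i, p ∉ faceAt (convexHull ℝ X) (ξ i) → c i = 0) ∧ ∑ i, c i • ξ i = v}) ?_ ?_ ?_ ?_ v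
    ((hAmem v).2 hp)
  · exact ⟨0, by simp, by simp, by simp⟩
  · rintro _ ⟨c, h1, h2, rfl⟩ _ ⟨d, h3, h4, rfl⟩
    exact ⟨c + d, fun i => add_nonneg (h1 i) (h3 i), fun i hi => by simp [h2 i hi, h4 i hi],
      by simp [add_smul, Finset.sum_add_distrib]⟩
  · rintro t ht _ ⟨c, h1, h2, rfl⟩
    exact ⟨t • c, fun i => mul_nonneg ht.le (h1 i), fun i hi => by simp [h2 i hi],
      by simp [Finset.smul_sum, smul_smul]⟩
  · -- an extreme ray is the normal of a facet
    intro r hr hker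
    have hpr := (hAmem r).1 hr
    set D := vectorSpan ℝ (faceAt (convexHull ℝ X) r) with hD
    have hr0 : r ≠ 0 := by
      rintro rfl
      have : activeKer A (0 : V) = ⊥ := (Submodule.eq_bot_iff _).2 fun u hu =>
        hpointed u fun a ha => mem_activeKer.1 hu a ha (map_zero a)
      rw [this, finrank_bot] at hker
      omega
    have h1 := Subspace.finrank_add_finrank_dualCoannihilator_eq D
    have h2 : finrank ℝ (Submodule.dualCoannihilator D) ≤ 1 := by
      rw [← hker]
      refine Submodule.finrank_mono fun u hu => mem_activeKer.2 fun a ha har => ?_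
      rw [Submodule.mem_dualCoannihilator] at hu
      refine hu a ?_
      obtain ⟨s, hs, rfl⟩ := Finset.mem_image.1 ha
      rw [LinearMap.sub_apply, sub_eq_zero] at har
      exact sub_mem_vectorSpan hpr ⟨subset_convexHull ℝ X (by simpa using hs),
        fun z hz => har ▸ hpr.2 z hz⟩
    have h3 : 0 < finrank ℝ (Submodule.dualCoannihilator D) := by
      refine Module.finrank_pos_iff_exists_ne_zero.2
        ⟨⟨r, ?_⟩, fun h => hr0 (congrArg Subtype.val h)⟩
      exact (Submodule.mem_dualCoannihilator _).2 fun d hd => by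
        simpa using vectorSpan_faceAt_le_ker _ _ hd
    have hdimr : dimP (faceAt (convexHull ℝ X) r) + 1 = dimP (convexHull ℝ X) := by
      rw [hdim, ← h1]
      change finrank ℝ D + 1 = _
      omega
    obtain ⟨i, -, hi⟩ := hξ.surjOn (⟨⟨⟨p, hpr⟩, r, rfl⟩, hdimr⟩ :
      IsFacet (convexHull ℝ X) (faceAt (convexHull ℝ X) r))
    dsimp only at hi
    obtain ⟨c, hc, hcr⟩ := exists_pos_mul_of_faceAt_eq (hi ▸ ⟨p, hpr⟩) (hi ▸ hdimr) hi
    refine ⟨Pi.single i c, fun j => ?_, fun j hj => ?_, ?_⟩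
    · by_cases hij : j = i
      · subst hij
        simpa using hc.le
      · simp [hij]
    · rw [Pi.single_eq_of_ne]
      rintro rfl
      exact hj (hi ▸ hpr)
    · rw [Finset.sum_eq_single i (fun j _ hj => by simp [hj]) (by simp), Pi.single_eq_same]
      refine sub_eq_zero.1 ((Module.forall_dual_apply_eq_zero_iff ℝ _).1 fun f => ?_)
      have := hcr f (htop ▸ Submodule.mem_top)
      simp [this]

/-- The coordinate functions of a basis which is a subfamily of `ξ`, extended by zero. -/
theorem exists_coordinates [DecidableEq ι] [Fintype ι] {ξ : ι → V} {I : Finset ι}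
    (hspan : ⊤ ≤ Submodule.span ℝ (Set.range fun i : I => ξ i))
    (hcard : I.card = finrank ℝ V) :
    ∃ x : ι → Dual ℝ V, (∀ i, i ∉ I → x i = 0) ∧
      (∀ i j, i ∈ I → j ∈ I → x i (ξ j) = if i = j then 1 else 0) ∧
      ∀ v, ∑ i, x i v • ξ i = v := by
  let b := basisOfTopLeSpanOfCardEqFinrank (fun i : I => ξ i) hspan (by simpa using hcard)
  have hb : ∀ i : I, b i = ξ i := fun i => by simp [b]
  refine ⟨fun i => if hi : i ∈ I then b.coord ⟨i, hi⟩ else 0, fun i hi => dif_neg hi,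
    fun i j hi hj => ?_, fun v => ?_⟩
  · have : ξ j = b ⟨j, hj⟩ := (hb ⟨j, hj⟩).symm
    dsimp only
    rw [dif_pos hi, this, Basis.coord_apply, b.repr_self, Finsupp.single_apply]
    simp [eq_comm]
  · rw [← Finset.sum_subset (Finset.subset_univ I) (fun i _ hi => by simp [hi]),
      ← Finset.sum_coe_sort I]
    conv_rhs => rw [← b.sum_repr v]
    exact Finset.sum_congr rfl fun i _ => by simp [hb]

/-- The normal fan of a simple polytope, with the support function. The maximal cones are indexed by
the vertices. -/
theorem IsSimplePolytope.exists_simpleFan [FiniteDimensional ℝ V] [Fintype ι] [DecidableEq ι]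
    {P : Set (Dual ℝ V)} (hP : IsSimplePolytope P) {ξ : ι → V} (hξ : IsFacetNormals P ξ) :
    ∃ S : SimpleFan ξ {p // IsFace P {p}}, (S.h = fun i => supportFn P (ξ i)) ∧
      (∀ p, S.pt S.h p = p.1) ∧ ∀ p v, v ∈ S.cone p ↔ p.1 ∈ faceAt P v := by
  classical
  have hpoly := hP.isPolytope
  let I : {p // IsFace P {p}} → Finset ι := fun p =>
    Finset.univ.filter fun i => p.1 ∈ faceAt P (ξ i)
  have hI : ∀ {p i}, i ∈ I p ↔ p.1 ∈ faceAt P (ξ i) := by simp [I]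
  have hcard : ∀ p, (I p).card = finrank ℝ V := by
    intro p
    have h1 := hP.simple p.1 p.2
    have h2 : Set.BijOn (fun i => faceAt P (ξ i)) (I p : Set ι) {F | IsFacet P F ∧ p.1 ∈ F} := by
      refine ⟨fun i hi => ⟨hξ.mapsTo (Set.mem_univ i), hI.1 hi⟩,
        hξ.injOn.mono (Set.subset_univ _), fun F hF => ?_⟩
      obtain ⟨i, -, rfl⟩ := hξ.surjOn hF.1
      exact ⟨i, hI.2 hF.2, rfl⟩
    rw [← h2.image_eq, h2.injOn.encard_image, Set.encard_coe_eq_coe_finsetCard] at h1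
    exact_mod_cast h1
  have hcomb : ∀ (p : {p // IsFace P {p}}) v, p.1 ∈ faceAt P v →
      ∃ c : ι → ℝ, (∀ i, 0 ≤ c i) ∧ (∀ i, i ∉ I p → c i = 0) ∧ ∑ i, c i • ξ i = v := by
    intro p v hv
    obtain ⟨c, h1, h2, h3⟩ := exists_nonneg_combination hpoly hP.full_dim hξ hv
    exact ⟨c, h1, fun i hi => h2 i (by rwa [← hI]), h3⟩
  have hspan : ∀ p, ⊤ ≤ Submodule.span ℝ (Set.range fun i : I p => ξ i) := by
    rintro p u -
    have hmem : ∀ v, p.1 ∈ faceAt P v → v ∈ Submodule.span ℝ (Set.range fun i : I p => ξ i) := by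
      intro v hv
      obtain ⟨c, -, h2, rfl⟩ := hcomb p v hv
      refine Submodule.sum_mem _ fun i _ => ?_
      by_cases hi : i ∈ I p
      · exact Submodule.smul_mem _ _ (Submodule.subset_span ⟨⟨i, hi⟩, rfl⟩)
      · rw [h2 i hi, zero_smul]
        exact Submodule.zero_mem _
    obtain ⟨-, v, hv⟩ := p.2
    have hpv : p.1 ∈ faceAt P v := hv ▸ Set.mem_singleton _
    obtain ⟨X, hfin, -, rfl⟩ := hpoly
    obtain ⟨ε, h1, hε⟩ := ((eventually_lt_of_lex (v := v) (u := u) (p := p.1) hfin (by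
      intro s hs hsp
      refine Or.inl (lt_of_not_ge fun hle => hsp ?_)
      have : s ∈ faceAt (convexHull ℝ X) v :=
        ⟨subset_convexHull ℝ X hs, fun z hz => (hpv.2 z hz).trans hle⟩
      rwa [← hv] at this)).and self_mem_nhdsWithin).exists
    have hε' : (0 : ℝ) < ε := hε
    have h2 : p.1 ∈ faceAt (convexHull ℝ X) (v + ε • u) :=
      (mem_faceAt_convexHull_iff hpv.1).2 fun s hs => by
        by_cases hsp : s = p.1
        · rw [hsp]
        · exact (h1 s hs hsp).le
    have h3 := Submodule.smul_mem _ ε⁻¹ (Submodule.sub_mem _ (hmem _ h2) (hmem _ hpv))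
    simpa [smul_smul, hε'.ne'] using h3
  choose x hx1 hx2 hx3 using fun p => exists_coordinates (hspan p) (hcard p)
  have hval : ∀ {p : {p // IsFace P {p}}} {i}, i ∈ I p → supportFn P (ξ i) = p.1 (ξ i) :=
    fun hi => supportFn_eq (hI.1 hi)
  have happ : ∀ p (y : Dual ℝ V) v, y v = ∑ i, x p i v * y (ξ i) := fun p y v => by
    conv_lhs => rw [← hx3 p v]
    simp
  have hpt : ∀ p, ∑ j, supportFn P (ξ j) • x p j = p.1 := by
    intro p
    ext v
    rw [happ p p.1 v, LinearMap.sum_apply]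
    refine Finset.sum_congr rfl fun i _ => ?_
    by_cases hi : i ∈ I p
    · simp [hval hi, mul_comm]
    · simp [hx1 p i hi]
  have hcone : ∀ p v, (∀ i, 0 ≤ x p i v) ↔ p.1 ∈ faceAt P v := by
    intro p v
    constructor
    · intro h
      obtain ⟨-, u, hu⟩ := p.2
      have hpP : p.1 ∈ P := (hu ▸ Set.mem_singleton _ : p.1 ∈ faceAt P u).1
      refine ⟨hpP, fun z hz => ?_⟩
      rw [happ p z, happ p p.1]
      refine Finset.sum_le_sum fun i _ => ?_
      by_cases hi : i ∈ I p
      · exact mul_le_mul_of_nonneg_left ((hI.1 hi).2 z hz) (h i)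
      · simp [hx1 p i hi]
    · intro h i
      obtain ⟨c, h1, h2, rfl⟩ := hcomb p v h
      by_cases hi : i ∈ I p
      · rw [map_sum, Finset.sum_eq_single i]
        · simpa [hx2 p i i hi hi] using h1 i
        · intro j _ hji
          by_cases hj : j ∈ I p
          · simp [hx2 p i j hi hj, Ne.symm hji]
          · simp [h2 j hj]
        · simp
      · simp [hx1 p i hi]
  refine ⟨{ idx := I
            idx_injective := ?_
            card_idx := hcard
            x := x
            x_of_notMem := fun {p i} hi => hx1 p i hi
            x_apply := fun {p i j} hi hj => hx2 p i j hi hj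
            sum_x := hx3
            complete := ?_
            exists_mem_idx := ?_
            h := fun i => supportFn P (ξ i)
            h_lt := ?_ }, rfl, hpt, hcone⟩
  · intro p q hpq
    refine Subtype.ext (LinearMap.ext fun v => ?_)
    rw [happ p p.1, happ p q.1]
    refine Finset.sum_congr rfl fun i _ => ?_
    by_cases hi : i ∈ I p
    · rw [← hval hi, ← hval (show i ∈ I q from hpq ▸ hi)]
    · simp [hx1 p i hi]
  · intro v
    obtain ⟨p, hp, hpv⟩ := hpoly.exists_vertex_mem_faceAt v
    exact ⟨⟨p, hpv⟩, (hcone _ _).2 hp⟩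
  · intro i
    obtain ⟨p, hp, hpv⟩ := hpoly.exists_vertex_mem_faceAt (ξ i)
    exact ⟨⟨p, hpv⟩, hI.2 hp⟩
  · intro p i hi
    rw [hpt]
    obtain ⟨-, u, hu⟩ := p.2
    have hpP : p.1 ∈ P := (hu ▸ Set.mem_singleton _ : p.1 ∈ faceAt P u).1
    refine lt_of_le_of_ne (hpoly.le_supportFn hpP _) fun h => hi (hI.2 ?_)
    exact hpoly.mem_faceAt_iff.2 ⟨hpP, h⟩

end NormalFan

end PolytopeAlgebra

namespace PolytopeAlgebra

/-! ### The volume as a sum over the vertices -/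

section Volume

open Filter Topology MeasureTheory

/-- The open simplex cut off from the positive orthant by `∑ a, z a < r`. -/
def openSimplex (n : ℕ) (r : ℝ) : Set (Fin n → ℝ) := {z | (∀ a, 0 < z a) ∧ ∑ a, z a < r}

theorem isOpen_openSimplex (n : ℕ) (r : ℝ) : IsOpen (openSimplex n r) := by
  refine IsOpen.inter (s := {z : Fin n → ℝ | ∀ a, 0 < z a}) ?_
    (isOpen_lt (continuous_finsetSum _ fun a _ => continuous_apply a) continuous_const)
  simp only [Set.ofPred_forall]
  exact isOpen_iInter_of_finite fun a => isOpen_lt continuous_const (continuous_apply a)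

theorem volume_openSimplex (n : ℕ) : ∀ r : ℝ, 0 < r →
    volume (openSimplex n r) = ENNReal.ofReal (r ^ n / n.factorial) := by
  induction n with
  | zero =>
    intro r hr
    have : openSimplex 0 r = Set.univ := by
      ext z
      simp [openSimplex, hr]
    rw [this]
    simp [volume_pi]
  | succ n ih =>
    intro r hr
    let e := MeasurableEquiv.piFinSuccAbove (fun _ : Fin (n + 1) => ℝ) 0
    let T : Set (ℝ × (Fin n → ℝ)) := {t | 0 < t.1 ∧ t.2 ∈ openSimplex n (r - t.1)}
    have hT : IsOpen T := by
      have : T = ({t : ℝ × (Fin n → ℝ) | 0 < t.1} ∩ ⋂ a, {t : ℝ × (Fin n → ℝ) | 0 < t.2 a}) ∩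
          {t : ℝ × (Fin n → ℝ) | ∑ a, t.2 a < r - t.1} := by
        ext t
        simp [T, openSimplex, and_assoc]
      rw [this]
      exact ((isOpen_lt continuous_const continuous_fst).inter (isOpen_iInter_of_finite fun a =>
        isOpen_lt continuous_const (by fun_prop))).inter (isOpen_lt (by fun_prop) (by fun_prop))
    have hpre : openSimplex (n + 1) r = e ⁻¹' T := by
      ext z
      simp only [openSimplex, Fin.forall_fin_succ, Fin.sum_univ_succ, Set.mem_preimage,
        Set.mem_ofPred_eq, T, e, MeasurableEquiv.piFinSuccAbove_apply,
        Fin.insertNthEquiv_symm_apply, Fin.removeNth_zero, Fin.tail, lt_sub_iff_add_lt']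
      tauto
    have hslice : ∀ t : ℝ, volume (Prod.mk t ⁻¹' T) =
        (Set.Ioo 0 r).indicator (fun t => ENNReal.ofReal ((r - t) ^ n / n.factorial)) t := by
      intro t
      by_cases ht : t ∈ Set.Ioo 0 r
      · have : Prod.mk t ⁻¹' T = openSimplex n (r - t) := by
          ext z
          simp [T, ht.1]
        rw [Set.indicator_of_mem ht, this, ih _ (by linarith [ht.2])]
      · have : Prod.mk t ⁻¹' T = ∅ := by
          ext z
          simp only [T, openSimplex, Set.mem_preimage, Set.mem_ofPred_eq, Set.mem_empty_iff_false,
            iff_false]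
          rintro ⟨h1, h2, h3⟩
          have := Finset.sum_nonneg fun a (_ : a ∈ Finset.univ) => (h2 a).le
          exact ht ⟨h1, by linarith⟩
        rw [Set.indicator_of_notMem ht, this, measure_empty]
    rw [hpre,
      (volume_preserving_piFinSuccAbove (fun _ : Fin (n + 1) => ℝ) 0).measure_preimage_equiv,
      Measure.volume_eq_prod, Measure.prod_apply hT.measurableSet, lintegral_congr hslice,
      lintegral_indicator measurableSet_Ioo, ← ofReal_integral_eq_lintegral_ofReal]
    · rw [← integral_Ioc_eq_integral_Ioo, ← intervalIntegral.integral_of_le hr.le]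
      congr 1
      rw [intervalIntegral.integral_comp_sub_left (fun t => t ^ n / (n.factorial : ℝ)) r]
      rw [intervalIntegral.integral_div, integral_pow, Nat.factorial_succ]
      push_cast
      field_simp
      simp
    · have hcont : Continuous fun t : ℝ => (r - t) ^ n / (n.factorial : ℝ) := by fun_prop
      exact (hcont.integrableOn_Icc (a := 0) (b := r)).mono_set Set.Ioo_subset_Icc_self
    · refine (ae_restrict_iff' measurableSet_Ioo).2 (Eventually.of_forall fun t ht => ?_)
      have : 0 ≤ r - t := by linarith [ht.2]
      dsimp
      positivity

variable {V : Type*} [AddCommGroup V] [Module ℝ V]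

/-- The coordinates on `W = V*` in which `vol` is defined. -/
noncomputable def dualCoord (V : Type*) [AddCommGroup V] [Module ℝ V] [FiniteDimensional ℝ V] :
    Dual ℝ V ≃ₗ[ℝ] (Fin (finrank ℝ V) → ℝ) := (finBasis ℝ V).dualBasis.equivFun

theorem dualCoord_apply [FiniteDimensional ℝ V] (w : Dual ℝ V) (i : Fin (finrank ℝ V)) :
    dualCoord V w i = w (finBasis ℝ V i) := by
  simp [dualCoord]

theorem vol_eq [FiniteDimensional ℝ V] (Ω : V [⋀^Fin (finrank ℝ V)]→ₗ[ℝ] ℝ) (Q : Set (Dual ℝ V)) :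
    vol Ω Q = volume.real (dualCoord V '' Q) / |Ω (finBasis ℝ V)| := by
  rw [vol, Measure.real]
  congr 4
  ext w i
  rw [dualCoord_apply]

theorem measure_hyperplane {n : ℕ} (f : (Fin n → ℝ) →ₗ[ℝ] ℝ) (hf : f ≠ 0) (c : ℝ) :
    volume {z | f z = c} = 0 := by
  by_cases h : ∃ z₀, f z₀ = c
  · obtain ⟨z₀, rfl⟩ := h
    have : {z | f z = f z₀} = (AffineSubspace.mk' z₀ (LinearMap.ker f) : Set (Fin n → ℝ)) := by
      ext z
      simp [AffineSubspace.mem_mk', sub_eq_zero]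
    rw [this]
    refine Measure.addHaar_affineSubspace _ _ fun htop => hf ?_
    have h2 : LinearMap.ker f = ⊤ := by
      rw [← AffineSubspace.direction_mk' z₀ (LinearMap.ker f), htop, AffineSubspace.direction_top]
    exact LinearMap.ker_eq_top.1 h2
  · have : {z | f z = c} = ∅ := by
      ext z
      simpa using fun hz => h ⟨z, hz⟩
    rw [this, measure_empty]

namespace SimpleFan

variable {ι : Type*} [Fintype ι] [DecidableEq ι] {ξ : ι → V} {κ : Type*} (S : SimpleFan ξ κ)

/-- An enumeration of the generators of a maximal cone. -/
noncomputable def enum (p : κ) : Fin (finrank ℝ V) ≃ S.idx p :=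
  ((S.idx p).equivFinOfCardEq (S.card_idx p)).symm

theorem prod_enum (p : κ) (f : ι → ℝ) : ∏ a, f (S.enum p a) = ∏ i ∈ S.idx p, f i := by
  rw [← Finset.prod_coe_sort (S.idx p)]
  exact (S.enum p).prod_comp (fun i => f i)

theorem sum_enum (p : κ) (f : ι → ℝ) : ∑ a, f (S.enum p a) = ∑ i ∈ S.idx p, f i := by
  rw [← Finset.sum_coe_sort (S.idx p)]
  exact (S.enum p).sum_comp (fun i => f i)

/-- The sign with which the cone at the vertex `p` contributes. -/
noncomputable def sgn (p : κ) (v : V) : ℝ := ∏ i ∈ S.idx p, if 0 < S.x p i v then 1 else -1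

theorem sgn_mul_sgn (p : κ) (v : V) : S.sgn p v * S.sgn p v = 1 := by
  rw [sgn, ← Finset.prod_mul_distrib]
  refine Finset.prod_eq_one fun i _ => ?_
  split_ifs <;> simp

/-- The volume with respect to `Ω` of the parallelepiped spanned by the generators of a maximal
cone. -/
noncomputable def scale (Ω : V [⋀^Fin (finrank ℝ V)]→ₗ[ℝ] ℝ) (p : κ) : ℝ :=
  |Ω fun a => ξ (S.enum p a)|

/-- The normalized product of the facet equations of the cone of `p`. -/
noncomputable def den (Ω : V [⋀^Fin (finrank ℝ V)]→ₗ[ℝ] ℝ) (p : κ) (v : V) : ℝ :=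
  S.scale Ω p * ∏ i ∈ S.idx p, S.x p i v

theorem sgn_mul_abs_den (Ω : V [⋀^Fin (finrank ℝ V)]→ₗ[ℝ] ℝ) (p : κ) (v : V) :
    S.sgn p v * |S.den Ω p v| = S.den Ω p v := by
  rw [den, abs_mul, abs_of_nonneg (show 0 ≤ S.scale Ω p from abs_nonneg _), Finset.abs_prod,
    mul_left_comm, sgn, ← Finset.prod_mul_distrib]
  congr 1
  refine Finset.prod_congr rfl fun i _ => ?_
  split_ifs with h
  · rw [one_mul, abs_of_pos h]
  · rw [abs_of_nonpos (not_lt.1 h), neg_one_mul, neg_neg]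

variable [FiniteDimensional ℝ V]

/-- The linear part of the coordinates `x p i v * (k i - y (ξ i))` on `W = V*`. -/
noncomputable def chart (p : κ) (v : V) :
    (Fin (finrank ℝ V) → ℝ) →ₗ[ℝ] (Fin (finrank ℝ V) → ℝ) :=
  LinearMap.pi fun a => S.x p (S.enum p a) v •
    (Dual.eval ℝ V (ξ (S.enum p a)) ∘ₗ (dualCoord V).symm.toLinearMap)

theorem chart_apply (p : κ) (v : V) (z : Fin (finrank ℝ V) → ℝ) (a : Fin (finrank ℝ V)) :
    S.chart p v z a = S.x p (S.enum p a) v * (dualCoord V).symm z (ξ (S.enum p a)) := by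
  simp [chart]

theorem abs_det_chart (Ω : V [⋀^Fin (finrank ℝ V)]→ₗ[ℝ] ℝ) (p : κ) (v : V) :
    |LinearMap.det (S.chart p v)| * |Ω (finBasis ℝ V)| = |S.den Ω p v| := by
  set b := finBasis ℝ V
  have hmat : S.chart p v = Matrix.toLin' (Matrix.diagonal (fun a => S.x p (S.enum p a) v) *
      (b.toMatrix fun a => ξ (S.enum p a)).transpose) := by
    ext1 j
    ext a
    have h1 : (dualCoord V).symm (Pi.single j 1) = b.coord j := by
      rw [LinearEquiv.symm_apply_eq]
      ext i
      rw [dualCoord_apply, Basis.coord_apply, b.repr_self, Finsupp.single_apply, Pi.single_apply]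
    simp [chart_apply, h1, Matrix.mulVec_diagonal, Basis.toMatrix_apply, Matrix.row]
  have hΩ : (Ω fun a => ξ (S.enum p a)) = Ω b * b.det fun a => ξ (S.enum p a) := by
    conv_lhs => rw [Ω.eq_smul_basis_det b]
    simp
  rw [hmat, LinearMap.det_toLin', Matrix.det_mul, Matrix.det_diagonal, Matrix.det_transpose,
    ← Basis.det_apply, den, scale, hΩ, ← S.prod_enum p fun i => S.x p i v]
  simp only [abs_mul, abs_abs]
  ring

theorem scale_pos {Ω : V [⋀^Fin (finrank ℝ V)]→ₗ[ℝ] ℝ} (hΩ : Ω ≠ 0) (p : κ) :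
    0 < S.scale Ω p := by
  refine abs_pos.2 fun h => hΩ ?_
  have hli : LinearIndependent ℝ fun a => ξ (S.enum p a) := by
    rw [Fintype.linearIndependent_iff]
    intro g hg a
    have := congrArg (S.x p (S.enum p a)) hg
    simpa [S.x_xi, Subtype.coe_inj, (S.enum p).injective.eq_iff] using this
  let b := basisOfLinearIndependentOfCardEqFinrank' _ hli (by simp)
  have hb : (b : Fin (finrank ℝ V) → V) = fun a => ξ (S.enum p a) := by simp [b]
  rw [Ω.eq_smul_basis_det b, hb, h, zero_smul]

theorem den_ne_zero {Ω : V [⋀^Fin (finrank ℝ V)]→ₗ[ℝ] ℝ} (hΩ : Ω ≠ 0) {v : V}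
    (hv : S.Generic v) (p : κ) : S.den Ω p v ≠ 0 :=
  mul_ne_zero (S.scale_pos hΩ p).ne' (Finset.prod_ne_zero_iff.2 fun i hi => hv p i hi)

theorem apply_finBasis_ne_zero {Ω : V [⋀^Fin (finrank ℝ V)]→ₗ[ℝ] ℝ} (hΩ : Ω ≠ 0) :
    Ω (finBasis ℝ V) ≠ 0 := fun h => hΩ (by rw [Ω.eq_smul_basis_det (finBasis ℝ V), h, zero_smul])

/-- The simplex cut out of the cone at the vertex `p`, with the edges reversed so that they all
point downwards with respect to `v`. -/
def vertexSimplex (k : ι → ℝ) (v : V) (r : ℝ) (p : κ) : Set (Fin (finrank ℝ V) → ℝ) :=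
  {z | (fun a => S.x p (S.enum p a) v * k (S.enum p a)) - S.chart p v z ∈
    openSimplex (finrank ℝ V) r}

theorem measurableSet_vertexSimplex (k : ι → ℝ) (v : V) (r : ℝ) (p : κ) :
    MeasurableSet (S.vertexSimplex k v r p) :=
  ((isOpen_openSimplex _ r).preimage
    (continuous_const.sub (S.chart p v).continuous_of_finiteDimensional)).measurableSet

theorem volume_vertexSimplex {Ω : V [⋀^Fin (finrank ℝ V)]→ₗ[ℝ] ℝ} (hΩ : Ω ≠ 0) (k : ι → ℝ)
    {v : V} (hv : S.Generic v) {r : ℝ} (hr : 0 < r) (p : κ) :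
    volume (S.vertexSimplex k v r p) = ENNReal.ofReal
      (r ^ finrank ℝ V / (finrank ℝ V).factorial * |Ω (finBasis ℝ V)| / |S.den Ω p v|) := by
  have hdet := S.abs_det_chart Ω p v
  have hb := abs_pos.2 (apply_finBasis_ne_zero hΩ)
  have hden := abs_pos.2 (S.den_ne_zero hΩ hv p)
  have hne : LinearMap.det (S.chart p v) ≠ 0 := fun h => by
    rw [h, abs_zero, zero_mul] at hdet
    exact hden.ne hdet
  have h1 : S.vertexSimplex k v r p = S.chart p v ⁻¹'
      ((fun u => (fun a => S.x p (S.enum p a) v * k (S.enum p a)) - u) ⁻¹'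
        openSimplex (finrank ℝ V) r) := rfl
  have h2 := (Measure.measurePreserving_sub_left (volume : Measure (Fin (finrank ℝ V) → ℝ))
    (fun a => S.x p (S.enum p a) v * k (S.enum p a))).measure_preimage
      (isOpen_openSimplex (finrank ℝ V) r).measurableSet.nullMeasurableSet
  rw [h1, Measure.addHaar_preimage_linearMap _ hne, h2,
    volume_openSimplex _ r hr, ← ENNReal.ofReal_mul (abs_nonneg _)]
  congr 1
  rw [← hdet, abs_inv]
  have := abs_pos.2 hne
  field_simp

/-- The indicator function of a polytope as an alternating sum of indicator functions of cones,
one at each vertex. -/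
theorem sum_sgn_eq_indicator [Fintype κ] {Q : Set (Dual ℝ V)} (hQ : IsPolytope Q) {k : ι → ℝ}
    (hpt : ∀ p, S.pt k p ∈ Q) (hle : ∀ y ∈ Q, ∀ i, y (ξ i) ≤ k i) {v : V} (hv : S.Generic v)
    {y : Dual ℝ V} (hy : ∀ p, ∀ i ∈ S.idx p, y (ξ i) ≠ k i) :
    ∑ p, S.sgn p v * (if ∀ i ∈ S.idx p, 0 < S.x p i v * (k i - y (ξ i)) then 1 else 0) =
      open Classical in if y ∈ Q then 1 else 0 := by
  classical
  set B := Finset.univ.filter fun i => k i < y (ξ i)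
  have hB : ∀ i, i ∈ B ↔ k i < y (ξ i) := by simp [B]
  have hterm : ∀ u, S.Generic u → ∀ p,
      S.sgn p u * (if ∀ i ∈ S.idx p, 0 < S.x p i u * (k i - y (ξ i)) then 1 else 0) =
      ∏ i ∈ S.idx p, ((if 0 < S.x p i u then (1 : ℝ) else 0) - (if i ∈ B then 1 else 0)) := by
    intro u hu p
    have hprod : (if ∀ i ∈ S.idx p, 0 < S.x p i u * (k i - y (ξ i)) then (1 : ℝ) else 0) =
        ∏ i ∈ S.idx p, if 0 < S.x p i u * (k i - y (ξ i)) then 1 else 0 := by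
      rw [Finset.prod_ite_zero, Finset.prod_const_one]
      congr
    rw [sgn, hprod, ← Finset.prod_mul_distrib]
    refine Finset.prod_congr rfl fun i hi => ?_
    rcases lt_or_gt_of_ne (hu p i hi) with h1 | h1 <;>
      rcases lt_or_gt_of_ne (hy p i hi) with h2 | h2
    · rw [if_neg h1.not_gt, if_neg (by nlinarith), if_neg h1.not_gt,
        if_neg (by rw [hB]; exact h2.not_gt)]
      simp
    · rw [if_neg h1.not_gt, if_pos (by nlinarith), if_neg h1.not_gt,
        if_pos (by rw [hB]; exact h2)]
      simp
    · rw [if_pos h1, if_pos (by nlinarith), if_pos h1, if_neg (by rw [hB]; exact h2.not_gt)]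
      simp
    · rw [if_pos h1, if_neg (by nlinarith), if_pos h1, if_pos (by rw [hB]; exact h2)]
      simp
  rw [Finset.sum_congr rfl fun p _ => hterm v hv p, S.sum_prod_sub B hv]
  by_cases hyQ : y ∈ Q
  · have hB0 : B = ∅ := Finset.eq_empty_of_forall_notMem fun i hi =>
      ((hB i).1 hi).not_ge (hle y hyQ i)
    obtain ⟨p, -⟩ := S.complete 0
    rw [if_pos hyQ, hB0]
    simp [show ∃ _ : κ, True from ⟨p, trivial⟩]
  · -- a generic vector separating `y` from `Q` lies in none of the reversed cones
    rw [if_neg hyQ]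
    obtain ⟨v₁, hv₁⟩ := hQ.exists_separating hyQ
    obtain ⟨u, hu⟩ := S.exists_generic
    have hsep : ∀ᶠ ε in 𝓝[>] (0 : ℝ), ∀ p, 0 < (y v₁ - S.pt k p v₁) + ε * (y u - S.pt k p u) := by
      rw [eventually_all]
      exact fun p => eventually_add_mul_pos (sub_pos.2 (hv₁ _ (hpt p))) _
    obtain ⟨ε, h1, h2⟩ := ((S.eventually_generic v₁ hu).and hsep).exists
    rw [← S.sum_prod_sub B h1, ← Finset.sum_congr rfl fun p _ => hterm _ h1 p]
    refine Finset.sum_eq_zero fun p _ => ?_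
    rw [if_neg, mul_zero]
    intro h
    have h3 : 0 ≤ S.pt k p (v₁ + ε • u) - y (v₁ + ε • u) := by
      rw [S.pt_sub_apply]
      refine Finset.sum_nonneg fun i _ => ?_
      by_cases hi : i ∈ S.idx p
      · exact (h i hi).le
      · simp [S.x_of_notMem hi]
    have := h2 p
    simp only [map_add, map_smul, smul_eq_mul] at h3
    linarith

/-- The volume of a polytope as a sum over its vertices: the half space `-t < y v` contains the
polytope and truncates the cones at the vertices, with edges reversed, to simplices. -/
theorem sum_pow_div_den_of_large [Fintype κ] {Ω : V [⋀^Fin (finrank ℝ V)]→ₗ[ℝ] ℝ} (hΩ : Ω ≠ 0)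
    {Q : Set (Dual ℝ V)} (hQ : IsPolytope Q) {k : ι → ℝ}
    (hpt : ∀ p, S.pt k p ∈ Q) (hle : ∀ y ∈ Q, ∀ i, y (ξ i) ≤ k i) {v : V} (hv : S.Generic v)
    {t : ℝ} (ht : ∀ y ∈ Q, -t < y v) :
    ∑ p, (S.pt k p v + t) ^ finrank ℝ V / S.den Ω p v = (finrank ℝ V).factorial * vol Ω Q := by
  classical
  have hb := abs_pos.2 (apply_finBasis_ne_zero hΩ)
  have hr : ∀ p, 0 < S.pt k p v + t := fun p => by linarith [ht _ (hpt p)]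
  set T := dualCoord V with hT
  have hcomp : IsCompact (T '' Q) := by
    obtain ⟨X, hfin, -, rfl⟩ := hQ
    have himg : T '' convexHull ℝ X = convexHull ℝ (T '' X) :=
      LinearMap.image_convexHull T.toLinearMap X
    rw [himg]
    exact (hfin.image T).isCompact_convexHull ℝ
  have hvolD : ∀ p, volume (S.vertexSimplex k v (S.pt k p v + t) p) ≠ ⊤ := fun p => by
    rw [S.volume_vertexSimplex hΩ k hv (hr p)]
    exact ENNReal.ofReal_ne_top
  have hgen : ∀ᵐ z : Fin (finrank ℝ V) → ℝ, ∀ p, ∀ i ∈ S.idx p, T.symm z (ξ i) ≠ k i := by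
    rw [ae_all_iff]
    intro p
    rw [eventually_all_finset]
    intro i hi
    have hf : Dual.eval ℝ V (ξ i) ∘ₗ T.symm.toLinearMap ≠ 0 := fun h => by
      have := LinearMap.congr_fun h (T (S.x p i))
      simp [S.x_xi hi] at this
    have := measure_hyperplane _ hf (k i)
    rw [ae_iff]
    simpa using this
  have hae : (fun z => ∑ p, S.sgn p v *
      (S.vertexSimplex k v (S.pt k p v + t) p).indicator (fun _ => (1 : ℝ)) z) =ᵐ[volume]
      (T '' Q).indicator fun _ => (1 : ℝ) := by
    filter_upwards [hgen] with z hz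
    obtain ⟨y, rfl⟩ := T.surjective z
    simp only [LinearEquiv.symm_apply_apply] at hz
    have hmem : ∀ p, T y ∈ S.vertexSimplex k v (S.pt k p v + t) p ↔
        (∀ i ∈ S.idx p, 0 < S.x p i v * (k i - y (ξ i))) ∧ -t < y v := by
      intro p
      have e1 : ∀ a, ((fun a => S.x p (S.enum p a) v * k (S.enum p a)) - S.chart p v (T y)) a =
          S.x p (S.enum p a) v * (k (S.enum p a) - y (ξ (S.enum p a))) := fun a => by
        rw [Pi.sub_apply, S.chart_apply, LinearEquiv.symm_apply_apply, mul_sub]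
      simp only [vertexSimplex, openSimplex, Set.mem_ofPred_eq, e1]
      rw [S.sum_enum p fun i => S.x p i v * (k i - y (ξ i)),
        Finset.sum_subset (Finset.subset_univ (S.idx p)) (fun i _ hi => by
          simp [S.x_of_notMem hi]), ← S.pt_sub_apply]
      refine and_congr ?_ ?_
      · rw [(S.enum p).forall_congr_left]
        simp
      · constructor <;> intro h <;> linarith
    have hind := S.sum_sgn_eq_indicator hQ hpt hle hv hz
    simp only [Set.indicator_apply, hmem]
    rw [(T.injective.mem_set_image : T y ∈ T '' Q ↔ y ∈ Q)]
    by_cases hyt : -t < y v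
    · simpa [hyt] using hind
    · have : y ∉ Q := fun h => hyt (ht y h)
      simp [hyt, this]
  have hint := integral_congr_ae hae
  rw [integral_finsetSum _ fun p _ => (((integrable_indicator_iff
    (S.measurableSet_vertexSimplex k v _ p)).2 (integrableOn_const (hvolD p))).const_mul _),
    integral_indicator_const _ hcomp.measurableSet, smul_eq_mul, mul_one] at hint
  rw [vol_eq, ← hint, Finset.sum_div, Finset.mul_sum]
  refine Finset.sum_congr rfl fun p _ => ?_
  have hden := S.den_ne_zero hΩ hv p
  rw [integral_const_mul, integral_indicator_const _ (S.measurableSet_vertexSimplex k v _ p),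
    smul_eq_mul, mul_one, Measure.real, S.volume_vertexSimplex hΩ k hv (hr p),
    ENNReal.toReal_ofReal (by have := hr p; positivity)]
  have hs := S.sgn_mul_abs_den Ω p v
  have hs2 := S.sgn_mul_sgn p v
  have habs := (abs_pos.2 hden).ne'
  have hfac : ((finrank ℝ V).factorial : ℝ) ≠ 0 := by positivity
  have : 1 / S.den Ω p v = S.sgn p v / |S.den Ω p v| := by
    rw [div_eq_div_iff hden habs, one_mul]
    conv_rhs => rw [← hs]
    rw [← mul_assoc, hs2, one_mul]
  rw [div_eq_mul_one_div, this]
  field_simp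

/-- The weighted power sums of the values of a generic `v` at the vertices of a polytope: below
the dimension they vanish, and in the dimension they give the volume. -/
theorem sum_pow_div_den [Fintype κ] {Ω : V [⋀^Fin (finrank ℝ V)]→ₗ[ℝ] ℝ} (hΩ : Ω ≠ 0)
    {Q : Set (Dual ℝ V)} (hQ : IsPolytope Q) {k : ι → ℝ}
    (hpt : ∀ p, S.pt k p ∈ Q) (hle : ∀ y ∈ Q, ∀ i, y (ξ i) ≤ k i) {v : V} (hv : S.Generic v)
    {j : ℕ} (hj : j ≤ finrank ℝ V) :
    ∑ p, S.pt k p v ^ j / S.den Ω p v =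
      if j = finrank ℝ V then (finrank ℝ V).factorial * vol Ω Q else 0 := by
  -- the formula for large `t` is an identity of polynomials in `t`: compare coefficients
  let G : Polynomial ℝ := ∑ p, Polynomial.C (S.den Ω p v)⁻¹ *
    (Polynomial.X + Polynomial.C (S.pt k p v)) ^ finrank ℝ V -
      Polynomial.C ((finrank ℝ V).factorial * vol Ω Q)
  have hG : G = 0 := by
    refine Polynomial.eq_zero_of_infinite_isRoot _ (Set.Infinite.mono ?_
      (Set.Ioi_infinite (supportFn Q (-v))))
    intro t ht
    have h1 : ∀ y ∈ Q, -t < y v := fun y hy => by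
      have := hQ.le_supportFn hy (-v)
      rw [map_neg] at this
      linarith [Set.mem_Ioi.1 ht]
    have := S.sum_pow_div_den_of_large hΩ hQ hpt hle hv h1
    simp only [G, Set.mem_ofPred_eq, Polynomial.IsRoot.def, Polynomial.eval_sub,
      Polynomial.eval_finsetSum, Polynomial.eval_mul, Polynomial.eval_C, Polynomial.eval_pow,
      Polynomial.eval_add, Polynomial.eval_X]
    rw [← this, sub_eq_zero]
    exact Finset.sum_congr rfl fun p _ => by rw [add_comm t]; ring
  have hcoef := congrArg (fun g => Polynomial.coeff g (finrank ℝ V - j)) hG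
  simp only [G, Polynomial.coeff_sub, Polynomial.finsetSum_coeff, Polynomial.coeff_C_mul,
    Polynomial.coeff_X_add_C_pow, Polynomial.coeff_zero, Polynomial.coeff_C,
    Nat.sub_sub_self hj] at hcoef
  have hch : ((finrank ℝ V).choose (finrank ℝ V - j) : ℝ) ≠ 0 :=
    Nat.cast_ne_zero.2 (Nat.choose_pos (Nat.sub_le _ j)).ne'
  have h2 : ∑ p, (S.den Ω p v)⁻¹ * (S.pt k p v ^ j * ((finrank ℝ V).choose (finrank ℝ V - j) : ℝ)) =
      (∑ p, S.pt k p v ^ j / S.den Ω p v) * ((finrank ℝ V).choose (finrank ℝ V - j) : ℝ) := by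
    rw [Finset.sum_mul]
    exact Finset.sum_congr rfl fun p _ => by ring
  rw [h2] at hcoef
  by_cases hjn : j = finrank ℝ V
  · subst hjn
    rw [if_pos rfl]
    simp at hcoef
    linarith
  · have : finrank ℝ V - j ≠ 0 := by omega
    rw [if_neg this, sub_zero] at hcoef
    rw [if_neg hjn]
    exact (mul_eq_zero.1 hcoef).resolve_right hch

end SimpleFan

end Volume

end PolytopeAlgebra

namespace PolytopeAlgebra

/-! ### Polynomial functions on a vector space -/

section PolyFns

open Filter Topology

variable {V : Type*} [AddCommGroup V] [Module ℝ V]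

theorem dual_mem_linForms (w : Dual ℝ V) : (fun v => w v) ∈ linForms V := ⟨w, rfl⟩

theorem dual_mem_polyFns (w : Dual ℝ V) : (fun v => w v) ∈ polyFns V :=
  Algebra.subset_adjoin (dual_mem_linForms w)

theorem linForms_pow_le (k : ℕ) : linForms V ^ k ≤ Subalgebra.toSubmodule (polyFns V) := by
  induction k with
  | zero =>
    rw [pow_zero, Submodule.one_le]
    exact one_mem (polyFns V)
  | succ k ih =>
    rw [pow_succ, Submodule.mul_le]
    exact fun f hf g hg => (polyFns V).mul_mem (ih hf) (Algebra.subset_adjoin hg)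

theorem linForms_pow_smul {k : ℕ} {g : V → ℝ} (hg : g ∈ linForms V ^ k) (t : ℝ) (v : V) :
    g (t • v) = t ^ k * g v := by
  induction hg using Submodule.pow_induction_on_left' with
  | algebraMap r => simp
  | add f g i _ _ h1 h2 => simp [h1, h2, mul_add]
  | mem_mul m hm i f _ ih =>
    obtain ⟨w, rfl⟩ := hm
    simp only [Pi.mul_apply, ih, map_smul, smul_eq_mul, Nat.succ_eq_add_one]
    ring

theorem polyFns_comp {g : V → ℝ} (hg : g ∈ polyFns V) (f : V →ₗ[ℝ] V) :
    (fun v => g (f v)) ∈ polyFns V := by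
  induction hg using Algebra.adjoin_induction with
  | mem g hg =>
    obtain ⟨w, rfl⟩ := hg
    exact dual_mem_polyFns (w ∘ₗ f)
  | algebraMap r => exact Subalgebra.algebraMap_mem _ r
  | add g h _ _ h1 h2 => exact add_mem h1 h2
  | mul g h _ _ h1 h2 => exact mul_mem h1 h2

/-- A polynomial function is polynomial along every line. -/
theorem exists_polynomial_line {g : V → ℝ} (hg : g ∈ polyFns V) (u v : V) :
    ∃ f : Polynomial ℝ, ∀ t : ℝ, g (u + t • v) = f.eval t := by
  induction hg using Algebra.adjoin_induction with
  | mem g hg =>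
    obtain ⟨w, rfl⟩ := hg
    exact ⟨Polynomial.C (w u) + Polynomial.C (w v) * Polynomial.X, fun t => by simp; ring⟩
  | algebraMap r => exact ⟨Polynomial.C r, fun t => by simp⟩
  | add g h _ _ h1 h2 =>
    obtain ⟨f1, h1⟩ := h1
    obtain ⟨f2, h2⟩ := h2
    exact ⟨f1 + f2, fun t => by simp [h1, h2]⟩
  | mul g h _ _ h1 h2 =>
    obtain ⟨f1, h1⟩ := h1
    obtain ⟨f2, h2⟩ := h2
    exact ⟨f1 * f2, fun t => by simp [h1, h2]⟩

theorem tendsto_line {g : V → ℝ} (hg : g ∈ polyFns V) (u v : V) :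
    Tendsto (fun t : ℝ => g (u + t • v)) (𝓝[>] 0) (𝓝 (g u)) := by
  obtain ⟨f, hf⟩ := exists_polynomial_line hg u v
  have h0 : g u = f.eval 0 := by simpa using hf 0
  simp only [hf, h0]
  exact (f.continuous.tendsto 0).mono_left nhdsWithin_le_nhds

theorem eq_zero_of_eventually_line {g : V → ℝ} (hg : g ∈ polyFns V) {u : V}
    (h : ∀ v, ∀ᶠ t in 𝓝[>] (0 : ℝ), g (u + t • v) = 0) : g = 0 := by
  funext w
  obtain ⟨f, hf⟩ := exists_polynomial_line hg u (w - u)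
  obtain ⟨ε, hε, hsub⟩ := mem_nhdsGT_iff_exists_Ioo_subset.1 (h (w - u))
  have hf0 : f = 0 := by
    refine Polynomial.eq_zero_of_infinite_isRoot f ((Set.Ioo_infinite hε).mono fun t ht => ?_)
    have : g (u + t • (w - u)) = 0 := hsub ht
    rwa [hf] at this
  have := hf 1
  simpa [hf0] using this

/-- A polynomial function changes by a multiple of `x` under the translation `v ↦ v - x v • e`. -/
theorem exists_eq_add_mul {g : V → ℝ} (hg : g ∈ polyFns V) (x : Dual ℝ V) (e : V) :
    ∃ a ∈ polyFns V, ∀ v, g v = g (v - x v • e) + x v * a v := by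
  induction hg using Algebra.adjoin_induction with
  | mem g hg =>
    obtain ⟨w, rfl⟩ := hg
    exact ⟨fun _ => w e, Subalgebra.algebraMap_mem _ (w e), fun v => by simp⟩
  | algebraMap r => exact ⟨0, zero_mem _, fun v => by simp⟩
  | add g h _ _ h1 h2 =>
    obtain ⟨a, ha, h1⟩ := h1
    obtain ⟨b, hb, h2⟩ := h2
    refine ⟨a + b, add_mem ha hb, fun v => ?_⟩
    simp only [Pi.add_apply]
    rw [h1 v, h2 v]
    ring
  | mul g h _ hh h1 h2 =>
    obtain ⟨a, ha, h1⟩ := h1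
    obtain ⟨b, hb, h2⟩ := h2
    refine ⟨a * h + (fun v => g v - x v * a v) * b, add_mem (mul_mem ha hh) (mul_mem
      (sub_mem ‹g ∈ _› (mul_mem (dual_mem_polyFns x) ha)) hb), fun v => ?_⟩
    simp only [Pi.add_apply, Pi.mul_apply]
    have e1 := h1 v
    have e2 := h2 v
    have e3 : g (v - x v • e) = g v - x v * a v := by linarith
    rw [e3]
    have e4 : h (v - x v • e) = h v - x v * b v := by linarith
    rw [e4]
    ring

end PolyFns

namespace SimpleFan

open Filter Topology

variable {V : Type*} [AddCommGroup V] [Module ℝ V] {ι : Type*} [Fintype ι] [DecidableEq ι]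
  {ξ : ι → V} {κ : Type*} (S : SimpleFan ξ κ)

theorem eventually_vec_mem_cone (p : κ) (v : V) :
    ∀ᶠ t in 𝓝[>] (0 : ℝ), S.vec (S.idx p) + t • v ∈ S.cone p := by
  have : ∀ᶠ t in 𝓝[>] (0 : ℝ), ∀ i, 0 ≤ S.x p i (S.vec (S.idx p) + t • v) := by
    rw [eventually_all]
    intro i
    by_cases hi : i ∈ S.idx p
    · filter_upwards [eventually_add_mul_pos one_pos (S.x p i v)] with t ht
      simpa [S.x_vec subset_rfl, hi] using ht.le
    · simp [S.x_of_notMem hi]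
  exact this

/-- A polynomial function is determined by its values on a maximal cone. -/
theorem eq_zero_of_cone {p : κ} {g : V → ℝ} (hg : g ∈ polyFns V) (h : ∀ v ∈ S.cone p, g v = 0) :
    g = 0 :=
  eq_zero_of_eventually_line hg (u := S.vec (S.idx p)) fun v =>
    (S.eventually_vec_mem_cone p v).mono fun _ ht => h _ ht

/-- A polynomial function is determined by its values at the generic vectors. -/
theorem eq_zero_of_generic [Finite κ] {g : V → ℝ} (hg : g ∈ polyFns V)
    (h : ∀ v, S.Generic v → g v = 0) : g = 0 := by
  funext v
  obtain ⟨u, hu⟩ := S.exists_generic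
  refine tendsto_nhds_unique (tendsto_line hg v u) (tendsto_const_nhds.congr' ?_)
  filter_upwards [S.eventually_generic v hu] with t ht
  exact (h _ ht).symm

/-- A polynomial function which vanishes on some facets of a maximal cone is divisible by the
product of their equations. -/
theorem exists_eq_mul_prod {p : κ} {g : V → ℝ} (hg : g ∈ polyFns V) {I : Finset ι}
    (hI : I ⊆ S.idx p) (h : ∀ i ∈ I, ∀ v ∈ S.cone p, S.x p i v = 0 → g v = 0) :
    ∃ a ∈ polyFns V, ∀ v, g v = a v * ∏ i ∈ I, S.x p i v := by
  induction I using Finset.induction_on generalizing g with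
  | empty => exact ⟨g, hg, by simp⟩
  | insert i I hiI ih =>
    have hi : i ∈ S.idx p := hI (Finset.mem_insert_self i I)
    have hproj : ∀ v, ∀ j, S.x p j (v - S.x p i v • ξ i) = if j = i then 0 else S.x p j v := by
      intro v j
      rw [map_sub, map_smul, S.x_xi hi]
      by_cases hj : j = i
      · subst hj
        simp
      · simp [hj]
    obtain ⟨a, ha, hga⟩ := exists_eq_add_mul hg (S.x p i) (ξ i)
    have hzero : (fun v => g (v - S.x p i v • ξ i)) = 0 := by
      refine S.eq_zero_of_cone (p := p) ?_ fun v hv => ?_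
      · exact polyFns_comp hg (LinearMap.id - (S.x p i).smulRight (ξ i))
      · refine h i (Finset.mem_insert_self i I) _ (fun j => ?_) ?_
        · rw [hproj]
          split_ifs
          · exact le_rfl
          · exact hv j
        · rw [hproj, if_pos rfl]
    have hga' : ∀ v, g v = S.x p i v * a v := fun v => by
      rw [hga v, show g (v - S.x p i v • ξ i) = 0 from congrFun hzero v, zero_add]
    obtain ⟨b, hb, hab⟩ := ih ha ((Finset.subset_insert i I).trans hI) fun j hj v hv hvj => by
      have hji : j ≠ i := fun h => hiI (h ▸ hj)
      -- near `v`, move into the half space where the equation of the `i`-th facet is positive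
      refine tendsto_nhds_unique (tendsto_line ha v (ξ i)) (tendsto_const_nhds.congr' ?_)
      filter_upwards [self_mem_nhdsWithin] with t ht
      have ht' : (0 : ℝ) < t := ht
      have hx : ∀ l, S.x p l (v + t • ξ i) = S.x p l v + if l = i then t else 0 := fun l => by
        rw [map_add, map_smul, S.x_xi hi]
        simp
      have h0 := h j (Finset.mem_insert_of_mem hj) (v + t • ξ i) (fun l => by
        rw [hx]
        have := hv l
        split_ifs <;> linarith) (by rw [hx, hvj, if_neg hji, add_zero])
      rw [hga', hx, if_pos rfl] at h0
      exact ((mul_eq_zero.1 h0).resolve_left (by linarith [hv i])).symm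
    refine ⟨b, hb, fun v => ?_⟩
    rw [hga', hab, Finset.prod_insert hiI]
    ring

end SimpleFan

end PolytopeAlgebra

namespace PolytopeAlgebra

/-! ### Differential operators acting on powers of linear forms -/

section Diff

open MvPolynomial

variable {ι : Type*}

theorem diffHom_mul (d e q : MvPolynomial ι ℝ) : diffHom (d * e) q = diffHom d (diffHom e q) := by
  rw [map_mul, Module.End.mul_apply]

/-- The linear form with coefficients `c`. -/
noncomputable def linForm [Fintype ι] (c : ι → ℝ) : MvPolynomial ι ℝ := ∑ i, C (c i) * X i

theorem pderiv_linForm_pow [Fintype ι] (c : ι → ℝ) (N : ℕ) (i : ι) :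
    pderiv i (linForm c ^ N) = (N * c i) • linForm c ^ (N - 1) := by
  classical
  have : pderiv i (linForm c) = C (c i) := by
    simp [linForm, pderiv_X, Pi.single_apply, C_mul', smul_eq_C_mul (1 : MvPolynomial ι ℝ)]
  rw [pderiv_pow, this, smul_eq_C_mul, C_mul, C_eq_coe_nat]
  ring

theorem diffHom_monomial_linForm_pow [Fintype ι] (c : ι → ℝ) (s : ι →₀ ℕ) (a : ℝ) (N : ℕ) :
    diffHom (monomial s a) (linForm c ^ N) =
      (N.descFactorial s.degree * eval c (monomial s a)) • linForm c ^ (N - s.degree) := by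
  induction s using Finsupp.induction_linear generalizing a N with
  | zero => simp [← C_apply, Algebra.algebraMap_eq_smul_one, ← algebraMap_eq]
  | add s t hs ht =>
    rw [show monomial (s + t) a = monomial s a * monomial t (1 : ℝ) by
      rw [monomial_mul, mul_one], diffHom_mul, ht, map_smul, hs, smul_smul, map_mul, map_add,
      Nat.sub_sub, add_comm t.degree]
    congr 1
    rw [← Nat.descFactorial_mul_descFactorial (Nat.le_add_left t.degree s.degree),
      Nat.add_sub_cancel]
    push_cast
    ring
  | single i m =>
    induction m generalizing a N with
    | zero => simp [← C_apply, Algebra.algebraMap_eq_smul_one, ← algebraMap_eq]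
    | succ m ih =>
      rw [Finsupp.single_add, show monomial (Finsupp.single i m + Finsupp.single i 1) a =
        monomial (Finsupp.single i m) a * X i by rw [X, monomial_mul, mul_one], diffHom_mul,
        diffHom_X, pderiv_linForm_pow, map_smul, ih, smul_smul, map_mul, eval_X, map_add,
        Finsupp.degree_single, Finsupp.degree_single, Nat.sub_sub, add_comm 1 m]
      congr 1
      cases N with
      | zero => simp
      | succ N =>
        rw [Nat.succ_descFactorial_succ]
        push_cast [Nat.add_sub_cancel]
        ring

/-- A homogeneous operator pairs with a power of a linear form by evaluation. -/
theorem constantCoeff_diffHom_linForm_pow [Fintype ι] (c : ι → ℝ) {d : MvPolynomial ι ℝ} {m : ℕ}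
    (hd : d.IsHomogeneous m) (N : ℕ) :
    constantCoeff (diffHom d (linForm c ^ N)) = if m = N then N.factorial * eval c d else 0 := by
  have hlin : constantCoeff (linForm c) = 0 := by simp [linForm]
  conv_lhs => rw [d.as_sum]
  rw [map_sum, LinearMap.sum_apply, map_sum]
  have hterm : ∀ s ∈ d.support,
      constantCoeff (diffHom (monomial s (coeff s d)) (linForm c ^ N)) =
        if m = N then N.factorial * eval c (monomial s (coeff s d)) else 0 := by
    intro s hs
    have hs' : s.degree = m := by
      rw [Finsupp.degree_eq_weight_one]
      exact hd (mem_support_iff.1 hs)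
    rw [diffHom_monomial_linForm_pow, constantCoeff_smul, map_pow, hlin, hs', smul_eq_mul]
    rcases lt_trichotomy m N with h | h | h
    · rw [if_neg h.ne, zero_pow (by omega), mul_zero]
    · subst h
      simp [Nat.descFactorial_self]
    · rw [if_neg h.ne', Nat.descFactorial_eq_zero_iff_lt.2 h]
      simp
  rw [Finset.sum_congr rfl hterm]
  split_ifs
  · rw [← Finset.mul_sum, ← map_sum, ← d.as_sum]
  · simp

theorem coeff_diffHom_monomial (s m : ι →₀ ℕ) :
    ∃ c : ℝ, c ≠ 0 ∧ ∀ q, coeff m (diffHom (monomial s 1) q) = c * coeff (m + s) q := by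
  induction s using Finsupp.induction_linear generalizing m with
  | zero => exact ⟨1, one_ne_zero, fun q => by simp⟩
  | add s t hs ht =>
    obtain ⟨c, hc, h1⟩ := hs m
    obtain ⟨c', hc', h2⟩ := ht (m + s)
    refine ⟨c * c', mul_ne_zero hc hc', fun q => ?_⟩
    rw [show monomial (s + t) (1 : ℝ) = monomial s 1 * monomial t 1 by
      rw [monomial_mul, mul_one], diffHom_mul, h1, h2, mul_assoc, add_assoc]
  | single i k =>
    induction k generalizing m with
    | zero => exact ⟨1, one_ne_zero, fun q => by simp⟩
    | succ k ih =>
      obtain ⟨c, hc, h1⟩ := ih m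
      refine ⟨c * ((m + Finsupp.single i k) i + 1), mul_ne_zero hc (by positivity), fun q => ?_⟩
      rw [Finsupp.single_add, show monomial (Finsupp.single i k + Finsupp.single i 1) (1 : ℝ) =
        monomial (Finsupp.single i k) 1 * X i by rw [X, monomial_mul, mul_one], diffHom_mul,
        diffHom_X, h1, coeff_pderiv, add_assoc]
      ring

/-- The pairing between operators and polynomials is nondegenerate. -/
theorem eq_zero_of_constantCoeff_diffHom {q : MvPolynomial ι ℝ}
    (h : ∀ d, constantCoeff (diffHom d q) = 0) : q = 0 := by
  ext s
  obtain ⟨c, hc, h1⟩ := coeff_diffHom_monomial s (0 : ι →₀ ℕ)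
  have := h (monomial s 1)
  rw [constantCoeff_eq, h1, zero_add] at this
  simpa [hc] using this

end Diff

end PolytopeAlgebra

namespace PolytopeAlgebra

/-! ### The volume polynomial and the space of virtual polytopes -/

section VolumePolynomial

open Filter Topology

variable {V : Type*} [AddCommGroup V] [Module ℝ V] {ι : Type*} [Fintype ι] [DecidableEq ι]

namespace SimpleFan

variable {ξ : ι → V} {κ : Type*} (S : SimpleFan ξ κ)

theorem isOpen_adm [Finite κ] : IsOpen {k | S.Adm k} := by
  have : {k | S.Adm k} = ⋂ p, ⋂ i, {k | i ∉ S.idx p → S.pt k p (ξ i) < k i} := by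
    ext k
    simp [Adm]
  rw [this]
  refine isOpen_iInter_of_finite fun p => isOpen_iInter_of_finite fun i => ?_
  by_cases hi : i ∈ S.idx p
  · simp [hi]
  · simp only [hi, not_false_eq_true, forall_const, pt_apply]
    exact isOpen_lt (by fun_prop) (by fun_prop)

theorem ext_of_adm [Finite κ] {f g : MvPolynomial ι ℝ}
    (h : ∀ k, S.Adm k → MvPolynomial.eval k f = MvPolynomial.eval k g) : f = g := by
  obtain ⟨δ, hδ, hsub⟩ := Metric.isOpen_iff.1 S.isOpen_adm S.h S.adm_h
  refine MvPolynomial.funext_set (fun i => Metric.ball (S.h i) δ) (fun i => ?_) fun k hk => h k ?_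
  · rw [Real.ball_eq_Ioo]
    exact Set.Ioo_infinite (by linarith)
  · exact hsub (by rwa [ball_pi _ hδ])

/-- The piecewise linear function with value `1` at `ξ i` and `0` at the other generators. -/
noncomputable def chi (i : ι) (v : V) : ℝ := S.x (S.complete v).choose i v

theorem chi_eq {p : κ} {v : V} (hv : v ∈ S.cone p) (i : ι) : S.chi i v = S.x p i v :=
  S.x_eq_of_mem_cone hv (S.complete v).choose_spec i

theorem xi_mem_cone {p : κ} {i : ι} (hi : i ∈ S.idx p) : ξ i ∈ S.cone p := fun j => by
  rw [S.x_xi hi]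
  split_ifs <;> simp

theorem chi_xi (i j : ι) : S.chi i (ξ j) = if j = i then 1 else 0 := by
  obtain ⟨p, hp⟩ := S.exists_mem_idx j
  rw [S.chi_eq (S.xi_mem_cone hp), S.x_xi hp]
  simp [eq_comm]

/-- The polytope `Q` has support numbers `k` and its normal fan is coarser than the fan `S`. -/
structure Supports (k : ι → ℝ) (Q : Set (Dual ℝ V)) : Prop where
  isPolytope : IsPolytope Q
  pt_mem : ∀ p, S.pt k p ∈ Q
  le : ∀ y ∈ Q, ∀ i, y (ξ i) ≤ k i

namespace Supports

variable {S} {k : ι → ℝ} {Q : Set (Dual ℝ V)}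

theorem supportFn_eq (hQ : S.Supports k Q) (v : V) : supportFn Q v = ∑ i, k i * S.chi i v := by
  obtain ⟨p, hp⟩ := S.complete v
  rw [PolytopeAlgebra.supportFn_eq (y := S.pt k p)
    ⟨hQ.pt_mem p, fun z hz => S.le_pt hp (hQ.le z hz)⟩, pt_apply]
  exact Finset.sum_congr rfl fun i _ => by rw [S.chi_eq hp, mul_comm]

theorem supportFn_xi (hQ : S.Supports k Q) (i : ι) : supportFn Q (ξ i) = k i := by
  simp [hQ.supportFn_eq, S.chi_xi]

end Supports

theorem supports_face [Finite κ] {k : ι → ℝ} (hk : S.Adm k) : S.Supports k (S.face k ∅) where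
  isPolytope := S.isPolytope_face k ((S.complete 0).imp fun _ _ => Finset.empty_subset _)
  pt_mem _ := S.pt_mem_face k (Finset.empty_subset _)
  le _ hy := S.xi_le_of_mem_face hk hy

theorem face_mem_analogousPolytopes [Finite κ] {k : ι → ℝ} (hk : S.Adm k) :
    S.face k ∅ ∈ analogousPolytopes (S.face S.h ∅) :=
  ⟨(S.supports_face hk).isPolytope, S.analogous_face S.adm_h hk _ ∅
    ((S.complete 0).imp fun _ _ => Finset.empty_subset _) (by simp)⟩

theorem supports_of_analogous [FiniteDimensional ℝ V] [Finite κ] {Q : Set (Dual ℝ V)}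
    (hQ : Q ∈ analogousPolytopes (S.face S.h ∅)) : S.Supports (fun i => supportFn Q (ξ i)) Q := by
  refine ⟨hQ.1, fun p => ?_, fun y hy i => hQ.1.le_supportFn hy _⟩
  obtain ⟨q, hq⟩ := S.exists_common_point S.adm_h _ ∅ Q hQ.1 (by simp) hQ.2 p
    (Finset.empty_subset _)
  have hqeq : S.pt (fun i => supportFn Q (ξ i)) p = q := by
    ext v
    rw [S.apply_eq p q, pt_apply]
    refine Finset.sum_congr rfl fun i _ => ?_
    by_cases hi : i ∈ S.idx p
    · rw [supportFn_eq (hq i hi)]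
    · simp [S.x_of_notMem hi]
  obtain ⟨u, hu⟩ := hQ.1.faceAt_nonempty 0
  by_cases hn : (S.idx p).Nonempty
  · obtain ⟨i, hi⟩ := hn
    exact hqeq ▸ (hq i hi).1
  · -- in dimension `0` there is only one linear function
    have h0 : finrank ℝ V = 0 := by
      rw [← S.card_idx p, Finset.not_nonempty_iff_eq_empty.1 hn, Finset.card_empty]
    have := Module.finrank_zero_iff.1 h0
    have hsub : S.pt (fun i => supportFn Q (ξ i)) p = u := LinearMap.ext fun v => by
      rw [Subsingleton.elim v 0, map_zero, map_zero]
    exact hsub ▸ hu.1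

/-- The support numbers are linear coordinates on the space of virtual polytopes. -/
theorem bijective_supportNumbers [FiniteDimensional ℝ V] [Finite κ] :
    Function.Bijective (fun (f : virtualPolytopes (S.face S.h ∅)) (i : ι) =>
      (f : V → ℝ) (ξ i)) := by
  have hpl : ∀ f ∈ virtualPolytopes (S.face S.h ∅), ∀ v, f v = ∑ i, f (ξ i) * S.chi i v := by
    intro f hf
    induction hf using Submodule.span_induction with
    | mem f hf =>
      obtain ⟨Q, hQ, rfl⟩ := hf
      exact (S.supports_of_analogous hQ).supportFn_eq
    | zero => simp
    | add f g _ _ h1 h2 =>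
      intro v
      simp only [Pi.add_apply, add_mul, Finset.sum_add_distrib]
      rw [← h1, ← h2]
    | smul c f _ h1 =>
      intro v
      simp only [Pi.smul_apply, smul_eq_mul, mul_assoc, ← Finset.mul_sum]
      rw [← h1]
  refine ⟨fun f g hfg => Subtype.ext (funext fun v => ?_), fun k => ?_⟩
  · rw [hpl f f.2 v, hpl g g.2 v]
    exact Finset.sum_congr rfl fun i _ => by rw [show (f : V → ℝ) (ξ i) = _ from congrFun hfg i]
  · have hcont : Tendsto (fun ε : ℝ => S.h + ε • k) (𝓝[>] 0) (𝓝 S.h) := by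
      have : Continuous fun ε : ℝ => S.h + ε • k := by fun_prop
      simpa using (this.tendsto 0).mono_left nhdsWithin_le_nhds
    obtain ⟨ε, hadm, hε⟩ := ((hcont.eventually (S.isOpen_adm.mem_nhds S.adm_h)).and
      self_mem_nhdsWithin).exists
    have hε' : ε ≠ 0 := (Set.mem_Ioi.1 hε).ne'
    have hmem : ∀ k, S.Adm k → supportFn (S.face k ∅) ∈ virtualPolytopes (S.face S.h ∅) :=
      fun k hk => Submodule.subset_span ⟨_, S.face_mem_analogousPolytopes hk, rfl⟩
    refine ⟨⟨_, Submodule.smul_mem _ ε⁻¹ (Submodule.sub_mem _ (hmem _ hadm) (hmem _ S.adm_h))⟩,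
      funext fun i => ?_⟩
    simp [(S.supports_face hadm).supportFn_xi, (S.supports_face S.adm_h).supportFn_xi, hε']

variable [Fintype κ] (Ω : V [⋀^Fin (finrank ℝ V)]→ₗ[ℝ] ℝ)

/-- The sum over the vertices of the `N`-th powers of the pieces of the generic piecewise linear
function, divided by the facet products. -/
noncomputable def powerSum (v : V) (N : ℕ) : MvPolynomial ι ℝ :=
  ∑ p, MvPolynomial.C (S.den Ω p v)⁻¹ * linForm (fun i => S.x p i v) ^ N

theorem eval_powerSum (v : V) (N : ℕ) (k : ι → ℝ) :
    MvPolynomial.eval k (S.powerSum Ω v N) = ∑ p, S.pt k p v ^ N / S.den Ω p v := by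
  simp [powerSum, linForm, pt_apply, div_eq_inv_mul]

theorem constantCoeff_diffHom_powerSum (v : V) {d : MvPolynomial ι ℝ} {m : ℕ}
    (hd : d.IsHomogeneous m) (N : ℕ) :
    MvPolynomial.constantCoeff (diffHom d (S.powerSum Ω v N)) =
      if m = N then N.factorial *
        ∑ p, MvPolynomial.eval (fun i => S.x p i v) d / S.den Ω p v else 0 := by
  simp only [powerSum, ← MvPolynomial.smul_eq_C_mul, map_sum, map_smul,
    MvPolynomial.constantCoeff_smul, constantCoeff_diffHom_linForm_pow _ hd, smul_eq_mul]
  split_ifs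
  · rw [Finset.mul_sum]
    exact Finset.sum_congr rfl fun p _ => by ring
  · simp

variable [FiniteDimensional ℝ V] {Ω}

theorem powerSum_eq_zero (hΩ : Ω ≠ 0) {v : V} (hv : S.Generic v) {N : ℕ} (hN : N < finrank ℝ V) :
    S.powerSum Ω v N = 0 := by
  refine S.ext_of_adm fun k hk => ?_
  have hQ := S.supports_face hk
  rw [eval_powerSum, S.sum_pow_div_den hΩ hQ.isPolytope hQ.pt_mem hQ.le hv hN.le, if_neg hN.ne,
    map_zero]

theorem eval_powerSum_finrank (hΩ : Ω ≠ 0) {v : V} (hv : S.Generic v) {k : ι → ℝ}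
    {Q : Set (Dual ℝ V)} (hQ : S.Supports k Q) :
    MvPolynomial.eval k (S.powerSum Ω v (finrank ℝ V)) = (finrank ℝ V).factorial * vol Ω Q := by
  rw [eval_powerSum, S.sum_pow_div_den hΩ hQ.isPolytope hQ.pt_mem hQ.le hv le_rfl, if_pos rfl]

theorem isVolumePolynomial_powerSum (hΩ : Ω ≠ 0) {v : V} (hv : S.Generic v) :
    IsVolumePolynomial Ω (S.face S.h ∅) ξ
      (((finrank ℝ V).factorial : ℝ)⁻¹ • S.powerSum Ω v (finrank ℝ V)) := by
  refine ⟨?_, fun Q hQ => ?_⟩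
  · rw [MvPolynomial.smul_eq_C_mul]
    refine MvPolynomial.IsHomogeneous.C_mul (MvPolynomial.IsHomogeneous.sum _ _ _ fun p _ =>
      MvPolynomial.IsHomogeneous.C_mul ?_ _) _
    have : (linForm fun i => S.x p i v).IsHomogeneous 1 :=
      MvPolynomial.IsHomogeneous.sum _ _ _ fun i _ =>
        (MvPolynomial.isHomogeneous_X ℝ i).C_mul _
    simpa using this.pow (finrank ℝ V)
  · rw [MvPolynomial.smul_eval, S.eval_powerSum_finrank hΩ hv (S.supports_of_analogous hQ),
      inv_mul_cancel_left₀ (by positivity)]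

theorem IsVolumePolynomial.unique {q q' : MvPolynomial ι ℝ}
    (hq : IsVolumePolynomial Ω (S.face S.h ∅) ξ q)
    (hq' : IsVolumePolynomial Ω (S.face S.h ∅) ξ q') : q = q' := by
  refine S.ext_of_adm fun k hk => ?_
  have h1 := hq.2 _ (S.face_mem_analogousPolytopes hk)
  have h2 := hq'.2 _ (S.face_mem_analogousPolytopes hk)
  simp only [(S.supports_face hk).supportFn_xi] at h1 h2
  rw [h1, h2]

theorem isVolumePolynomial_volPoly (hΩ : Ω ≠ 0) :
    IsVolumePolynomial Ω (S.face S.h ∅) ξ (volPoly Ω (S.face S.h ∅) ξ) := by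
  obtain ⟨v, hv⟩ := S.exists_generic
  exact Classical.epsilon_spec ⟨_, S.isVolumePolynomial_powerSum hΩ hv⟩

theorem volPoly_eq (hΩ : Ω ≠ 0) {v : V} (hv : S.Generic v) :
    volPoly Ω (S.face S.h ∅) ξ =
      ((finrank ℝ V).factorial : ℝ)⁻¹ • S.powerSum Ω v (finrank ℝ V) :=
  IsVolumePolynomial.unique S (S.isVolumePolynomial_volPoly hΩ)
    (S.isVolumePolynomial_powerSum hΩ hv)

theorem constantCoeff_diffHom_volPoly (hΩ : Ω ≠ 0) {v : V} (hv : S.Generic v)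
    {d : MvPolynomial ι ℝ} {m : ℕ} (hd : d.IsHomogeneous m) :
    MvPolynomial.constantCoeff (diffHom d (volPoly Ω (S.face S.h ∅) ξ)) =
      if m = finrank ℝ V then ∑ p, MvPolynomial.eval (fun i => S.x p i v) d / S.den Ω p v
        else 0 := by
  rw [S.volPoly_eq hΩ hv, map_smul, MvPolynomial.constantCoeff_smul,
    S.constantCoeff_diffHom_powerSum Ω v hd]
  split_ifs
  · rw [smul_eq_mul, inv_mul_cancel_left₀ (by positivity)]
  · simp

/-- In degrees up to the dimension, the sum over the vertices of the values of a polynomial in the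
`χ i`, divided by the facet products, is given by the action on the volume polynomial. -/
theorem sum_eval_div_den (hΩ : Ω ≠ 0) {v : V} (hv : S.Generic v) {d : MvPolynomial ι ℝ} {m : ℕ}
    (hd : d.IsHomogeneous m) (hm : m ≤ finrank ℝ V) :
    ∑ p, MvPolynomial.eval (fun i => S.x p i v) d / S.den Ω p v =
      MvPolynomial.constantCoeff (diffHom d (volPoly Ω (S.face S.h ∅) ξ)) := by
  rw [S.constantCoeff_diffHom_volPoly hΩ hv hd]
  rcases hm.lt_or_eq with h | h
  · rw [if_neg h.ne]
    have := S.constantCoeff_diffHom_powerSum Ω v hd m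
    rw [S.powerSum_eq_zero hΩ hv h, map_zero, map_zero, if_pos rfl] at this
    exact (mul_eq_zero.1 this.symm).resolve_left (by positivity)
  · rw [if_pos h]

end SimpleFan

end VolumePolynomial

end PolytopeAlgebra

namespace PolytopeAlgebra

/-! ### Piecewise polynomial functions and the functional of Brion -/

namespace SimpleFan

open Filter Topology

variable {V : Type*} [AddCommGroup V] [Module ℝ V] {ι : Type*} [Fintype ι] [DecidableEq ι]
  {ξ : ι → V} {κ : Type*} (S : SimpleFan ξ κ)

theorem cone_injective : Function.Injective S.cone := fun _ _ h => S.idx_eq_of_subset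
  ((S.vec_mem_cone_iff subset_rfl).1 (h ▸ (S.vec_mem_cone_iff subset_rfl).2 subset_rfl))

theorem span_cone (p : κ) : Submodule.span ℝ (S.cone p) = ⊤ := by
  rw [eq_top_iff]
  rintro v -
  rw [← S.sum_x p v]
  refine Submodule.sum_mem _ fun i _ => ?_
  by_cases hi : i ∈ S.idx p
  · exact Submodule.smul_mem _ _ (Submodule.subset_span (S.xi_mem_cone hi))
  · simp [S.x_of_notMem hi]

theorem dimC_cone (p : κ) : dimC (S.cone p) = finrank ℝ V := by
  rw [dimC, S.span_cone, finrank_top]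

theorem span_wall (p : κ) (i : ι) :
    Submodule.span ℝ {v | v ∈ S.cone p ∧ S.x p i v = 0} = LinearMap.ker (S.x p i) := by
  refine le_antisymm (Submodule.span_le.2 fun v hv => hv.2) fun v hv => ?_
  rw [← S.sum_x p v]
  refine Submodule.sum_mem _ fun j _ => ?_
  by_cases hj : j ∈ S.idx p
  · by_cases hij : i = j
    · subst hij
      rw [LinearMap.mem_ker.1 hv, zero_smul]
      exact Submodule.zero_mem _
    · refine Submodule.smul_mem _ _ (Submodule.subset_span ⟨S.xi_mem_cone hj, ?_⟩)
      rw [S.x_xi hj, if_neg hij]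
  · simp [S.x_of_notMem hj]

theorem wall_injOn (p : κ) :
    Set.InjOn (fun i => {v | v ∈ S.cone p ∧ S.x p i v = 0}) (S.idx p) := by
  intro i hi j hj hij
  by_contra hne
  have hmem : ξ j ∈ {v | v ∈ S.cone p ∧ S.x p i v = 0} :=
    ⟨S.xi_mem_cone hj, by rw [S.x_xi hj, if_neg hne]⟩
  dsimp only at hij
  rw [hij] at hmem
  have := hmem.2
  rw [S.x_xi hj, if_pos rfl] at this
  exact one_ne_zero this

/-- The facets of a maximal cone are its subsets on which one coordinate vanishes. -/
theorem isConeFacet_iff [FiniteDimensional ℝ V] {p : κ} {τ : Set V} :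
    IsConeFacet (S.cone p) τ ↔ ∃ i ∈ S.idx p, {v | v ∈ S.cone p ∧ S.x p i v = 0} = τ := by
  have hker : ∀ i ∈ S.idx p, finrank ℝ (LinearMap.ker (S.x p i)) + 1 = finrank ℝ V := fun i hi =>
    Module.Dual.finrank_ker_add_one_of_ne_zero (S.x_ne_zero hi)
  constructor
  · rintro ⟨⟨L, hL, rfl⟩, hdim⟩
    rw [S.dimC_cone, dimC] at hdim
    have hterm : ∀ v ∈ S.cone p, L v = 0 ↔ ∀ i, S.x p i v * L (ξ i) = 0 := by
      intro v hv
      rw [S.apply_eq p L v, Finset.sum_eq_zero_iff_of_nonneg]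
      · simp
      · intro i _
        by_cases hi : i ∈ S.idx p
        · exact mul_nonneg (hv i) (hL _ (S.xi_mem_cone hi))
        · simp [S.x_of_notMem hi]
    obtain ⟨i, hi, hLi⟩ : ∃ i ∈ S.idx p, L (ξ i) ≠ 0 := by
      by_contra! h
      have : {v | v ∈ S.cone p ∧ L v = 0} = S.cone p := by
        ext v
        refine ⟨fun h => h.1, fun hv => ⟨hv, (hterm v hv).2 fun i => ?_⟩⟩
        by_cases hi : i ∈ S.idx p
        · simp [h i hi]
        · simp [S.x_of_notMem hi]
      rw [this, S.span_cone, finrank_top] at hdim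
      omega
    refine ⟨i, hi, ?_⟩
    have huniq : ∀ j ∈ S.idx p, L (ξ j) ≠ 0 → j = i := by
      intro j hj hLj
      by_contra hji
      have hle : Submodule.span ℝ {v | v ∈ S.cone p ∧ L v = 0} ≤
          LinearMap.ker (S.x p i) ⊓ LinearMap.ker (S.x p j) := by
        rw [Submodule.span_le]
        rintro v ⟨hv, hLv⟩
        have := (hterm v hv).1 hLv
        exact ⟨(mul_eq_zero.1 (this i)).resolve_right hLi,
          (mul_eq_zero.1 (this j)).resolve_right hLj⟩
      have hlt : LinearMap.ker (S.x p i) ⊓ LinearMap.ker (S.x p j) < LinearMap.ker (S.x p i) := by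
        refine lt_of_le_of_ne inf_le_left fun h => ?_
        have hmem : ξ j ∈ LinearMap.ker (S.x p i) := by
          rw [LinearMap.mem_ker, S.x_xi hj, if_neg (Ne.symm hji)]
        have := LinearMap.mem_ker.1 (inf_eq_left.1 h hmem)
        rw [S.x_xi hj, if_pos rfl] at this
        exact one_ne_zero this
      have h1 := Submodule.finrank_mono hle
      have h2 := Submodule.finrank_lt_finrank_of_lt hlt
      have h3 := hker i hi
      omega
    ext v
    refine and_congr_right fun hv => ?_
    rw [hterm v hv]
    refine ⟨fun h j => ?_, fun h => (mul_eq_zero.1 (h i)).resolve_right hLi⟩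
    by_cases hj : j ∈ S.idx p
    · by_cases hLj : L (ξ j) = 0
      · rw [hLj, mul_zero]
      · rw [huniq j hj hLj, h, zero_mul]
    · simp [S.x_of_notMem hj]
  · rintro ⟨i, hi, rfl⟩
    refine ⟨⟨S.x p i, fun v hv => hv i, rfl⟩, ?_⟩
    rw [dimC, S.span_wall p i, hker i hi, S.dimC_cone]

section FacetProduct

variable [FiniteDimensional ℝ V] {Ω : V [⋀^Fin (finrank ℝ V)]→ₗ[ℝ] ℝ}

theorem abs_scale_mul_det (p : κ) (u : Fin (finrank ℝ V) → V) :
    |S.scale Ω p * (Matrix.of fun i j => S.x p (S.enum p i) (u j)).det| = |Ω u| := by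
  have hli : LinearIndependent ℝ fun a => ξ (S.enum p a) := by
    rw [Fintype.linearIndependent_iff]
    intro g hg a
    have := congrArg (S.x p (S.enum p a)) hg
    simpa [S.x_xi, Subtype.coe_inj, (S.enum p).injective.eq_iff] using this
  let b := basisOfLinearIndependentOfCardEqFinrank' _ hli (by simp)
  have hb : (b : Fin (finrank ℝ V) → V) = fun a => ξ (S.enum p a) := by simp [b]
  have hmat : (Matrix.of fun i j => S.x p (S.enum p i) (u j)) = b.toMatrix u := by
    ext i j
    rw [Matrix.of_apply, Basis.toMatrix_apply]
    conv_lhs => rw [← b.sum_repr (u j)]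
    simp [hb, S.x_xi, (S.enum p).injective.eq_iff]
  have hΩ : Ω u = Ω b * b.det u := by
    conv_lhs => rw [Ω.eq_smul_basis_det b]
    simp
  rw [hΩ, hmat, scale, abs_mul, abs_abs, abs_mul, hb, Basis.det_apply]

theorem isFacetProduct_den (hΩ : Ω ≠ 0) (p : κ) : IsFacetProduct Ω (S.cone p) (S.den Ω p) := by
  refine ⟨S.scale Ω p, fun a => S.x p (S.enum p a), S.scale_pos hΩ p, fun a v hv => hv _, ?_,
    S.abs_scale_mul_det p, ?_⟩
  · refine ⟨fun a _ => S.isConeFacet_iff.2 ⟨_, (S.enum p a).2, rfl⟩, fun a _ b _ hab => ?_,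
      fun τ hτ => ?_⟩
    · exact (S.enum p).injective
        (Subtype.ext (S.wall_injOn p (S.enum p a).2 (S.enum p b).2 hab))
    · obtain ⟨i, hi, rfl⟩ := S.isConeFacet_iff.1 hτ
      exact ⟨(S.enum p).symm ⟨i, hi⟩, Set.mem_univ _, by simp⟩
  · funext v
    rw [den, ← S.prod_enum p fun i => S.x p i v]

/-- The normalization determines the product of the facet equations. -/
theorem IsFacetProduct.eq_den {p : κ} {F : V → ℝ} (hF : IsFacetProduct Ω (S.cone p) F) :
    F = S.den Ω p := by
  obtain ⟨c, l, hc, hpos, hbij, hdet, rfl⟩ := hF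
  -- each equation is a multiple of a coordinate function
  have hπ : ∀ a, ∃ i : S.idx p, {v | v ∈ S.cone p ∧ S.x p i v = 0} =
      {v | v ∈ S.cone p ∧ l a v = 0} := fun a => by
    obtain ⟨i, hi, h⟩ := S.isConeFacet_iff.1 (hbij.mapsTo (Set.mem_univ a))
    exact ⟨⟨i, hi⟩, h⟩
  choose π hπ using hπ
  have hinj : Function.Injective π := fun a b hab =>
    hbij.injOn (Set.mem_univ a) (Set.mem_univ b) (by
      rw [← hπ a, ← hπ b, hab])
  have hπbij : Function.Bijective π := by
    rw [Fintype.bijective_iff_injective_and_card]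
    exact ⟨hinj, by simp [S.card_idx]⟩
  have hzero : ∀ a, ∀ j ∈ S.idx p, j ≠ π a → l a (ξ j) = 0 := by
    intro a j hj hja
    have : ξ j ∈ {v | v ∈ S.cone p ∧ S.x p (π a) v = 0} :=
      ⟨S.xi_mem_cone hj, by rw [S.x_xi hj, if_neg (Ne.symm hja)]⟩
    rw [hπ a] at this
    exact this.2
  have hl : ∀ a v, l a v = l a (ξ (π a)) * S.x p (π a) v := by
    intro a v
    rw [S.apply_eq p (l a) v, Finset.sum_eq_single (π a : ι), mul_comm]
    · intro j _ hj
      by_cases hjp : j ∈ S.idx p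
      · rw [hzero a j hjp hj, mul_zero]
      · simp [S.x_of_notMem hjp]
    · simp
  have hconst : c * ∏ a, l a (ξ (π a)) = S.scale Ω p := by
    have h1 := hdet fun a => ξ (π a)
    have h2 : (Matrix.of fun i j => l i (ξ (π j))) =
        Matrix.diagonal fun a => l a (ξ (π a)) := by
      ext i j
      rw [Matrix.of_apply, Matrix.diagonal_apply]
      split_ifs with hij
      · rw [hij]
      · exact hzero i _ (π j).2 fun h => hij (hinj (Subtype.ext h)).symm
    have hnn : 0 ≤ c * ∏ a, l a (ξ (π a)) := mul_nonneg hc.le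
      (Finset.prod_nonneg fun a _ => hpos a _ (S.xi_mem_cone (π a).2))
    rw [h2, Matrix.det_diagonal, abs_of_nonneg hnn] at h1
    let σ : Equiv.Perm (Fin (finrank ℝ V)) := (Equiv.ofBijective π hπbij).trans (S.enum p).symm
    have h3 : (fun a => ξ (π a)) = (fun a => ξ (S.enum p a)) ∘ σ := by
      funext a
      simp [σ]
    rw [h1, h3, AlternatingMap.map_perm, scale]
    rcases Int.units_eq_one_or (Equiv.Perm.sign σ) with h | h <;> simp [h]
  funext v
  have hprod : ∏ a, l a v = (∏ a, l a (ξ (π a))) * ∏ a, S.x p (π a) v := by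
    rw [← Finset.prod_mul_distrib]
    exact Finset.prod_congr rfl fun a _ => hl a v
  rw [hprod, ← mul_assoc, hconst, den, ← Finset.prod_coe_sort (S.idx p)]
  congr 1
  exact (Equiv.ofBijective π hπbij).prod_comp fun i : S.idx p => S.x p i v

theorem facetProduct_cone (hΩ : Ω ≠ 0) (p : κ) : facetProduct Ω (S.cone p) = S.den Ω p :=
  IsFacetProduct.eq_den S (Classical.epsilon_spec ⟨_, S.isFacetProduct_den hΩ p⟩)

theorem den_ne_zero_iff (hΩ : Ω ≠ 0) (v : V) : (∀ p, S.den Ω p v ≠ 0) ↔ S.Generic v := by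
  refine ⟨fun h p i hi h0 => h p ?_, fun h => S.den_ne_zero hΩ h⟩
  rw [den, Finset.prod_eq_zero hi h0, mul_zero]

end FacetProduct

/-- A set of cones such that each of them lies in a maximal cone of `S`, and whose members of full
dimension are the maximal cones of `S`. -/
structure IsFan (Φ : Set (Set V)) : Prop where
  cone_mem : ∀ p, S.cone p ∈ Φ
  exists_subset : ∀ σ ∈ Φ, ∃ p, σ ⊆ S.cone p
  maxCones_eq : maxCones Φ = Set.range S.cone

variable {S} {Φ : Set (Set V)}

theorem polyOn_eq {p : κ} {f q : V → ℝ} (hq : q ∈ polyFns V) (hfq : Set.EqOn f q (S.cone p)) :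
    polyOn (S.cone p) f = q := by
  have h : polyOn (S.cone p) f ∈ polyFns V ∧ Set.EqOn f (polyOn (S.cone p) f) (S.cone p) :=
    Classical.epsilon_spec (p := fun q => q ∈ polyFns V ∧ Set.EqOn f q (S.cone p)) ⟨q, hq, hfq⟩
  refine sub_eq_zero.1 (S.eq_zero_of_cone (p := p) (sub_mem h.1 hq) fun v hv => ?_)
  rw [Pi.sub_apply, ← h.2 hv, hfq hv, sub_self]

namespace IsFan

theorem mem_pwPoly (hΦ : S.IsFan Φ) {f : V → ℝ} :
    f ∈ pwPoly Φ ↔ ∀ p, ∃ q ∈ polyFns V, Set.EqOn f q (S.cone p) := by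
  refine ⟨fun h p => h _ (hΦ.cone_mem p), fun h σ hσ => ?_⟩
  obtain ⟨p, hp⟩ := hΦ.exists_subset σ hσ
  obtain ⟨q, hq, hfq⟩ := h p
  exact ⟨q, hq, hfq.mono hp⟩

theorem mem_pwHomog (hΦ : S.IsFan Φ) {k : ℕ} {f : pwPoly Φ} :
    f ∈ pwHomog Φ k ↔ ∀ p, ∃ q ∈ linForms V ^ k, Set.EqOn (f : V → ℝ) q (S.cone p) := by
  refine ⟨fun h p => h _ (hΦ.cone_mem p), fun h σ hσ => ?_⟩
  obtain ⟨p, hp⟩ := hΦ.exists_subset σ hσ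
  obtain ⟨q, hq, hfq⟩ := h p
  exact ⟨q, hq, hfq.mono hp⟩

theorem polyOn_spec (hΦ : S.IsFan Φ) {f : V → ℝ} (hf : f ∈ pwPoly Φ) (p : κ) :
    polyOn (S.cone p) f ∈ polyFns V ∧ Set.EqOn f (polyOn (S.cone p) f) (S.cone p) := by
  obtain ⟨q, hq, hfq⟩ := hΦ.mem_pwPoly.1 hf p
  rw [polyOn_eq hq hfq]
  exact ⟨hq, hfq⟩

/-- The functions `χ i` as elements of the algebra of piecewise polynomial functions. -/
noncomputable def chi (hΦ : S.IsFan Φ) (i : ι) : pwPoly Φ :=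
  ⟨S.chi i, hΦ.mem_pwPoly.2 fun p => ⟨_, dual_mem_polyFns (S.x p i), fun _ hv => S.chi_eq hv i⟩⟩

theorem chi_mem_pwHomog (hΦ : S.IsFan Φ) (i : ι) : hΦ.chi i ∈ pwHomog Φ 1 :=
  hΦ.mem_pwHomog.2 fun p => ⟨fun v => S.x p i v, by
    rw [pow_one]
    exact dual_mem_linForms _, fun _ hv => S.chi_eq hv i⟩

theorem polyOn_aeval_chi (hΦ : S.IsFan Φ) (d : MvPolynomial ι ℝ) (p : κ) :
    polyOn (S.cone p) (MvPolynomial.aeval hΦ.chi d : pwPoly Φ) =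
      fun v => MvPolynomial.eval (fun i => S.x p i v) d := by
  induction d using MvPolynomial.induction_on with
  | C a =>
    simp only [MvPolynomial.eval_C]
    exact polyOn_eq (Subalgebra.algebraMap_mem (polyFns V) a) fun v _ => by simp
  | add d e h1 h2 =>
    obtain ⟨h3, h4⟩ := hΦ.polyOn_spec (MvPolynomial.aeval hΦ.chi d : pwPoly Φ).2 p
    obtain ⟨h5, h6⟩ := hΦ.polyOn_spec (MvPolynomial.aeval hΦ.chi e : pwPoly Φ).2 p
    rw [h1] at h3 h4
    rw [h2] at h5 h6
    simp only [map_add]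
    exact polyOn_eq (add_mem h3 h5) fun v hv => by simp [h4 hv, h6 hv]
  | mul_X d i h1 =>
    obtain ⟨h3, h4⟩ := hΦ.polyOn_spec (MvPolynomial.aeval hΦ.chi d : pwPoly Φ).2 p
    rw [h1] at h3 h4
    simp only [map_mul, MvPolynomial.eval_X]
    exact polyOn_eq (mul_mem h3 (dual_mem_polyFns (S.x p i))) fun v hv => by
      simp [h4 hv, chi, S.chi_eq hv]

section Zeta

variable [FiniteDimensional ℝ V] [Fintype κ] {Ω : V [⋀^Fin (finrank ℝ V)]→ₗ[ℝ] ℝ}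

theorem isZeta_iff (hΦ : S.IsFan Φ) (hΩ : Ω ≠ 0) {f g : V → ℝ} :
    IsZeta Ω Φ f g ↔ g ∈ polyFns V ∧ ∀ v, S.Generic v →
      g v = ∑ p, polyOn (S.cone p) f v / S.den Ω p v := by
  refine and_congr_right fun _ => forall_congr' fun v => ?_
  rw [hΦ.maxCones_eq, finsum_mem_range S.cone_injective, finsum_eq_sum_of_fintype]
  simp only [Set.forall_mem_range, S.facetProduct_cone hΩ, S.den_ne_zero_iff hΩ]

theorem isZeta_unique (hΦ : S.IsFan Φ) (hΩ : Ω ≠ 0) {f g g' : V → ℝ} (hg : IsZeta Ω Φ f g)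
    (hg' : IsZeta Ω Φ f g') : g = g' := by
  rw [hΦ.isZeta_iff hΩ] at hg hg'
  refine sub_eq_zero.1 (S.eq_zero_of_generic (sub_mem hg.1 hg'.1) fun v hv => ?_)
  rw [Pi.sub_apply, hg.2 v hv, hg'.2 v hv, sub_self]

theorem isZeta_add (hΦ : S.IsFan Φ) (hΩ : Ω ≠ 0) {f f' g g' : V → ℝ} (hf : f ∈ pwPoly Φ)
    (hf' : f' ∈ pwPoly Φ) (hg : IsZeta Ω Φ f g) (hg' : IsZeta Ω Φ f' g') :
    IsZeta Ω Φ (f + f') (g + g') := by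
  rw [hΦ.isZeta_iff hΩ] at hg hg' ⊢
  refine ⟨add_mem hg.1 hg'.1, fun v hv => ?_⟩
  rw [Pi.add_apply, hg.2 v hv, hg'.2 v hv, ← Finset.sum_add_distrib]
  refine Finset.sum_congr rfl fun p _ => ?_
  obtain ⟨h1, h2⟩ := hΦ.polyOn_spec hf p
  obtain ⟨h3, h4⟩ := hΦ.polyOn_spec hf' p
  rw [polyOn_eq (f := f + f') (add_mem h1 h3) fun v hv => by
    rw [Pi.add_apply, Pi.add_apply, h2 hv, h4 hv], Pi.add_apply, add_div]

theorem isZeta_mul (hΦ : S.IsFan Φ) (hΩ : Ω ≠ 0) {a f g : V → ℝ} (ha : a ∈ polyFns V)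
    (hf : f ∈ pwPoly Φ) (hg : IsZeta Ω Φ f g) : IsZeta Ω Φ (a * f) (a * g) := by
  rw [hΦ.isZeta_iff hΩ] at hg ⊢
  refine ⟨mul_mem ha hg.1, fun v hv => ?_⟩
  rw [Pi.mul_apply, hg.2 v hv, Finset.mul_sum]
  refine Finset.sum_congr rfl fun p _ => ?_
  obtain ⟨h1, h2⟩ := hΦ.polyOn_spec hf p
  rw [polyOn_eq (f := a * f) (mul_mem ha h1) fun v hv => by
    rw [Pi.mul_apply, Pi.mul_apply, h2 hv], Pi.mul_apply, mul_div_assoc]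

theorem isZeta_zero (hΦ : S.IsFan Φ) (hΩ : Ω ≠ 0) : IsZeta Ω Φ 0 0 := by
  rw [hΦ.isZeta_iff hΩ]
  refine ⟨zero_mem _, fun v _ => ?_⟩
  have : ∀ p, polyOn (S.cone p) (0 : V → ℝ) = 0 := fun p =>
    polyOn_eq (zero_mem _) fun _ _ => rfl
  simp [this]

theorem isZeta_sum (hΦ : S.IsFan Φ) (hΩ : Ω ≠ 0) {α : Type*} (s : Finset α) {f g : α → V → ℝ}
    (hf : ∀ a ∈ s, f a ∈ pwPoly Φ) (hg : ∀ a ∈ s, IsZeta Ω Φ (f a) (g a)) :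
    IsZeta Ω Φ (∑ a ∈ s, f a) (∑ a ∈ s, g a) := by
  classical
  induction s using Finset.induction_on with
  | empty => simpa using hΦ.isZeta_zero hΩ
  | insert a s ha ih =>
    rw [Finset.sum_insert ha, Finset.sum_insert ha]
    exact hΦ.isZeta_add hΩ (hf a (by simp)) (sum_mem fun b hb => hf b (by simp [hb]))
      (hg a (by simp)) (ih (fun b hb => hf b (by simp [hb])) fun b hb => hg b (by simp [hb]))

/-- Brion's functional takes constant values on homogeneous polynomials in the `χ i` of degree up
to the dimension, namely those of Timorin's functional. -/
theorem isZeta_aeval_chi (hΦ : S.IsFan Φ) (hΩ : Ω ≠ 0) {d : MvPolynomial ι ℝ} {m : ℕ}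
    (hd : d.IsHomogeneous m) (hm : m ≤ finrank ℝ V) :
    IsZeta Ω Φ (MvPolynomial.aeval hΦ.chi d : pwPoly Φ) (fun _ =>
      MvPolynomial.constantCoeff (diffHom d (volPoly Ω (S.face S.h ∅) ξ))) := by
  rw [hΦ.isZeta_iff hΩ]
  refine ⟨Subalgebra.algebraMap_mem (polyFns V) _, fun v hv => ?_⟩
  rw [← S.sum_eval_div_den hΩ hv hd hm]
  exact Finset.sum_congr rfl fun p _ => by rw [hΦ.polyOn_aeval_chi]

end Zeta

end IsFan

end SimpleFan

end PolytopeAlgebra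

namespace PolytopeAlgebra

/-! ### A module basis of the piecewise polynomial functions, and duality -/

namespace SimpleFan

open Filter Topology

variable {V : Type*} [AddCommGroup V] [Module ℝ V] {ι : Type*} [Fintype ι] [DecidableEq ι]
  {ξ : ι → V} {κ : Type*} (S : SimpleFan ξ κ)

/-- The walls of the cone of `p` which separate it from `v`. Seen from the vertex `p`, they
correspond to the edges along which the linear function `v` increases. -/
noncomputable def up (v : V) (p : κ) : Finset ι := {i ∈ S.idx p | S.x p i v < 0}

theorem mem_up {v : V} {p : κ} {i : ι} : i ∈ S.up v p ↔ i ∈ S.idx p ∧ S.x p i v < 0 :=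
  Finset.mem_filter

theorem up_subset (v : V) (p : κ) : S.up v p ⊆ S.idx p := Finset.filter_subset _ _

theorem Generic.neg {v : V} (hv : S.Generic v) : S.Generic (-v) := fun p i hi => by
  rw [map_neg]
  exact neg_ne_zero.2 (hv p i hi)

/-- On the face of the polytope defined by the facets in `up v p`, the linear function `v` attains
its maximum at the vertex `p` only. -/
theorem pt_le_of_up_subset {v : V} (hv : S.Generic v) {p w : κ} (h : S.up v p ⊆ S.idx w) :
    S.pt S.h w v ≤ S.pt S.h p v ∧ (S.pt S.h w v = S.pt S.h p v → w = p) := by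
  have hterm : ∀ i ∈ Finset.univ, 0 ≤ S.x p i v * (S.h i - S.pt S.h w (ξ i)) := by
    intro i _
    by_cases hi : i ∈ S.up v p
    · simp [S.pt_xi S.h (h hi)]
    · refine mul_nonneg ?_ (sub_nonneg.2 (S.pt_xi_le S.adm_h w i))
      by_cases hip : i ∈ S.idx p
      · rw [mem_up, not_and, not_lt] at hi
        exact hi hip
      · simp [S.x_of_notMem hip]
  have hsum := S.pt_sub_apply S.h p (S.pt S.h w) v
  refine ⟨sub_nonneg.1 (hsum ▸ Finset.sum_nonneg hterm), fun heq => ?_⟩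
  rw [heq, sub_self, eq_comm, Finset.sum_eq_zero_iff_of_nonneg hterm] at hsum
  refine (S.idx_eq_of_subset fun i hi => ?_).symm
  by_contra hiw
  have h1 := (mul_eq_zero.1 (hsum i (Finset.mem_univ i))).resolve_left (hv p i hi)
  linarith [S.h_lt hiw, show S.pt S.h w (ξ i) = (∑ j, S.h j • S.x w j) (ξ i) from rfl]

namespace IsFan

variable {S} {Φ : Set (Set V)}

/-- The squarefree monomials in the functions `χ i`. -/
noncomputable def prodChi (hΦ : S.IsFan Φ) (J : Finset ι) : pwPoly Φ := ∏ i ∈ J, hΦ.chi i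

theorem prodChi_eq_aeval (hΦ : S.IsFan Φ) (J : Finset ι) :
    hΦ.prodChi J = MvPolynomial.aeval hΦ.chi (∏ i ∈ J, (MvPolynomial.X i : MvPolynomial ι ℝ)) := by
  simp [prodChi]

theorem prodChi_apply (hΦ : S.IsFan Φ) (J : Finset ι) {p : κ} {v : V} (hv : v ∈ S.cone p) :
    (hΦ.prodChi J : V → ℝ) v = ∏ i ∈ J, S.x p i v := by
  rw [prodChi, ← Subalgebra.coe_val, map_prod, Finset.prod_apply]
  exact Finset.prod_congr rfl fun i _ => S.chi_eq hv i

theorem prodChi_eq_zero (hΦ : S.IsFan Φ) {J : Finset ι} {p : κ} {v : V} (hv : v ∈ S.cone p)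
    (hJ : ¬ J ⊆ S.idx p) : (hΦ.prodChi J : V → ℝ) v = 0 := by
  obtain ⟨i, hi, hip⟩ := Finset.not_subset.1 hJ
  rw [hΦ.prodChi_apply J hv, Finset.prod_eq_zero hi]
  simp [S.x_of_notMem hip]

theorem polyFns_le (Φ : Set (Set V)) : polyFns V ≤ pwPoly Φ :=
  fun q hq _ _ => ⟨q, hq, fun _ _ => rfl⟩

/-- Inductive form of `exists_eq_sum_mul_prodChi`: the coefficients are found one vertex at a time,
from the top to the bottom. -/
theorem exists_eq_sum_of_vanish (hΦ : S.IsFan Φ) [Fintype κ] [DecidableEq κ] {v : V}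
    (hv : S.Generic v) (n : ℕ) :
    ∀ U : Finset κ, Uᶜ.card = n → (∀ w ∈ U, ∀ p ∉ U, S.pt S.h p v ≤ S.pt S.h w v) →
    ∀ f ∈ pwPoly Φ, (∀ w ∈ U, ∀ u ∈ S.cone w, f u = 0) →
    ∃ a : κ → V → ℝ, (∀ p, a p ∈ polyFns V) ∧ f = ∑ p, a p * hΦ.prodChi (S.up v p) := by
  induction n with
  | zero =>
    intro U hU _ f _ hfU
    refine ⟨0, fun p => zero_mem _, funext fun u => ?_⟩
    obtain ⟨p, hp⟩ := S.complete u
    rw [Finset.card_eq_zero, Finset.compl_eq_empty_iff] at hU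
    simp [hfU p (hU ▸ Finset.mem_univ p) u hp]
  | succ n ih =>
    intro U hU hup f hf hfU
    obtain ⟨p, hpU, hmax⟩ := Finset.exists_max_image Uᶜ (fun p => S.pt S.h p v)
      (Finset.card_pos.1 (by omega))
    rw [Finset.mem_compl] at hpU
    obtain ⟨hg, hfg⟩ := hΦ.polyOn_spec hf p
    obtain ⟨a, ha, hga⟩ := S.exists_eq_mul_prod hg (S.up_subset v p) fun i hi u hu hxu => by
      rw [mem_up] at hi
      obtain ⟨w, hw1, hw2⟩ := S.exists_neighbour hi.1
      -- the neighbour across a wall in `up v p` lies above `p`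
      have hlt : S.pt S.h p v < S.pt S.h w v := by
        have hsum := S.pt_sub_apply S.h p (S.pt S.h w) v
        rw [Finset.sum_eq_single i] at hsum
        · have h1 := mul_neg_of_neg_of_pos hi.2 (sub_pos.2 (S.adm_h w i hw2))
          linarith
        · intro j _ hj
          by_cases hjp : j ∈ S.idx p
          · rw [S.pt_xi S.h (hw1 (by simp [hj, hjp])), sub_self, mul_zero]
          · simp [S.x_of_notMem hjp]
        · simp
      have hwU : w ∈ U := by
        by_contra h
        exact absurd (hmax w (Finset.mem_compl.2 h)) (not_le.2 hlt)
      rw [← hfg hu]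
      refine hfU w hwU u ((S.mem_cone_iff hu).2 fun j hj => hw1 ?_)
      refine Finset.mem_erase.2 ⟨fun h => hj (h ▸ hxu), ?_⟩
      by_contra hjp
      exact hj (by simp [S.x_of_notMem hjp])
    have hf' : f - a * hΦ.prodChi (S.up v p) ∈ pwPoly Φ :=
      sub_mem hf (mul_mem (polyFns_le Φ ha) (hΦ.prodChi _).2)
    obtain ⟨b, hb, hfb⟩ := ih (insert p U) (by
        rw [Finset.compl_insert, Finset.card_erase_of_mem (Finset.mem_compl.2 hpU)]
        omega) (by
        intro w hw q hq
        rw [Finset.mem_insert, not_or] at hq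
        rcases Finset.mem_insert.1 hw with rfl | hw
        · exact hmax q (Finset.mem_compl.2 hq.2)
        · exact hup w hw q hq.2) _ hf' (by
        intro w hw u hu
        rw [Pi.sub_apply, Pi.mul_apply]
        rcases Finset.mem_insert.1 hw with rfl | hw
        · rw [hfg hu, hga, hΦ.prodChi_apply _ hu, sub_self]
        · rw [hfU w hw u hu, hΦ.prodChi_eq_zero hu, mul_zero, sub_zero]
          intro hsub
          obtain ⟨h1, h2⟩ := S.pt_le_of_up_subset hv hsub
          exact hpU (h2 (le_antisymm h1 (hup w hw p hpU)) ▸ hw))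
    refine ⟨b + Pi.single p a, fun q => ?_, ?_⟩
    · rw [Pi.add_apply]
      refine add_mem (hb q) ?_
      by_cases hq : q = p
      · subst hq
        simpa using ha
      · simp [hq]
    · rw [sub_eq_iff_eq_add] at hfb
      rw [hfb]
      simp only [Pi.add_apply, add_mul, Finset.sum_add_distrib]
      congr 1
      rw [Finset.sum_eq_single p]
      · simp
      · intro q _ hq
        simp [hq]
      · simp

/-- The functions `∏ i ∈ up v p, χ i` span the piecewise polynomial functions as a module over the
polynomial functions. -/
theorem exists_eq_sum_mul_prodChi (hΦ : S.IsFan Φ) [Fintype κ] {v : V} (hv : S.Generic v)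
    {f : V → ℝ} (hf : f ∈ pwPoly Φ) :
    ∃ a : κ → V → ℝ, (∀ p, a p ∈ polyFns V) ∧ f = ∑ p, a p * hΦ.prodChi (S.up v p) :=
  open scoped Classical in
  hΦ.exists_eq_sum_of_vanish hv _ ∅ rfl (by simp) f hf (by simp)

/-- The products of basis elements for opposite directions are triangular for the height. -/
theorem prodChi_mul_prodChi_apply (hΦ : S.IsFan Φ) {v : V} (hv : S.Generic v) {p q w : κ}
    (hpq : S.pt S.h p v ≤ S.pt S.h q v) {u : V} (hu : u ∈ S.cone w) (hw : ¬ (w = p ∧ w = q)) :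
    ((hΦ.prodChi (S.up v p) * hΦ.prodChi (S.up (-v) q) : pwPoly Φ) : V → ℝ) u = 0 := by
  rw [Subalgebra.coe_mul, Pi.mul_apply]
  by_cases h1 : S.up v p ⊆ S.idx w
  · by_cases h2 : S.up (-v) q ⊆ S.idx w
    · obtain ⟨h3, h4⟩ := S.pt_le_of_up_subset hv h1
      obtain ⟨h5, h6⟩ := S.pt_le_of_up_subset (Generic.neg S hv) h2
      rw [map_neg, map_neg, neg_le_neg_iff] at h5
      rw [map_neg, map_neg, neg_inj] at h6
      exact absurd ⟨h4 (by linarith), h6 (by linarith)⟩ hw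
    · rw [hΦ.prodChi_eq_zero hu h2, mul_zero]
  · rw [hΦ.prodChi_eq_zero hu h1, zero_mul]

/-! ### Brion's pairing -/

/-- A polynomial function without constant term belongs to the augmentation ideal. -/
theorem mem_augIdeal (Φ : Set (Set V)) {a : V → ℝ} (ha : a ∈ polyFns V) (h0 : a 0 = 0) :
    (⟨a, polyFns_le Φ ha⟩ : pwPoly Φ) ∈ augIdeal Φ := by
  have key : ∃ ha' : a ∈ pwPoly Φ, (⟨a, ha'⟩ - algebraMap ℝ (pwPoly Φ) (a 0)) ∈ augIdeal Φ := by
    clear h0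
    induction ha using Algebra.adjoin_induction with
    | mem a ha =>
      refine ⟨polyFns_le Φ (Algebra.subset_adjoin ha), ?_⟩
      have : a 0 = 0 := by
        obtain ⟨w, rfl⟩ := ha
        simp
      rw [this, map_zero, sub_zero]
      exact Ideal.subset_span ⟨1, one_pos, by rwa [pow_one]⟩
    | algebraMap r =>
      refine ⟨Subalgebra.algebraMap_mem _ r, ?_⟩
      convert zero_mem (augIdeal Φ)
      exact sub_self _
    | add a b _ _ h1 h2 =>
      obtain ⟨h3, h4⟩ := h1
      obtain ⟨h5, h6⟩ := h2
      refine ⟨add_mem h3 h5, ?_⟩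
      convert add_mem h4 h6 using 1
      rw [Pi.add_apply, map_add, show (⟨a + b, add_mem h3 h5⟩ : pwPoly Φ) = ⟨a, h3⟩ + ⟨b, h5⟩
        from rfl]
      ring
    | mul a b _ _ h1 h2 =>
      obtain ⟨h3, h4⟩ := h1
      obtain ⟨h5, h6⟩ := h2
      refine ⟨mul_mem h3 h5, ?_⟩
      convert add_mem (Ideal.mul_mem_left _ ⟨a, h3⟩ h6)
        (Ideal.mul_mem_left _ (algebraMap ℝ (pwPoly Φ) (b 0)) h4) using 1
      rw [Pi.mul_apply, map_mul, show (⟨a * b, mul_mem h3 h5⟩ : pwPoly Φ) = ⟨a, h3⟩ * ⟨b, h5⟩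
        from rfl]
      ring
  obtain ⟨ha', h⟩ := key
  rwa [h0, map_zero, sub_zero] at h

section Zeta

variable [FiniteDimensional ℝ V] [Fintype κ] {Ω : V [⋀^Fin (finrank ℝ V)]→ₗ[ℝ] ℝ}

theorem isZeta_zeta (hΦ : S.IsFan Φ) (hΩ : Ω ≠ 0) (f : pwPoly Φ) :
    IsZeta Ω Φ f (zeta Ω Φ f) := by
  refine Classical.epsilon_spec (p := IsZeta Ω Φ f) ?_
  obtain ⟨v, hv⟩ := S.exists_generic
  obtain ⟨a, ha, hf⟩ := hΦ.exists_eq_sum_mul_prodChi hv f.2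
  have hb : ∀ p, IsZeta Ω Φ (hΦ.prodChi (S.up v p)) _ := fun p => by
    rw [prodChi_eq_aeval]
    refine hΦ.isZeta_aeval_chi hΩ (m := (S.up v p).card) ?_ ?_
    · simpa using MvPolynomial.IsHomogeneous.prod (S.up v p) (fun i => MvPolynomial.X (R := ℝ) i)
        (fun _ => 1) fun i _ => MvPolynomial.isHomogeneous_X ℝ i
    · exact S.card_idx p ▸ Finset.card_le_card (S.up_subset v p)
  rw [hf]
  exact ⟨_, hΦ.isZeta_sum hΩ Finset.univ
    (fun p _ => mul_mem (polyFns_le Φ (ha p)) (hΦ.prodChi _).2)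
    fun p _ => hΦ.isZeta_mul hΩ (ha p) (hΦ.prodChi _).2 (hb p)⟩

theorem zeta_eq (hΦ : S.IsFan Φ) (hΩ : Ω ≠ 0) {f : pwPoly Φ} {g : V → ℝ} (hg : IsZeta Ω Φ f g) :
    zeta Ω Φ f = g := hΦ.isZeta_unique hΩ (hΦ.isZeta_zeta hΩ f) hg

/-- The linear function `f ↦ ζ(f)(0)` on the piecewise polynomial functions. -/
noncomputable def zetaZero (hΦ : S.IsFan Φ) (hΩ : Ω ≠ 0) : pwPoly Φ →ₗ[ℝ] ℝ where
  toFun f := zeta Ω Φ f 0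
  map_add' f g := by
    rw [hΦ.zeta_eq hΩ (f := f + g)
      (hΦ.isZeta_add hΩ f.2 g.2 (hΦ.isZeta_zeta hΩ f) (hΦ.isZeta_zeta hΩ g)), Pi.add_apply]
  map_smul' c f := by
    have hc : algebraMap ℝ (V → ℝ) c ∈ polyFns V := Subalgebra.algebraMap_mem _ c
    have h := hΦ.isZeta_mul hΩ hc f.2 (hΦ.isZeta_zeta hΩ f)
    rw [← Algebra.smul_def, ← Algebra.smul_def] at h
    rw [hΦ.zeta_eq hΩ (f := c • f) h, Pi.smul_apply]
    rfl

theorem zetaZero_mul (hΦ : S.IsFan Φ) (hΩ : Ω ≠ 0) {a : V → ℝ} (ha : a ∈ polyFns V)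
    (f : pwPoly Φ) :
    hΦ.zetaZero hΩ (⟨a, polyFns_le Φ ha⟩ * f) = a 0 * hΦ.zetaZero hΩ f := by
  have h := hΦ.isZeta_mul hΩ ha f.2 (hΦ.isZeta_zeta hΩ f)
  exact congrFun (hΦ.zeta_eq hΩ (f := ⟨a, polyFns_le Φ ha⟩ * f) h) 0

theorem zetaZero_eq_zero (hΦ : S.IsFan Φ) (hΩ : Ω ≠ 0) {f : pwPoly Φ} (hf : f ∈ augIdeal Φ) :
    hΦ.zetaZero hΩ f = 0 := by
  suffices h : ∀ r, hΦ.zetaZero hΩ (f * r) = 0 by simpa using h 1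
  induction hf using Submodule.span_induction with
  | mem f hf =>
    obtain ⟨k, hk, hf⟩ := hf
    intro r
    have h0 : (f : V → ℝ) 0 = 0 := by
      have := linForms_pow_smul hf 0 0
      rwa [zero_pow hk.ne', zero_mul, smul_zero] at this
    have := hΦ.zetaZero_mul hΩ (linForms_pow_le k hf) r
    rwa [h0, zero_mul] at this
  | zero => simp
  | add f g _ _ h1 h2 =>
    intro r
    rw [add_mul, map_add, h1, h2, add_zero]
  | smul a f _ h1 =>
    intro r
    rw [smul_eq_mul, mul_comm a, mul_assoc]
    exact h1 _

theorem zetaBar_mk (hΦ : S.IsFan Φ) (hΩ : Ω ≠ 0) (f : pwPoly Φ) :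
    zetaBar Ω Φ (Ideal.Quotient.mk _ f) = hΦ.zetaZero hΩ f := by
  refine sub_eq_zero.1 ?_
  change hΦ.zetaZero hΩ _ - hΦ.zetaZero hΩ f = 0
  rw [← map_sub]
  refine hΦ.zetaZero_eq_zero hΩ (Ideal.Quotient.eq.1 ?_)
  exact Classical.choose_spec (Ideal.Quotient.mk_surjective (Ideal.Quotient.mk (augIdeal Φ) f))

theorem zetaZero_prodChi_self (hΦ : S.IsFan Φ) (hΩ : Ω ≠ 0) {v : V} (hv : S.Generic v) (q : κ) :
    hΦ.zetaZero hΩ (hΦ.prodChi (S.up v q) * hΦ.prodChi (S.up (-v) q)) = (S.scale Ω q)⁻¹ := by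
  classical
  refine congrFun (hΦ.zeta_eq hΩ (g := fun _ => (S.scale Ω q)⁻¹) ?_) 0
  rw [hΦ.isZeta_iff hΩ]
  refine ⟨Subalgebra.algebraMap_mem (polyFns V) _, fun u hu => ?_⟩
  have hzero : ∀ w, w ≠ q → polyOn (S.cone w)
      (hΦ.prodChi (S.up v q) * hΦ.prodChi (S.up (-v) q) : pwPoly Φ) = 0 := fun w hw =>
    polyOn_eq (zero_mem _) fun u hu =>
      hΦ.prodChi_mul_prodChi_apply hv le_rfl hu fun h => hw h.1
  have hq : polyOn (S.cone q) (hΦ.prodChi (S.up v q) * hΦ.prodChi (S.up (-v) q) : pwPoly Φ) =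
      fun u => ∏ i ∈ S.idx q, S.x q i u := by
    refine polyOn_eq ?_ fun u hu => ?_
    · have : (fun u => ∏ i ∈ S.idx q, S.x q i u) = ∏ i ∈ S.idx q, fun u => S.x q i u := by
        ext u
        rw [Finset.prod_apply]
      rw [this]
      exact prod_mem fun i _ => dual_mem_polyFns _
    · rw [Subalgebra.coe_mul, Pi.mul_apply, hΦ.prodChi_apply _ hu, hΦ.prodChi_apply _ hu,
        ← Finset.prod_union]
      · refine Finset.prod_congr ?_ fun _ _ => rfl
        ext i
        have := hv q i
        simp only [Finset.mem_union, mem_up, map_neg, neg_lt_zero, ← and_or_left]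
        exact ⟨fun h => h.1, fun h => ⟨h, lt_or_gt_of_ne (this h)⟩⟩
      · rw [Finset.disjoint_left]
        intro i h1 h2
        rw [mem_up] at h1 h2
        rw [map_neg] at h2
        linarith [h1.2, h2.2]
  rw [Finset.sum_eq_single q, hq, den]
  · have h1 : ∏ i ∈ S.idx q, S.x q i u ≠ 0 := Finset.prod_ne_zero_iff.2 fun i hi => hu q i hi
    have h2 := (S.scale_pos hΩ q).ne'
    field_simp
  · intro w _ hw
    rw [hzero w hw]
    simp
  · simp

/-- Brion's pairing is nondegenerate. -/
theorem mem_augIdeal_of_zetaZero (hΦ : S.IsFan Φ) (hΩ : Ω ≠ 0) {f : pwPoly Φ}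
    (hf : ∀ g, hΦ.zetaZero hΩ (f * g) = 0) : f ∈ augIdeal Φ := by
  classical
  obtain ⟨v, hv⟩ := S.exists_generic
  obtain ⟨a, ha, hfa⟩ := hΦ.exists_eq_sum_mul_prodChi hv f.2
  have hfa' : f = ∑ p, (⟨a p, polyFns_le Φ (ha p)⟩ : pwPoly Φ) * hΦ.prodChi (S.up v p) := by
    apply Subtype.ext
    rw [hfa, ← Subalgebra.coe_val, map_sum]
    rfl
  suffices h0 : ∀ p, a p 0 = 0 by
    rw [hfa']
    exact sum_mem fun p _ => Ideal.mul_mem_right _ _ (mem_augIdeal Φ (ha p) (h0 p))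
  by_contra! hne
  -- test against the dual basis element of the highest vertex with a nonzero coefficient
  obtain ⟨q, hq, hmax⟩ := Finset.exists_max_image {p | a p 0 ≠ 0} (fun p => S.pt S.h p v)
    (by simpa [Finset.filter_nonempty_iff] using hne)
  rw [Finset.mem_filter] at hq
  have h := hf (hΦ.prodChi (S.up (-v) q))
  rw [hfa', Finset.sum_mul, map_sum, Finset.sum_eq_single q] at h
  · rw [mul_assoc, hΦ.zetaZero_mul hΩ (ha q), hΦ.zetaZero_prodChi_self hΩ hv] at h
    exact (mul_ne_zero hq.2 (inv_ne_zero (S.scale_pos hΩ q).ne')) h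
  · intro p _ hpq
    rw [mul_assoc, hΦ.zetaZero_mul hΩ (ha p)]
    by_cases hp : a p 0 = 0
    · rw [hp, zero_mul]
    · have hle := hmax p (by simpa using hp)
      have : hΦ.prodChi (S.up v p) * hΦ.prodChi (S.up (-v) q) = 0 := by
        apply Subtype.ext
        funext u
        obtain ⟨w, hw⟩ := S.complete u
        exact hΦ.prodChi_mul_prodChi_apply hv hle hw fun h => hpq (h.1.symm.trans h.2)
      rw [this, map_zero, mul_zero]
  · simp

/-- Brion's functional lowers degrees by the dimension, so that the value at `0` vanishes on
homogeneous functions of any other degree. -/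
theorem zetaZero_eq_zero_of_mem_pwHomog (hΦ : S.IsFan Φ) (hΩ : Ω ≠ 0) {f : pwPoly Φ} {m : ℕ}
    (hf : f ∈ pwHomog Φ m) (hm : m ≠ finrank ℝ V) : hΦ.zetaZero hΩ f = 0 := by
  obtain ⟨hg, hgv⟩ := (hΦ.isZeta_iff hΩ).1 (hΦ.isZeta_zeta hΩ f)
  obtain ⟨v, hv⟩ := S.exists_generic
  have hscale : ∀ v, S.Generic v → ∀ t : ℝ, 0 < t →
      t ^ finrank ℝ V * zeta Ω Φ f (t • v) = t ^ m * zeta Ω Φ f v := by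
    intro v hv t ht
    have htv : S.Generic (t • v) := fun p i hi => by
      rw [map_smul, smul_eq_mul]
      exact mul_ne_zero ht.ne' (hv p i hi)
    rw [hgv v hv, hgv _ htv, Finset.mul_sum, Finset.mul_sum]
    refine Finset.sum_congr rfl fun p _ => ?_
    obtain ⟨q, hq, hfq⟩ := hΦ.mem_pwHomog.1 hf p
    have hden : S.den Ω p (t • v) = t ^ finrank ℝ V * S.den Ω p v := by
      simp only [den, map_smul, smul_eq_mul, Finset.prod_mul_distrib, Finset.prod_const,
        S.card_idx]
      ring
    rw [polyOn_eq (linForms_pow_le m hq) hfq, linForms_pow_smul hq, hden]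
    have := pow_ne_zero (finrank ℝ V) ht.ne'
    field_simp
  have hlim : ∀ v, Tendsto (fun t : ℝ => zeta Ω Φ f (t • v)) (𝓝[>] 0) (𝓝 (zeta Ω Φ f 0)) :=
    fun v => by simpa using tendsto_line hg 0 v
  have hpow : ∀ k : ℕ, k ≠ 0 → Tendsto (fun t : ℝ => t ^ k) (𝓝[>] 0) (𝓝 0) := fun k hk => by
    have : Continuous fun t : ℝ => t ^ k := by fun_prop
    simpa [hk] using (this.tendsto 0).mono_left nhdsWithin_le_nhds
  rcases lt_or_gt_of_ne hm with h | h
  · have hzero : zeta Ω Φ f = 0 := by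
      refine S.eq_zero_of_generic hg fun v hv => ?_
      have h1 := (hpow (finrank ℝ V - m) (by omega)).mul (hlim v)
      rw [zero_mul] at h1
      refine tendsto_nhds_unique (tendsto_const_nhds.congr' ?_) h1
      filter_upwards [self_mem_nhdsWithin] with t ht
      have ht' : (0 : ℝ) < t := ht
      have := hscale v hv t ht'
      rw [← Nat.sub_add_cancel h.le, pow_add, mul_comm _ (t ^ m), mul_assoc] at this
      exact (mul_left_cancel₀ (pow_ne_zero m ht'.ne') this).symm
    exact congrFun hzero 0
  · have h1 := (hpow (m - finrank ℝ V) (by omega)).mul_const (zeta Ω Φ f v)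
    rw [zero_mul] at h1
    refine tendsto_nhds_unique ((hlim v).congr' ?_) h1
    filter_upwards [self_mem_nhdsWithin] with t ht
    have ht' : (0 : ℝ) < t := ht
    have := hscale v hv t ht'
    rw [← Nat.sub_add_cancel (le_of_lt h), pow_add, mul_comm _ (t ^ finrank ℝ V), mul_assoc] at this
    exact mul_left_cancel₀ (pow_ne_zero _ ht'.ne') this

end Zeta

end IsFan

end SimpleFan

end PolytopeAlgebra

namespace PolytopeAlgebra

/-! ### The isomorphism between the polytope algebra and the cohomology of the fan -/

namespace SimpleFan

variable {V : Type*} [AddCommGroup V] [Module ℝ V] {ι : Type*} [Fintype ι] [DecidableEq ι]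
  {ξ : ι → V} {κ : Type*} {S : SimpleFan ξ κ}

namespace IsFan

variable {Φ : Set (Set V)}

theorem mul_mem_pwHomog {f g : pwPoly Φ} {k l : ℕ} (hf : f ∈ pwHomog Φ k)
    (hg : g ∈ pwHomog Φ l) : f * g ∈ pwHomog Φ (k + l) := fun σ hσ => by
  obtain ⟨p, hp, hfp⟩ := hf σ hσ
  obtain ⟨q, hq, hgq⟩ := hg σ hσ
  exact ⟨p * q, pow_add (linForms V) k l ▸ Submodule.mul_mem_mul hp hq,
    fun v hv => by simp [hfp hv, hgq hv]⟩

theorem one_mem_pwHomog : (1 : pwPoly Φ) ∈ pwHomog Φ 0 := fun _ _ =>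
  ⟨1, by rw [pow_zero]; exact Submodule.one_le.1 le_rfl, fun _ _ => rfl⟩

theorem aeval_chi_mem_pwHomog (hΦ : S.IsFan Φ) {d : MvPolynomial ι ℝ} {k : ℕ}
    (hd : d.IsHomogeneous k) : MvPolynomial.aeval hΦ.chi d ∈ pwHomog Φ k := by
  rw [d.as_sum, map_sum]
  refine sum_mem fun s hs => ?_
  have hk : s.degree = k := by
    rw [Finsupp.degree_eq_weight_one]
    exact hd (MvPolynomial.mem_support_iff.1 hs)
  rw [MvPolynomial.aeval_monomial, ← Algebra.smul_def, ← hk]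
  refine Submodule.smul_mem _ _ ?_
  clear hs hk
  induction s using Finsupp.induction_linear with
  | zero => simpa using one_mem_pwHomog
  | add s t hs ht =>
    rw [Finsupp.prod_add_index' (by simp) (by simp [pow_add]), map_add]
    exact mul_mem_pwHomog hs ht
  | single i m =>
    rw [Finsupp.prod_single_index (by simp), Finsupp.degree_single]
    induction m with
    | zero => simpa using one_mem_pwHomog
    | succ m ih =>
      rw [pow_succ]
      exact mul_mem_pwHomog ih (hΦ.chi_mem_pwHomog i)

/-- Modulo the ideal generated by the polynomial functions without constant term, every piecewise
polynomial function is a polynomial in the functions `χ i`. -/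
theorem exists_sub_aeval_chi_mem [Fintype κ] (hΦ : S.IsFan Φ) (f : pwPoly Φ) :
    ∃ d : MvPolynomial ι ℝ, f - MvPolynomial.aeval hΦ.chi d ∈ augIdeal Φ := by
  obtain ⟨v, hv⟩ := S.exists_generic
  obtain ⟨a, ha, hfa⟩ := hΦ.exists_eq_sum_mul_prodChi hv f.2
  have hfa' : f = ∑ p, (⟨a p, polyFns_le Φ (ha p)⟩ : pwPoly Φ) * hΦ.prodChi (S.up v p) := by
    apply Subtype.ext
    rw [hfa, ← Subalgebra.coe_val, map_sum]
    rfl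
  refine ⟨∑ p, MvPolynomial.C (a p 0) * ∏ i ∈ S.up v p, MvPolynomial.X i, ?_⟩
  rw [hfa', map_sum, ← Finset.sum_sub_distrib]
  refine sum_mem fun p _ => ?_
  rw [map_mul, ← prodChi_eq_aeval, ← sub_mul]
  refine Ideal.mul_mem_right _ _ ?_
  have hc : algebraMap ℝ (V → ℝ) (a p 0) ∈ polyFns V := Subalgebra.algebraMap_mem _ _
  convert mem_augIdeal Φ (sub_mem (ha p) hc) (sub_self _) using 1
  apply Subtype.ext
  simp

variable [FiniteDimensional ℝ V] [Fintype κ] {Ω : V [⋀^Fin (finrank ℝ V)]→ₗ[ℝ] ℝ}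

/-- Brion's functional on polynomials in the `χ i` is Timorin's functional. -/
theorem zetaZero_aeval_chi (hΦ : S.IsFan Φ) (hΩ : Ω ≠ 0) (d : MvPolynomial ι ℝ) :
    hΦ.zetaZero hΩ (MvPolynomial.aeval hΦ.chi d) =
      MvPolynomial.constantCoeff (diffHom d (volPoly Ω (S.face S.h ∅) ξ)) := by
  rw [← MvPolynomial.sum_homogeneousComponent d]
  simp only [map_sum, LinearMap.sum_apply]
  refine Finset.sum_congr rfl fun m _ => ?_
  have hd := MvPolynomial.homogeneousComponent_isHomogeneous m d
  by_cases hm : m ≤ finrank ℝ V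
  · exact congrFun (hΦ.zeta_eq hΩ (hΦ.isZeta_aeval_chi hΩ hd hm)) 0
  · obtain ⟨v, hv⟩ := S.exists_generic
    rw [hΦ.zetaZero_eq_zero_of_mem_pwHomog hΩ (hΦ.aeval_chi_mem_pwHomog hd) (by omega),
      S.constantCoeff_diffHom_volPoly hΩ hv hd, if_neg (by omega)]

theorem zetaZero_mul_eq (hΦ : S.IsFan Φ) (hΩ : Ω ≠ 0) {f g f' g' : pwPoly Φ}
    (hf : f - f' ∈ augIdeal Φ) (hg : g - g' ∈ augIdeal Φ) :
    hΦ.zetaZero hΩ (f * g) = hΦ.zetaZero hΩ (f' * g') := by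
  rw [← sub_eq_zero, ← map_sub]
  refine hΦ.zetaZero_eq_zero hΩ ?_
  rw [show f * g - f' * g' = g * (f - f') + f' * (g - g') by ring]
  exact add_mem (Ideal.mul_mem_left _ _ hf) (Ideal.mul_mem_left _ _ hg)

theorem mem_augIdeal_of_zetaZero_aeval (hΦ : S.IsFan Φ) (hΩ : Ω ≠ 0) {f : pwPoly Φ}
    (hf : ∀ (k : ℕ) (e : MvPolynomial ι ℝ), e.IsHomogeneous k →
      hΦ.zetaZero hΩ (f * MvPolynomial.aeval hΦ.chi e) = 0) : f ∈ augIdeal Φ := by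
  refine hΦ.mem_augIdeal_of_zetaZero hΩ fun g => ?_
  obtain ⟨e, he⟩ := hΦ.exists_sub_aeval_chi_mem g
  rw [hΦ.zetaZero_mul_eq hΩ (f' := f) (by simp) he, ← MvPolynomial.sum_homogeneousComponent e,
    map_sum, Finset.mul_sum, map_sum]
  exact Finset.sum_eq_zero fun k _ =>
    hf k _ (MvPolynomial.homogeneousComponent_isHomogeneous k e)

theorem aeval_chi_mem_augIdeal_iff (hΦ : S.IsFan Φ) (hΩ : Ω ≠ 0) (d : MvPolynomial ι ℝ) :
    MvPolynomial.aeval hΦ.chi d ∈ augIdeal Φ ↔ d ∈ annIdeal (volPoly Ω (S.face S.h ∅) ξ) := by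
  refine ⟨fun h => eq_zero_of_constantCoeff_diffHom fun e => ?_, fun h => ?_⟩
  · rw [← diffHom_mul, ← hΦ.zetaZero_aeval_chi hΩ, map_mul]
    exact hΦ.zetaZero_eq_zero hΩ (Ideal.mul_mem_left _ _ h)
  · refine hΦ.mem_augIdeal_of_zetaZero_aeval hΩ fun k e _ => ?_
    rw [← map_mul, hΦ.zetaZero_aeval_chi hΩ, mul_comm, diffHom_mul,
      show diffHom d (volPoly Ω (S.face S.h ∅) ξ) = 0 from h, map_zero, map_zero]

/-- The polytope algebra and the cohomology of the fan are both quotients of the polynomial ring by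
the kernel of the same pairing. -/
theorem exists_algEquiv (hΦ : S.IsFan Φ) (hΩ : Ω ≠ 0) :
    ∃ β : PolyAlg Ω (S.face S.h ∅) ξ ≃ₐ[ℝ] Coh Φ, ∀ d : MvPolynomial ι ℝ,
      β (Ideal.Quotient.mk _ d) = Ideal.Quotient.mk _ (MvPolynomial.aeval hΦ.chi d) := by
  let ψ : MvPolynomial ι ℝ →ₐ[ℝ] Coh Φ :=
    (Ideal.Quotient.mkₐ ℝ (augIdeal Φ)).comp (MvPolynomial.aeval hΦ.chi)
  have hψ : ∀ d, ψ d = Ideal.Quotient.mk _ (MvPolynomial.aeval hΦ.chi d) := fun d => rfl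
  have hsurj : Function.Surjective ψ := fun x => by
    obtain ⟨f, rfl⟩ := Ideal.Quotient.mk_surjective x
    obtain ⟨d, hd⟩ := hΦ.exists_sub_aeval_chi_mem f
    exact ⟨d, (Ideal.Quotient.eq.2 hd).symm⟩
  have hker : annIdeal (volPoly Ω (S.face S.h ∅) ξ) = RingHom.ker ψ := by
    ext d
    rw [RingHom.mem_ker, hψ, Ideal.Quotient.eq_zero_iff_mem, hΦ.aeval_chi_mem_augIdeal_iff hΩ]
  exact ⟨(Ideal.quotientEquivAlgOfEq ℝ hker).trans (Ideal.quotientKerAlgEquivOfSurjective hsurj),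
    fun d => rfl⟩

/-- A homogeneous piecewise polynomial function is congruent to a homogeneous polynomial in the
functions `χ i`. -/
theorem exists_isHomogeneous_sub_mem (hΦ : S.IsFan Φ) (hΩ : Ω ≠ 0) {f : pwPoly Φ} {k : ℕ}
    (hf : f ∈ pwHomog Φ k) :
    ∃ d : MvPolynomial ι ℝ, d.IsHomogeneous k ∧
      f - MvPolynomial.aeval hΦ.chi d ∈ augIdeal Φ := by
  obtain ⟨d, hd⟩ := hΦ.exists_sub_aeval_chi_mem f
  have hcomp := fun j => MvPolynomial.homogeneousComponent_isHomogeneous (R := ℝ) j d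
  refine ⟨_, hcomp k, hΦ.mem_augIdeal_of_zetaZero_aeval hΩ fun l e he => ?_⟩
  have hzero : ∀ {g : pwPoly Φ} {j : ℕ}, g ∈ pwHomog Φ j → j + l ≠ finrank ℝ V →
      hΦ.zetaZero hΩ (g * MvPolynomial.aeval hΦ.chi e) = 0 := fun hg h =>
    hΦ.zetaZero_eq_zero_of_mem_pwHomog hΩ (mul_mem_pwHomog hg (hΦ.aeval_chi_mem_pwHomog he)) h
  rw [sub_mul, map_sub, sub_eq_zero]
  by_cases hkl : k + l = finrank ℝ V
  · rw [hΦ.zetaZero_mul_eq hΩ hd (g' := MvPolynomial.aeval hΦ.chi e) (by simp)]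
    conv_lhs => rw [← MvPolynomial.sum_homogeneousComponent d]
    rw [map_sum, Finset.sum_mul, map_sum]
    refine Finset.sum_eq_single k (fun j _ hj => ?_) fun hk => ?_
    · exact hzero (hΦ.aeval_chi_mem_pwHomog (hcomp j)) (by omega)
    · rw [Finset.mem_range, not_lt] at hk
      rw [MvPolynomial.homogeneousComponent_eq_zero _ _ (by omega), map_zero, zero_mul, map_zero]
  · rw [hzero hf hkl, hzero (hΦ.aeval_chi_mem_pwHomog (hcomp k)) hkl]

end IsFan

/-- The assertions about a polytope whose normal fan is the given fan. -/
theorem exists_natural_algEquiv [FiniteDimensional ℝ V] [Fintype κ]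
    {Ω : V [⋀^Fin (finrank ℝ V)]→ₗ[ℝ] ℝ} (hΩ : Ω ≠ 0) {P : Set (Dual ℝ V)}
    (hP : S.face S.h ∅ = P) (hΦ : S.IsFan (normalFan P)) :
    ∃ β : PolyAlg Ω P ξ ≃ₐ[ℝ] Coh (normalFan P),
      (∀ i, ∃ χ ∈ pwHomog (normalFan P) 1,
        (∀ j, (χ : V → ℝ) (ξ j) = if j = i then 1 else 0) ∧
        β (del Ω P ξ i) = Ideal.Quotient.mk _ χ) ∧
      (∀ k, (gradedA Ω P ξ k).map β.toLinearMap = gradedH (normalFan P) k) ∧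
      β (lefschetz Ω P ξ) = Ideal.Quotient.mk _ (supportPw P) ∧
      ∀ a b, pairingT Ω P ξ a b = pairingB Ω (normalFan P) (β a) (β b) := by
  subst hP
  obtain ⟨β, hβ⟩ := hΦ.exists_algEquiv hΩ
  have hβX : ∀ i, β (del Ω (S.face S.h ∅) ξ i) = Ideal.Quotient.mk _ (hΦ.chi i) := fun i => by
    rw [del, hβ, MvPolynomial.aeval_X]
  refine ⟨β, fun i => ⟨hΦ.chi i, hΦ.chi_mem_pwHomog i, S.chi_xi i, hβX i⟩, fun k => ?_, ?_,
    fun a b => ?_⟩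
  · refine le_antisymm ?_ ?_
    · rintro _ ⟨_, ⟨d, hd, rfl⟩, rfl⟩
      exact ⟨_, hΦ.aeval_chi_mem_pwHomog hd, (hβ d).symm⟩
    · rintro _ ⟨f, hf, rfl⟩
      obtain ⟨d, hd, hfd⟩ := hΦ.exists_isHomogeneous_sub_mem hΩ hf
      exact ⟨_, ⟨d, hd, rfl⟩, (hβ d).trans (Ideal.Quotient.eq.2 hfd).symm⟩
  · have hsup := S.supports_face S.adm_h
    rw [lefschetz, map_sum]
    simp only [map_smul, hβX]
    have : supportPw (S.face S.h ∅) = ∑ i, supportFn (S.face S.h ∅) (ξ i) • hΦ.chi i := by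
      apply Subtype.ext
      funext v
      rw [← Subalgebra.coe_val, map_sum, Finset.sum_apply]
      simp only [hsup.supportFn_xi]
      exact hsup.supportFn_eq v
    rw [this, map_sum]
    rfl
  · obtain ⟨d, rfl⟩ := Ideal.Quotient.mk_surjective a
    obtain ⟨e, rfl⟩ := Ideal.Quotient.mk_surjective b
    rw [pairingT, pairingB, ← map_mul β, ← map_mul, hβ, hΦ.zetaBar_mk hΩ, hΦ.zetaZero_aeval_chi hΩ]
    rfl

theorem isFan_normalFan [FiniteDimensional ℝ V] {P : Set (Dual ℝ V)} (hP : IsPolytope P)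
    {S : SimpleFan ξ {p // IsFace P {p}}}
    (hS : ∀ p v, v ∈ S.cone p ↔ p.1 ∈ faceAt P v) : S.IsFan (normalFan P) := by
  have hmem : ∀ p : {p // IsFace P {p}}, p.1 ∈ P := fun p => by
    obtain ⟨-, v, hv⟩ := p.2
    exact (hv ▸ Set.mem_singleton _ : p.1 ∈ faceAt P v).1
  have hcone : ∀ p : {p // IsFace P {p}}, S.cone p = normalCone P {p.1} := fun p => by
    ext v
    simp [hS, faceAt, normalCone, hmem p]
  have hsub : ∀ F, IsFace P F → ∃ p : {p // IsFace P {p}}, p.1 ∈ F ∧ normalCone P F ⊆ S.cone p := by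
    rintro _ ⟨-, v, rfl⟩
    obtain ⟨p, hp, hpv⟩ := hP.exists_vertex_mem_faceAt v
    refine ⟨⟨p, hpv⟩, hp, ?_⟩
    rw [hcone]
    rintro u hu f rfl y hy
    exact hu f hp y hy
  refine ⟨fun p => ⟨_, p.2, hcone p⟩, ?_, ?_⟩
  · rintro _ ⟨F, hF, rfl⟩
    exact (hsub F hF).imp fun p hp => hp.2
  · refine Set.Subset.antisymm ?_ ?_
    · rintro _ ⟨⟨F, hF, rfl⟩, hdim⟩
      obtain ⟨p, hpF, -⟩ := hsub F hF
      have hFp : F = {p.1} := by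
        refine Set.eq_singleton_iff_unique_mem.2 ⟨hpF, fun f hf => ?_⟩
        by_contra hne
        have hFP : F ⊆ P := by
          obtain ⟨-, v, rfl⟩ := hF
          exact faceAt_subset P v
        -- two points of the face force the normal cone into a hyperplane
        have hle : Submodule.span ℝ (normalCone P F) ≤ LinearMap.ker (f - p.1) := by
          rw [Submodule.span_le]
          intro v hv
          have h1 := hv f hf p.1 (hmem p)
          have h2 := hv p.1 hpF f (hFP hf)
          rw [← neg_sub, LinearMap.neg_apply] at h2
          exact le_antisymm (by linarith) h1
        have h1 := Submodule.finrank_mono hle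
        have h2 := Module.Dual.finrank_ker_add_one_of_ne_zero (sub_ne_zero.2 hne)
        rw [dimC] at hdim
        omega
      exact ⟨p, by rw [hcone, hFp]⟩
    · rintro _ ⟨p, rfl⟩
      exact ⟨⟨_, p.2, hcone p⟩, S.dimC_cone p⟩

end SimpleFan

end PolytopeAlgebra

open Module PolytopeAlgebra in
theorem theorem4p16 {V : Type*} [AddCommGroup V] [Module ℝ V] [FiniteDimensional ℝ V]
    (Ω : V [⋀^Fin (finrank ℝ V)]→ₗ[ℝ] ℝ) (hΩ : Ω ≠ 0)
    (P : Set (Dual ℝ V)) (hP : IsSimplePolytope P)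
    {ι : Type*} [Fintype ι] [DecidableEq ι] (ξ : ι → V) (hξ : IsFacetNormals P ξ) :
    -- the support numbers are linear coordinates on the space of virtual polytopes, and in
    -- these coordinates the volume is a homogeneous polynomial
    Function.Bijective (fun (h : virtualPolytopes P) (i : ι) => (h : V → ℝ) (ξ i)) ∧
    IsVolumePolynomial Ω P ξ (volPoly Ω P ξ) ∧
    -- the functional of Brion takes values in polynomials and descends to the quotient
    (∀ f : pwPoly (normalFan P),
      IsZeta Ω (normalFan P) f (zeta Ω (normalFan P) f) ∧
      zetaBar Ω (normalFan P) (Ideal.Quotient.mk _ f) = zeta Ω (normalFan P) f 0) ∧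
    -- the natural isomorphism
    ∃ β : PolyAlg Ω P ξ ≃ₐ[ℝ] Coh (normalFan P),
      (∀ i, ∃ χ ∈ pwHomog (normalFan P) 1,
        (∀ j, (χ : V → ℝ) (ξ j) = if j = i then 1 else 0) ∧
        β (del Ω P ξ i) = Ideal.Quotient.mk _ χ) ∧
      (∀ k, (gradedA Ω P ξ k).map β.toLinearMap = gradedH (normalFan P) k) ∧
      β (lefschetz Ω P ξ) = Ideal.Quotient.mk _ (supportPw P) ∧
      ∀ a b, pairingT Ω P ξ a b = pairingB Ω (normalFan P) (β a) (β b) := by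
  have := hP.isPolytope.finite_vertices
  have := Fintype.ofFinite {p // IsFace P {p}}
  obtain ⟨S, -, hpt, hcone⟩ := hP.exists_simpleFan hξ
  have hΦ := SimpleFan.isFan_normalFan hP.isPolytope hcone
  have hface : S.face S.h ∅ = P := by
    refine Eq.trans ?_ hP.isPolytope.eq_convexHull_vertices
    rw [SimpleFan.face]
    congr 1
    ext p
    simp [hpt]
  refine ⟨?_, ?_, fun f => ⟨hΦ.isZeta_zeta hΩ f, hΦ.zetaBar_mk hΩ f⟩,
    SimpleFan.exists_natural_algEquiv hΩ hface hΦ⟩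
  · have h := S.bijective_supportNumbers
    rwa [hface] at h
  · have h := S.isVolumePolynomial_volPoly hΩ
    rwa [hface] at h
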